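/- Let $n\in\{2,3\}$, let $\Omega\subset\mathbb R^n$ be a bounded domain with $C^6$ boundary $\Gamma$, outward unit normal $\nu$ and surface measure $ds$. Let $0<\eta<\operatorname{diam}\Omega$, $k_1>0$, $\Omega_\eta=\{x\in\Omega:\operatorname{dist}(x,\Gamma)>\eta\}$, and let $\sigma_0\in W^{2,\infty}(\Omega)$ satisfy $\sigma_0\ge k_1$ a.e. in $\Omega\setminus\overline{\Omega_\eta}$. Let $g\in H^{7/2}(\Gamma)$ with $\int_\Gamma g\,ds=0$, and let $U^\delta\in H^5(\Omega)$ be any function with $\int_\Omega U^\delta\,dx=0$ and $\sigma_0\,\partial_\nu U^\delta=g$ on $\Gamma$. Put $\beta=\nabla U^\delta$ (continuous on $\overline\Omega$), $\Gamma_{\rm in}=\{x\in\Gamma:\beta\cdot\nu<0\}$, $\Gamma_{\rm out}=\{x\in\Gamma:\beta\cdot\nu>0\}$ (equivalently $g<0$, respectively $g>0$), and assume that $$\operatorname{dist}(\Gamma_{\rm in},\Gamma_{\rm out})>0$$ (a condition that is regarded as satisfied when one of the two sets is empty). Let $$V=\{v\in L^2(\Omega):\ \beta\cdot\nabla v\in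 L^2(\Omega)\},\qquad \|v\|_V^2=\|v\|_{L^2(\Omega)}^2+\|\beta\cdot\nabla v\|_{L^2(\Omega)}^2,$$ with $\beta\cdot\nabla v$ taken in the sense of distributions. Then every $v\in V$ has a unique trace in $L^2(|\beta\cdot\nu|;\Gamma)$: there is exactly one $t\in L^2(|\beta\cdot\nu|;\Gamma)$ for which there are functions $\varphi_k$, restrictions to $\overline\Omega$ of smooth functions on $\mathbb R^n$, with $\varphi_k\to v$ in $V$ and $\varphi_k|_\Gamma\to t$ in $L^2(|\beta\cdot\nu|;\Gamma)$. Write $v$ also for this trace, let $r^\ominus=\frac12(|r|-r)$ and $\gamma_0=\sqrt{\sigma_0}$ on $\Gamma$. For every $\varepsilon\in(0,1)$ the regularized transport problem $$\beta\cdot\nabla\gamma+\bigl(\tfrac12\Delta U^\delta+\varepsilon\bigr)\gamma=0\ \text{ in }\Omega,\qquad \gamma=\gamma_0\ \text{ on }\Gamma_{\rm in},$$ has exactly one weak solution $\gamma^\delta_\varepsilon\in V$; that is, there is exactly one $\gamma^\delta_\varepsilon\in V$ such that, for all $w\in V$, $$\int_\Omega\Bigl(\beta\cdot\nabla \gamma^\delta_\varepsilon+\bigl(\tfrac12\Delta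 U^\delta+\varepsilon\bigr)\gamma^\delta_\varepsilon\Bigr)w\,dx+\int_\Gamma(\beta\cdot\nu)^\ominus\,\gamma^\delta_\varepsilon\,w\,ds=\int_\Gamma(\beta\cdot\nu)^\ominus\,\gamma_0\,w\,ds .$$ -/

import Mathlib

open MeasureTheory Filter Topology Set
open scoped ENNReal ContDiff RealInnerProductSpace

noncomputable section

namespace Transport

/-- Euclidean space `ℝⁿ`. -/
abbrev E (n : ℕ) : Type := EuclideanSpace ℝ (Fin n)

variable {n : ℕ}

/-! ### Domains with `C⁶` boundary -/

/-- `Ω` is a bounded domain of `ℝⁿ` (open, connected, non-empty) with `C⁶` boundary: in a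
neighbourhood of every boundary point it is, in the direction of some unit vector `e`, the strict
subgraph of a `C⁶` function of the coordinates orthogonal to `e`. -/
structure IsC6Domain (Ω : Set (E n)) : Prop where
  isOpen : IsOpen Ω
  isConnected : IsConnected Ω
  isBounded : Bornology.IsBounded Ω
  boundary : ∀ x ∈ frontier Ω, ∃ (e : E n) (h : E n → ℝ), ‖e‖ = 1 ∧ ContDiff ℝ 6 h ∧
    ∀ᶠ y in 𝓝 x, (y ∈ Ω ↔ ⟪e, y⟫ < h (y - ⟪e, y⟫ • e))

/-- `v` is the unit outward normal to `Ω` at `x`: `‖v‖ = 1`, and in every cone strictly inside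
the half space `⟪v, y - x⟫ < 0` (respectively `> 0`) all points near `x` are in `Ω`
(respectively not in `Ω`). There is at most one such vector. -/
def IsOutwardNormal (Ω : Set (E n)) (x v : E n) : Prop :=
  ‖v‖ = 1 ∧ ∀ c : ℝ, 0 < c → ∀ᶠ y in 𝓝 x,
    (⟪v, y - x⟫ < -(c * ‖y - x‖) → y ∈ Ω) ∧ (c * ‖y - x‖ < ⟪v, y - x⟫ → y ∉ Ω)

open Classical in
/-- The unit outward normal field `ν` on the boundary. -/
def outwardNormal (Ω : Set (E n)) (x : E n) : E n :=
  if h : ∃ v, IsOutwardNormal Ω x v then h.choose else 0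

/-- The surface measure `ds` on `Γ = ∂Ω`: the `(n-1)`-dimensional Hausdorff measure, normalised
to agree with Lebesgue measure on hyperplanes. -/
def surface (Ω : Set (E n)) : Measure (E n) :=
  (Measure.euclideanHausdorffMeasure (n - 1)).restrict (frontier Ω)

/-! ### Weak derivatives, Sobolev spaces, boundary values -/

/-- Test functions `C_c^∞(Ω)`. -/
def IsTest (Ω : Set (E n)) (φ : E n → ℝ) : Prop :=
  ContDiff ℝ ∞ φ ∧ HasCompactSupport φ ∧ tsupport φ ⊆ Ω

/-- `g` is the weak partial derivative `∂ᵢ f` in `Ω`. -/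
def HasWeakPartial (Ω : Set (E n)) (i : Fin n) (f g : E n → ℝ) : Prop :=
  LocallyIntegrableOn f Ω ∧ LocallyIntegrableOn g Ω ∧
    ∀ φ, IsTest Ω φ → ∫ x in Ω, f x * gradient φ x i = -∫ x in Ω, g x * φ x

open Classical in
/-- The weak partial derivative `∂ᵢ f` in `Ω` (unique almost everywhere when it exists). -/
def weakPartial (Ω : Set (E n)) (i : Fin n) (f : E n → ℝ) : E n → ℝ :=
  if h : ∃ g, HasWeakPartial Ω i f g then h.choose else 0

/-- The Sobolev space `W^{k,p}(Ω)`: `f` and all its weak derivatives up to order `k` are in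
`L^p(Ω)`. The space `H^k(Ω)` is `W^{k,2}(Ω)`. -/
def MemSobolev (Ω : Set (E n)) (p : ℝ≥0∞) : ℕ → (E n → ℝ) → Prop
  | 0, f => MemLp f p (volume.restrict Ω)
  | k + 1, f => MemLp f p (volume.restrict Ω) ∧
      ∀ i, ∃ g, HasWeakPartial Ω i f g ∧ MemSobolev Ω p k g

open Classical in
/-- The continuous representative on `closure Ω` of a function on `Ω` that is given up to null
sets. For an open set `Ω` its values on `closure Ω` are unique when it exists. -/
def contRep (Ω : Set (E n)) (f : E n → ℝ) : E n → ℝ :=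
  if h : ∃ F : E n → ℝ, ContinuousOn F (closure Ω) ∧ F =ᵐ[volume.restrict Ω] f
  then h.choose else 0

/-- `g ∈ H^{7/2}(Γ)`: `g` is the boundary trace of a function in `H⁴(Ω)`. (Such functions are
continuous on `closure Ω` in dimensions two and three.) -/
def MemH72Boundary (Ω : Set (E n)) (g : E n → ℝ) : Prop :=
  ∃ G, MemSobolev Ω 2 4 G ∧ ∀ᵐ x ∂(surface Ω), g x = contRep Ω G x

/-! ### The transport operator attached to a potential `U` -/

/-- The velocity field `β = ∇U` on `closure Ω`. -/
def velocity (Ω : Set (E n)) (U : E n → ℝ) (x : E n) : E n :=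
  WithLp.toLp 2 (fun i => contRep Ω (weakPartial Ω i U) x)

/-- The Laplacian `ΔU = div β` in `Ω`, in the weak sense. -/
def lap (Ω : Set (E n)) (U : E n → ℝ) (x : E n) : ℝ :=
  ∑ i, weakPartial Ω i (weakPartial Ω i U) x

/-- The normal velocity `β · ν = ∂_ν U` on `Γ`. -/
def normalVelocity (Ω : Set (E n)) (U : E n → ℝ) (x : E n) : ℝ :=
  ⟪velocity Ω U x, outwardNormal Ω x⟫

/-- The inflow boundary. -/
def inflow (Ω : Set (E n)) (U : E n → ℝ) : Set (E n) :=
  {x ∈ frontier Ω | normalVelocity Ω U x < 0}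

/-- The outflow boundary. -/
def outflow (Ω : Set (E n)) (U : E n → ℝ) : Set (E n) :=
  {x ∈ frontier Ω | 0 < normalVelocity Ω U x}

/-- The inflow and outflow boundaries are at positive distance (this holds when one of them is
empty). -/
def WellSeparated (Ω : Set (E n)) (U : E n → ℝ) : Prop :=
  ∃ d : ℝ, 0 < d ∧ ∀ x ∈ inflow Ω U, ∀ y ∈ outflow Ω U, d ≤ dist x y

/-- `f = β · ∇v` in the sense of distributions in `Ω`, that is,
`∫_Ω f φ = -∫_Ω v div(φ β)` for all test functions `φ`, where `div(φ β) = β · ∇φ + (ΔU) φ`. -/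
def HasTransportDeriv (Ω : Set (E n)) (U v f : E n → ℝ) : Prop :=
  ∀ φ, IsTest Ω φ → ∫ x in Ω, f x * φ x =
    -∫ x in Ω, v x * (⟪velocity Ω U x, gradient φ x⟫ + lap Ω U x * φ x)

/-- The graph space `V = {v ∈ L²(Ω) : β · ∇v ∈ L²(Ω)}`. -/
def MemGraph (Ω : Set (E n)) (U v : E n → ℝ) : Prop :=
  MemLp v 2 (volume.restrict Ω) ∧
    ∃ f, MemLp f 2 (volume.restrict Ω) ∧ HasTransportDeriv Ω U v f

open Classical in
/-- The function `β · ∇v ∈ L²(Ω)` for `v ∈ V` (unique almost everywhere). -/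
def transportDeriv (Ω : Set (E n)) (U v : E n → ℝ) : E n → ℝ :=
  if h : ∃ f, MemLp f 2 (volume.restrict Ω) ∧ HasTransportDeriv Ω U v f then h.choose else 0

/-- The measure `|β · ν| ds` on `Γ`. -/
def weightedSurface (Ω : Set (E n)) (U : E n → ℝ) : Measure (E n) :=
  (surface Ω).withDensity (fun x => ENNReal.ofReal |normalVelocity Ω U x|)

/-- `t ∈ L²(|β · ν|; Γ)` is the trace of `v ∈ V`: there are functions `φ k`, smooth up to the
boundary, with `φ k → v` in the norm of `V` and `φ k → t` in `L²(|β · ν|; Γ)`. In other words, the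
trace is the extension by continuity to `V` of the restriction map `φ ↦ φ|_Γ`. -/
def IsTrace (Ω : Set (E n)) (U v t : E n → ℝ) : Prop :=
  MemLp t 2 (weightedSurface Ω U) ∧
  ∃ φ : ℕ → E n → ℝ, (∀ k, ContDiff ℝ ∞ (φ k)) ∧
    Tendsto (fun k => eLpNorm (fun x => φ k x - v x) 2 (volume.restrict Ω)) atTop (𝓝 0) ∧
    Tendsto (fun k => eLpNorm
      (fun x => ⟪velocity Ω U x, gradient (φ k) x⟫ - transportDeriv Ω U v x) 2
      (volume.restrict Ω)) atTop (𝓝 0) ∧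
    Tendsto (fun k => eLpNorm (fun x => φ k x - t x) 2 (weightedSurface Ω U)) atTop (𝓝 0)

open Classical in
/-- The trace of `v ∈ V` on `Γ`. -/
def trace (Ω : Set (E n)) (U v : E n → ℝ) : E n → ℝ :=
  if h : ∃ t, IsTrace Ω U v t then h.choose else 0

/-- The negative part `(β · ν)^⊖ = (|β · ν| - β · ν) / 2`. -/
def inflowWeight (Ω : Set (E n)) (U : E n → ℝ) (x : E n) : ℝ :=
  (|normalVelocity Ω U x| - normalVelocity Ω U x) / 2

/-- The bilinear form
`a(v, w) = ∫_Ω (β · ∇v + (½ ΔU + ε) v) w dx + ∫_Γ (β · ν)^⊖ v w ds`. -/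
def bilin (Ω : Set (E n)) (U : E n → ℝ) (ε : ℝ) (v w : E n → ℝ) : ℝ :=
  (∫ x in Ω, (transportDeriv Ω U v x + (1 / 2 * lap Ω U x + ε) * v x) * w x) +
    ∫ x, inflowWeight Ω U x * trace Ω U v x * trace Ω U w x ∂(surface Ω)

/-- `v ∈ V` is a weak solution of `β · ∇v + (½ ΔU + ε) v = 0` in `Ω` with `v = √σ₀` on the inflow
boundary: `a(v, w) = ∫_Γ (β · ν)^⊖ √σ₀ w ds` for all `w ∈ V`. -/
def IsWeakSolution (Ω : Set (E n)) (U σ₀ : E n → ℝ) (ε : ℝ) (v : E n → ℝ) : Prop :=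
  MemGraph Ω U v ∧ ∀ w, MemGraph Ω U w →
    bilin Ω U ε v w =
      ∫ x, inflowWeight Ω U x * √(contRep Ω σ₀ x) * trace Ω U w x ∂(surface Ω)

/-- The inner region `Ω_η = {x ∈ Ω : dist(x, Γ) > η}`. -/
def innerRegion (Ω : Set (E n)) (η : ℝ) : Set (E n) :=
  {x ∈ Ω | η < Metric.infDist x (frontier Ω)}

end Transport

end

noncomputable section

namespace Transport

variable {n : ℕ}

/-! ### Tangent cones and the normal field -/

/-! The theorem is a Lax–Milgram type argument in the graph space of the transport operator. Its
coercivity is only in `L²(Ω)` and in the trace norm, not in the norm of `V`, so existence goes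
through a closed-range argument instead.

The central identity is Green's formula `∫ (β·∇v) w + v (β·∇w) + ΔU v w = ∫_Γ (β·ν) v w`. Since
inflow and outflow are at positive distance, there is a smooth `χ` with `|β·ν| χ = β·ν` on `Γ`.
Inserting `w = χ v` turns the right side into `∫_Γ |β·ν| v²`, which bounds the trace of a smooth
function by its norm in `V` (`exists_trace_bound`). As smooth functions are dense in `V`, every `v ∈
V` has exactly one trace. Inserting `w = v` instead gives `a(v,v) = ε ‖v‖² + ½ ‖v‖²_Γ`, hence
uniqueness.

For existence, consider the operator sending `v` to the pair consisting of `β·∇v + (½ΔU + ε) v` and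
the inflow part of the trace. Coercivity, with the equation itself used to recover `β·∇v`, makes it
bounded below, so its range is closed. If a pair `(w, r)` is orthogonal to the range, then `w`
solves the adjoint equation, hence lies in `V`. Testing with `½(1+χ) w` shows that the outflow trace
of `w` vanishes, and Green's formula then forces `w = 0`. Projecting the data onto the range
therefore gives a weak solution (`GraphSpace.exists_form_eq`).

Density of smooth functions uses one-sided mollifiers: near each point of the closure a cone of
directions points into `Ω`, so convolution with a kernel supported in that cone commutes with weak
derivatives up to the boundary. Friedrichs' lemma (`ConeAt.tendsto_commutator`) controls the
commutator with `β·∇`; it needs `β` Lipschitz along the cone and `ΔU` bounded. Both follow from the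
embedding of `H²` into continuous functions for `n ≤ 3`, proved by differentiating mollifications in
their scale.

The divergence theorem is proved without charts that straighten the boundary. At small scales the
boundary lies within a thin cone around its tangent plane; the normal flux is computed by Fubini,
the tangential flux is small by a translation argument, and the relative error tends to zero with
the scale. Approximation by smoothings extends it to the Sobolev field `β`. -/

/-- The boundary of `Ω` is flat at `x`, with outward direction `a`: at small scales, `closure Ω`
is stable under moving in directions that make an angle bounded away from `π / 2` with `-a`. -/
def IsFlatAt (Ω : Set (E n)) (x a : E n) : Prop :=
  ‖a‖ = 1 ∧ ∀ ε : ℝ, 0 < ε → ∃ r : ℝ, 0 < r ∧ ∀ y ∈ Metric.ball x r, ∀ z ∈ Metric.ball x r,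
    y ∈ closure Ω → y ≠ z → ⟪a, z - y⟫ ≤ -(ε * ‖z - y‖) → z ∈ Ω

/-- The direction is the normalised gradient `p` of the defining function `G`; it is nonzero because
`⟪p, e⟫ = 1`. Strict differentiability, rather than differentiability at `x`, gives an estimate
uniform in both endpoints `y` and `z`. -/
theorem IsC6Domain.exists_isFlatAt {Ω : Set (E n)} (hΩ : IsC6Domain Ω) {x : E n}
    (hx : x ∈ frontier Ω) : ∃ a, IsFlatAt Ω x a := by
  obtain ⟨e, h, he, hh, hiff⟩ := hΩ.boundary x hx
  set G : E n → ℝ := fun y => ⟪e, y⟫ - h (y - ⟪e, y⟫ • e) with hG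
  have hin : ContDiff ℝ 6 fun y : E n => ⟪e, y⟫ := contDiff_const.inner ℝ contDiff_id
  have hGd : ContDiff ℝ 6 G := hin.sub (hh.comp (contDiff_id.sub (hin.smul contDiff_const)))
  have hstr : HasStrictFDerivAt G (fderiv ℝ G x) x :=
    hGd.contDiffAt.hasStrictFDerivAt (by norm_num)
  set p : E n := (InnerProductSpace.toDual ℝ (E n)).symm (fderiv ℝ G x) with hp
  have hpv : ∀ v, ⟪p, v⟫ = fderiv ℝ G x v := fun v => by
    rw [hp, InnerProductSpace.toDual_symm_apply]
  have hee : ⟪e, e⟫ = (1 : ℝ) := by rw [real_inner_self_eq_norm_sq, he]; norm_num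
  have hpe : ⟪p, e⟫ = (1 : ℝ) := by
    rw [hpv]
    have h1 : HasDerivAt (fun s : ℝ => x + s • e) e 0 := by
      simpa using ((hasDerivAt_id (0 : ℝ)).smul_const e).const_add x
    have h2 : HasFDerivAt G (fderiv ℝ G x) (x + (0 : ℝ) • e) := by
      simpa using hstr.hasFDerivAt
    have h3 := h2.comp_hasDerivAt (0 : ℝ) h1
    have h4 : (G ∘ fun s : ℝ => x + s • e) = fun s => G x + s := by
      funext s
      simp only [hG, Function.comp, inner_add_right, inner_smul_right, hee, mul_one]
      have : x + s • e - (⟪e, x⟫ + s) • e = x - ⟪e, x⟫ • e := by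
        rw [add_smul]; abel
      rw [this]; ring
    rw [h4] at h3
    exact h3.unique ((hasDerivAt_id (0 : ℝ)).const_add (G x))
  have hp0 : p ≠ 0 := by
    rintro h0
    rw [h0, inner_zero_left] at hpe
    exact zero_ne_one hpe
  have hpn : 0 < ‖p‖ := norm_pos_iff.2 hp0
  refine ⟨‖p‖⁻¹ • p, by rw [norm_smul, norm_inv, norm_norm, inv_mul_cancel₀ hpn.ne'], ?_⟩
  intro ε hε
  -- The tolerance is half of the descent `ε ‖p‖ ‖z - y‖` of the linear part, so `G z` stays
  -- strictly negative.
  have hlo := (hasStrictFDerivAt_iff_isLittleO.1 hstr).def (c := ε * ‖p‖ / 2) (by positivity)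
  rw [nhds_prod_eq] at hlo
  obtain ⟨r₁, hr₁, H₁⟩ := Metric.eventually_nhds_iff_ball.1
    (by rw [nhds_prod_eq]; exact hlo : ∀ᶠ q : E n × E n in 𝓝 (x, x), _)
  obtain ⟨r₂, hr₂, H₂⟩ := Metric.eventually_nhds_iff_ball.1 hiff
  refine ⟨min r₁ r₂, lt_min hr₁ hr₂, fun y hy z hz hyc hyz hin => ?_⟩
  have hy₁ := Metric.ball_subset_ball (min_le_left r₁ r₂) hy
  have hz₁ := Metric.ball_subset_ball (min_le_left r₁ r₂) hz
  have hy₂ := Metric.ball_subset_ball (min_le_right r₁ r₂) hy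
  have hz₂ := Metric.ball_subset_ball (min_le_right r₁ r₂) hz
  -- The set `G > 0` is open and misses `Ω` near `x`, so it misses the closure as well.
  have hGy : G y ≤ 0 := by
    by_contra hpos
    push Not at hpos
    have ho : IsOpen (Metric.ball x r₂ ∩ {y | 0 < G y}) :=
      Metric.isOpen_ball.inter (isOpen_lt continuous_const hGd.continuous)
    obtain ⟨w, ⟨hw₁, hw₂⟩, hwΩ⟩ := mem_closure_iff.1 hyc _ ho ⟨hy₂, hpos⟩
    have := (H₂ w hw₁).1 hwΩ
    simp only [hG, mem_ofPred_eq] at hw₂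
    linarith
  have hdist : 0 < ‖z - y‖ := norm_pos_iff.2 (sub_ne_zero.2 hyz.symm)
  have hmem : (z, y) ∈ Metric.ball (x, x) r₁ := by
    rw [Metric.mem_ball, Prod.dist_eq]
    exact max_lt hz₁ hy₁
  have key := H₁ _ hmem
  simp only [Real.norm_eq_abs] at key
  have key' := (abs_le.1 key).2
  rw [← hpv] at key'
  rw [inner_smul_left] at hin
  simp only [conj_trivial] at hin
  have hin' : ⟪p, z - y⟫ ≤ -(ε * ‖p‖ * ‖z - y‖) := by
    have := mul_le_mul_of_nonneg_left hin hpn.le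
    rw [← mul_assoc, mul_inv_cancel₀ hpn.ne', one_mul] at this
    linarith
  have hneg : G z < 0 := by
    have : 0 < ε * ‖p‖ * ‖z - y‖ := by positivity
    linarith
  refine (H₂ z hz₂).2 ?_
  simp only [hG] at hneg
  linarith

/-- For distinct unit vectors, the direction `u = w - v` has negative product with `v` and positive
product with `w`. Points `x + s u` would then be inside `Ω` and outside it. -/
theorem IsOutwardNormal.unique {Ω : Set (E n)} {x v w : E n}
    (hv : IsOutwardNormal Ω x v) (hw : IsOutwardNormal Ω x w) : v = w := by
  by_contra hne
  set u := w - v with hu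
  have hun : 0 < ‖u‖ := norm_pos_iff.2 (sub_ne_zero.2 (Ne.symm hne))
  have huu : ‖u‖ ^ 2 = 2 - 2 * ⟪v, w⟫ := by
    rw [hu, norm_sub_sq_real, hw.1, hv.1, real_inner_comm]; ring
  have hvu : ⟪v, u⟫ = -(‖u‖ ^ 2 / 2) := by
    rw [huu, hu, inner_sub_right, real_inner_self_eq_norm_sq, hv.1]; ring
  have hwu : ⟪w, u⟫ = ‖u‖ ^ 2 / 2 := by
    rw [huu, hu, inner_sub_right, real_inner_self_eq_norm_sq, hw.1, real_inner_comm]; ring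
  have h1 := (hv.2 (‖u‖ / 4) (by positivity)).and (hw.2 (‖u‖ / 4) (by positivity))
  have hcont : Tendsto (fun s : ℝ => x + s • u) (𝓝[>] 0) (𝓝 x) := by
    have : Tendsto (fun s : ℝ => x + s • u) (𝓝 0) (𝓝 (x + (0 : ℝ) • u)) :=
      Continuous.tendsto (by fun_prop) 0
    rw [zero_smul, add_zero] at this
    exact this.mono_left nhdsWithin_le_nhds
  obtain ⟨s, ⟨hs1, hs2⟩, hs0⟩ := ((hcont.eventually h1).and self_mem_nhdsWithin).exists
  have hs0 : 0 < s := hs0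
  simp only [add_sub_cancel_left, inner_smul_right, norm_smul, Real.norm_eq_abs, abs_of_pos hs0,
    hvu, hwu] at hs1 hs2
  have hpos : 0 < s * ‖u‖ ^ 2 := by positivity
  exact hs2.2 (by nlinarith) (hs1.1 (by nlinarith))

theorem IsFlatAt.isOutwardNormal {Ω : Set (E n)} (hΩ : IsOpen Ω) {x a : E n}
    (hx : x ∈ frontier Ω) (ha : IsFlatAt Ω x a) : IsOutwardNormal Ω x a := by
  refine ⟨ha.1, fun c hc => ?_⟩
  obtain ⟨r, hr, H⟩ := ha.2 c hc
  have hxΩ : x ∉ Ω := (hΩ.frontier_eq ▸ hx : x ∈ closure Ω \ Ω).2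
  have hxr : x ∈ Metric.ball x r := Metric.mem_ball_self hr
  filter_upwards [Metric.ball_mem_nhds x hr] with y hy
  refine ⟨fun h => ?_, fun h hyΩ => ?_⟩
  · refine H x hxr y hy (frontier_subset_closure hx) ?_ h.le
    rintro rfl
    simp at h
  · refine hxΩ (H y hy x hxr (subset_closure hyΩ) ?_ ?_)
    · rintro rfl
      exact hxΩ hyΩ
    · rw [← neg_sub y x, inner_neg_right, norm_neg]
      linarith

theorem IsC6Domain.isFlatAt_outwardNormal {Ω : Set (E n)} (hΩ : IsC6Domain Ω) {x : E n}
    (hx : x ∈ frontier Ω) : IsFlatAt Ω x (outwardNormal Ω x) := by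
  obtain ⟨a, ha⟩ := hΩ.exists_isFlatAt hx
  have hn := ha.isOutwardNormal hΩ.isOpen hx
  have hex : ∃ v, IsOutwardNormal Ω x v := ⟨a, hn⟩
  have : outwardNormal Ω x = a := by
    rw [outwardNormal, dif_pos hex]
    exact hex.choose_spec.unique hn
  rwa [this]

/-- This is the modulus of continuity of the normal. With `u = b - a` one has `⟪a, u⟫ = -‖u‖² / 2`,
so `‖u‖ > 2 ε` puts `y + s u` into `Ω` by flatness, whereas `⟪b, u⟫ > 0` puts it outside. -/
theorem IsFlatAt.norm_sub_le {Ω : Set (E n)} {x a y b : E n} {ε r : ℝ}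
    (hε : 0 < ε) (ha : ‖a‖ = 1)
    (H : ∀ y ∈ Metric.ball x r, ∀ z ∈ Metric.ball x r,
      y ∈ closure Ω → y ≠ z → ⟪a, z - y⟫ ≤ -(ε * ‖z - y‖) → z ∈ Ω)
    (hy : y ∈ Metric.ball x r) (hyc : y ∈ closure Ω) (hb : IsOutwardNormal Ω y b) :
    ‖b - a‖ ≤ 2 * ε := by
  by_contra hlt
  push Not at hlt
  set u := b - a with hu
  have hun : 0 < ‖u‖ := by linarith
  have huu : ‖u‖ ^ 2 = 2 - 2 * ⟪a, b⟫ := by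
    rw [hu, norm_sub_sq_real, hb.1, ha, real_inner_comm]; ring
  have hau : ⟪a, u⟫ = -(‖u‖ ^ 2 / 2) := by
    rw [huu, hu, inner_sub_right, real_inner_self_eq_norm_sq, ha]; ring
  have hbu : ⟪b, u⟫ = ‖u‖ ^ 2 / 2 := by
    rw [huu, hu, inner_sub_right, real_inner_self_eq_norm_sq, hb.1, real_inner_comm]; ring
  have hcont : Tendsto (fun s : ℝ => y + s • u) (𝓝[>] 0) (𝓝 y) := by
    have : Tendsto (fun s : ℝ => y + s • u) (𝓝 0) (𝓝 (y + (0 : ℝ) • u)) :=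
      Continuous.tendsto (by fun_prop) 0
    rw [zero_smul, add_zero] at this
    exact this.mono_left nhdsWithin_le_nhds
  obtain ⟨s, ⟨hs1, hs2⟩, hs0⟩ := ((hcont.eventually ((hb.2 (‖u‖ / 4) (by positivity)).and
    (Metric.isOpen_ball.mem_nhds hy))).and self_mem_nhdsWithin).exists
  have hs0 : 0 < s := hs0
  have hpos : 0 < s * ‖u‖ ^ 2 := by positivity
  refine hs1.2 ?_ (H y hy _ hs2 hyc ?_ ?_)
  · simp only [add_sub_cancel_left, inner_smul_right, norm_smul, Real.norm_eq_abs, abs_of_pos hs0,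
      hbu]
    nlinarith
  · intro h
    have : s • u = 0 := by simpa using h
    rcases smul_eq_zero.1 this with h | h
    · exact hs0.ne' h
    · rw [h, norm_zero] at hun
      exact lt_irrefl _ hun
  · simp only [add_sub_cancel_left, inner_smul_right, norm_smul, Real.norm_eq_abs, abs_of_pos hs0,
      hau]
    nlinarith [mul_pos hs0 hun]

theorem IsC6Domain.continuousOn_outwardNormal {Ω : Set (E n)} (hΩ : IsC6Domain Ω) :
    ContinuousOn (outwardNormal Ω) (frontier Ω) := by
  intro x hx
  refine Metric.continuousWithinAt_iff.2 fun δ hδ => ?_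
  obtain ⟨r, hr, H⟩ := (hΩ.isFlatAt_outwardNormal hx).2 (δ / 4) (by positivity)
  refine ⟨r, hr, fun y hy hyx => ?_⟩
  have := IsFlatAt.norm_sub_le (by positivity) (hΩ.isFlatAt_outwardNormal hx).1 H hyx
    (frontier_subset_closure hy) ((hΩ.isFlatAt_outwardNormal hy).isOutwardNormal hΩ.isOpen hy)
  rw [dist_eq_norm]
  linarith

theorem exists_finite_partition {K : Set (E n)} (hK : IsCompact K) (r : E n → ℝ)
    (hr : ∀ x ∈ K, 0 < r x) :
    ∃ (s : Finset (E n)) (ψ : E n → E n → ℝ), (∀ c ∈ s, c ∈ K) ∧ (∀ c, ContDiff ℝ ∞ (ψ c)) ∧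
      (∀ c y, 0 ≤ ψ c y) ∧ (∀ c ∈ s, tsupport (ψ c) ⊆ Metric.ball c (r c)) ∧
      ∀ y ∈ K, ∑ c ∈ s, ψ c y = 1 := by
  classical
  obtain ⟨s, hs, hcov⟩ := hK.elim_nhds_subcover (fun x => Metric.ball x (r x))
    (fun x hx => Metric.ball_mem_nhds x (hr x hx))
  obtain ⟨f, hf⟩ := SmoothPartitionOfUnity.exists_isSubordinate (modelWithCornersSelf ℝ (E n))
    hK.isClosed (fun c : s => Metric.ball (c : E n) (r c)) (fun _ => Metric.isOpen_ball)
    (by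
      intro y hy
      obtain ⟨c, hc, hyc⟩ := mem_iUnion₂.1 (hcov hy)
      exact mem_iUnion.2 ⟨⟨c, hc⟩, hyc⟩)
  refine ⟨s, fun c => if hc : c ∈ s then f ⟨c, hc⟩ else 0, hs, fun c => ?_, fun c y => ?_,
    fun c hc => ?_, fun y hy => ?_⟩
  · by_cases hc : c ∈ s
    · simp only [hc, dif_pos]
      exact (f ⟨c, hc⟩).contMDiff.contDiff
    · simp only [hc, dif_neg, not_false_eq_true]
      exact contDiff_const
  · by_cases hc : c ∈ s
    · simp only [hc, dif_pos]
      exact f.nonneg _ _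
    · simp [hc]
  · simp only [hc, dif_pos]
    exact hf ⟨c, hc⟩
  · have := f.sum_eq_one hy
    rw [finsum_eq_sum_of_fintype] at this
    rw [← this, ← Finset.sum_attach s, Finset.univ_eq_attach]
    refine Finset.sum_congr rfl fun c _ => ?_
    simp

/-! ### Cylindrical coordinates -/

/-- Orthogonal coordinates centred at `x` with distinguished direction `a`. -/
def cyl (x a : E n) (q : ℝ × (ℝ ∙ a)ᗮ) : E n := q.1 • a + (q.2 : E n) + x

theorem continuous_cyl (x a : E n) : Continuous (cyl x a) := by
  unfold cyl
  fun_prop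

/-- The orthogonal coordinates as a measurable equivalence. -/
def cylEquiv (x : E n) {a : E n} (ha : ‖a‖ = 1) : (ℝ × (ℝ ∙ a)ᗮ) ≃ᵐ E n :=
  ((LinearIsometryEquiv.toSpanUnitSingleton a ha).toHomeomorph.toMeasurableEquiv.prodCongr
    (MeasurableEquiv.refl _)).trans ((ℝ ∙ a).measurableEquivProd x).symm

theorem cylEquiv_apply (x : E n) {a : E n} (ha : ‖a‖ = 1) (q : ℝ × (ℝ ∙ a)ᗮ) :
    cylEquiv x ha q = cyl x a q := by
  simp only [cylEquiv, MeasurableEquiv.trans_apply, Submodule.measurableEquivProd_symm_apply,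
    vadd_eq_add, cyl]
  rfl

theorem measurePreserving_cylEquiv (x : E n) {a : E n} (ha : ‖a‖ = 1) :
    MeasurePreserving (cylEquiv x ha) (volume.prod volume) volume := by
  have h1 : MeasurePreserving ((ℝ ∙ a).measurableEquivProd x).symm (volume.prod volume)
      (volume : Measure (E n)) := by
    have := ((ℝ ∙ a).measurePreserving_measurableEquivProd x).symm
    rwa [InnerProductSpace.euclideanHausdorffMeasure_eq_volume] at this
  exact ((LinearIsometryEquiv.toSpanUnitSingleton a ha).measurePreserving.prod
    (MeasurePreserving.id _)).trans h1

theorem integral_eq_cyl (x : E n) {a : E n} (ha : ‖a‖ = 1) {F : E n → ℝ} (hF : Integrable F) :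
    ∫ y, F y = ∫ τ : (ℝ ∙ a)ᗮ, ∫ s : ℝ, F (cyl x a (s, τ)) := by
  have hmp := measurePreserving_cylEquiv x ha
  rw [← hmp.integral_comp (cylEquiv x ha).measurableEmbedding]
  rw [integral_prod_symm]
  · simp only [cylEquiv_apply]
  · exact (hmp.integrable_comp_emb (cylEquiv x ha).measurableEmbedding).2 hF

theorem inner_cyl_sub {x a : E n} (ha : ‖a‖ = 1) (q q' : ℝ × (ℝ ∙ a)ᗮ) :
    ⟪a, cyl x a q - cyl x a q'⟫ = q.1 - q'.1 := by
  have h1 : ⟪a, (q.2 : E n)⟫ = (0 : ℝ) := Submodule.mem_orthogonal_singleton_iff_inner_right.1 q.2.2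
  have h2 : ⟪a, (q'.2 : E n)⟫ = (0 : ℝ) :=
    Submodule.mem_orthogonal_singleton_iff_inner_right.1 q'.2.2
  simp only [cyl, add_sub_add_right_eq_sub, inner_sub_right, inner_add_right, inner_smul_right,
    h1, h2, real_inner_self_eq_norm_sq, ha]
  ring

theorem norm_cyl_sub_sq {x a : E n} (ha : ‖a‖ = 1) (q q' : ℝ × (ℝ ∙ a)ᗮ) :
    ‖cyl x a q - cyl x a q'‖ ^ 2 = (q.1 - q'.1) ^ 2 + ‖q.2 - q'.2‖ ^ 2 := by
  have h : cyl x a q - cyl x a q' = (q.1 - q'.1) • a + ((q.2 - q'.2 : (ℝ ∙ a)ᗮ) : E n) := by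
    simp only [cyl, Submodule.coe_sub, sub_smul]
    abel
  have h1 : ⟪a, ((q.2 - q'.2 : (ℝ ∙ a)ᗮ) : E n)⟫ = (0 : ℝ) :=
    Submodule.mem_orthogonal_singleton_iff_inner_right.1 (q.2 - q'.2).2
  rw [h, norm_add_sq_real, inner_smul_left, h1, norm_smul, ha]
  simp

theorem norm_cyl_sub_le {x a : E n} (ha : ‖a‖ = 1) (q q' : ℝ × (ℝ ∙ a)ᗮ) :
    ‖cyl x a q - cyl x a q'‖ ≤ |q.1 - q'.1| + ‖q.2 - q'.2‖ := by
  refine abs_le_of_sq_le_sq' ?_ (by positivity) |>.2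
  rw [norm_cyl_sub_sq ha]
  nlinarith [abs_nonneg (q.1 - q'.1), norm_nonneg (q.2 - q'.2), sq_abs (q.1 - q'.1)]

theorem norm_snd_sub_le {x a : E n} (ha : ‖a‖ = 1) (q q' : ℝ × (ℝ ∙ a)ᗮ) :
    ‖q.2 - q'.2‖ ≤ ‖cyl x a q - cyl x a q'‖ := by
  refine abs_le_of_sq_le_sq' ?_ (by positivity) |>.2
  rw [norm_cyl_sub_sq ha]
  nlinarith [sq_nonneg (q.1 - q'.1)]

theorem abs_fst_sub_le {x a : E n} (ha : ‖a‖ = 1) (q q' : ℝ × (ℝ ∙ a)ᗮ) :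
    |q.1 - q'.1| ≤ ‖cyl x a q - cyl x a q'‖ := by
  refine abs_le_of_sq_le_sq' ?_ (by positivity) |>.2
  rw [norm_cyl_sub_sq ha, sq_abs]
  nlinarith [sq_nonneg ‖q.2 - q'.2‖]

theorem cyl_zero (x a : E n) : cyl x a 0 = x := by simp [cyl]

theorem cyl_surjective (x : E n) {a : E n} (ha : ‖a‖ = 1) : Function.Surjective (cyl x a) := by
  intro y
  refine ⟨(cylEquiv x ha).symm y, ?_⟩
  rw [← cylEquiv_apply x ha, MeasurableEquiv.apply_symm_apply]

theorem cyl_injective (x : E n) {a : E n} (ha : ‖a‖ = 1) : Function.Injective (cyl x a) := by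
  intro p q h
  rw [← cylEquiv_apply x ha, ← cylEquiv_apply x ha] at h
  exact (cylEquiv x ha).injective h

/-! ### The boundary as a graph -/

/-- `ε`-flatness of `Ω` in the ball `B(x, r)`, in direction `a`. -/
def FlatOn (Ω : Set (E n)) (x a : E n) (ε r : ℝ) : Prop :=
  ∀ y ∈ Metric.ball x r, ∀ z ∈ Metric.ball x r,
    y ∈ closure Ω → y ≠ z → ⟪a, z - y⟫ ≤ -(ε * ‖z - y‖) → z ∈ Ω

theorem cyl_mem_ball {x a : E n} (ha : ‖a‖ = 1) {r s : ℝ} {τ : (ℝ ∙ a)ᗮ}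
    (hs : |s| < r / 2) (hτ : ‖τ‖ < r / 2) : cyl x a (s, τ) ∈ Metric.ball x r := by
  rw [Metric.mem_ball, dist_eq_norm]
  have := norm_cyl_sub_le (x := x) ha (s, τ) 0
  rw [cyl_zero] at this
  simp only [Prod.fst_zero, Prod.snd_zero, sub_zero] at this
  linarith

/-- Along the axis the inner product equals minus the distance, so `ε ≤ 1` suffices. Hence every
vertical slice of `Ω` is an initial interval. -/
theorem FlatOn.cyl_mem {Ω : Set (E n)} {x a : E n} {ε r : ℝ} (H : FlatOn Ω x a ε r)
    (ha : ‖a‖ = 1) (hε1 : ε ≤ 1) {s s' : ℝ} {τ : (ℝ ∙ a)ᗮ} (hs : |s| < r / 2)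
    (hs' : |s'| < r / 2) (hτ : ‖τ‖ < r / 2) (hlt : s' < s)
    (hmem : cyl x a (s, τ) ∈ closure Ω) : cyl x a (s', τ) ∈ Ω := by
  refine H _ (cyl_mem_ball ha hs hτ) _ (cyl_mem_ball ha hs' hτ) hmem ?_ ?_
  · intro h
    have := cyl_injective x ha h
    simp only [Prod.mk.injEq] at this
    exact hlt.ne' this.1
  · rw [inner_cyl_sub ha]
    have := norm_cyl_sub_le (x := x) ha (s', τ) (s, τ)
    simp only [sub_self, norm_zero, add_zero, abs_of_neg (sub_neg.2 hlt)] at this ⊢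
    nlinarith [norm_nonneg (cyl x a (s', τ) - cyl x a (s, τ))]

/-- The height is the supremum of the slice over `τ`. Comparison with `x` shows that the slice is
nonempty and bounded: for `‖τ‖ < σ` the points at heights `-σ` and `σ` are at distance at most `2 σ`
from `x`, so with `ε ≤ 1/2` they lie in the inner and outer cones at `x`. -/
theorem FlatOn.exists_height {Ω : Set (E n)} (hΩ : IsOpen Ω) {x a : E n} {ε r : ℝ}
    (hx : x ∈ frontier Ω) (H : FlatOn Ω x a ε r) (ha : ‖a‖ = 1) (hε : 0 < ε) (hε1 : ε ≤ 1 / 2)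
    {τ : (ℝ ∙ a)ᗮ} (hτ : ‖τ‖ < r / 2) :
    ∃ k : ℝ, |k| < r / 2 ∧ cyl x a (k, τ) ∈ frontier Ω ∧
      ∀ s : ℝ, |s| < r / 2 →
        (cyl x a (s, τ) ∈ Ω ↔ s < k) ∧ (cyl x a (s, τ) ∈ closure Ω → s ≤ k) := by
  have hxΩ : x ∉ Ω := (hΩ.frontier_eq ▸ hx : x ∈ closure Ω \ Ω).2
  have hxc : x ∈ closure Ω := frontier_subset_closure hx
  obtain ⟨σ, hσ1, hσ2⟩ := exists_between hτ
  have hσ0 : 0 < σ := (norm_nonneg τ).trans_lt hσ1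
  have hr : 0 < r := by linarith
  have hxb : x ∈ Metric.ball x r := Metric.mem_ball_self hr
  have hσa : |σ| < r / 2 := by rwa [abs_of_pos hσ0]
  have hσa' : |-σ| < r / 2 := by rwa [abs_neg, abs_of_pos hσ0]
  have hn : ∀ s : ℝ, |s| = σ → ‖cyl x a (s, τ) - x‖ ≤ 2 * σ := by
    intro s hs
    have := norm_cyl_sub_le (x := x) ha (s, τ) 0
    rw [cyl_zero] at this
    simp only [Prod.fst_zero, Prod.snd_zero, sub_zero] at this
    linarith
  have hin : ∀ s : ℝ, ⟪a, cyl x a (s, τ) - x⟫ = s := by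
    intro s
    have := inner_cyl_sub (x := x) ha (s, τ) 0
    rw [cyl_zero] at this
    simpa using this
  have hlow : cyl x a (-σ, τ) ∈ Ω := by
    refine H x hxb _ (cyl_mem_ball ha hσa' hτ) hxc ?_ ?_
    · intro h
      have := hin (-σ)
      rw [← h, sub_self, inner_zero_right] at this
      linarith
    · rw [hin]
      have := hn (-σ) (by rw [abs_neg, abs_of_pos hσ0])
      nlinarith [norm_nonneg (cyl x a (-σ, τ) - x)]
  have hhigh : cyl x a (σ, τ) ∉ closure Ω := by
    intro hc
    refine hxΩ (H _ (cyl_mem_ball ha hσa hτ) x hxb hc ?_ ?_)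
    · intro h
      have := hin σ
      rw [h, sub_self, inner_zero_right] at this
      linarith
    · rw [← neg_sub, inner_neg_right, hin, norm_neg]
      have := hn σ (abs_of_pos hσ0)
      nlinarith [norm_nonneg (cyl x a (σ, τ) - x)]
  set S : Set ℝ := {s | |s| < r / 2 ∧ cyl x a (s, τ) ∈ Ω} with hS
  have hne : S.Nonempty := ⟨-σ, hσa', hlow⟩
  have hub : ∀ s ∈ S, s ≤ σ := by
    rintro s ⟨hs, hsΩ⟩
    by_contra hlt
    push Not at hlt
    exact hhigh (subset_closure (H.cyl_mem ha (by linarith) hs hσa hτ hlt (subset_closure hsΩ)))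
  have hbdd : BddAbove S := ⟨σ, hub⟩
  have hk1 : sSup S ≤ σ := csSup_le hne hub
  have hk2 : -σ ≤ sSup S := le_csSup hbdd ⟨hσa', hlow⟩
  have hkabs : |sSup S| < r / 2 := (abs_le.2 ⟨hk2, hk1⟩).trans_lt hσ2
  have hbelow : ∀ s, |s| < r / 2 → s < sSup S → cyl x a (s, τ) ∈ Ω := by
    intro s hs hlt
    obtain ⟨s', ⟨hs', hs'Ω⟩, hss'⟩ := exists_lt_of_lt_csSup hne hlt
    exact H.cyl_mem ha (by linarith) hs' hs hτ hss' (subset_closure hs'Ω)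
  have habove : ∀ s, |s| < r / 2 → sSup S < s → cyl x a (s, τ) ∉ closure Ω := by
    intro s hs hlt hc
    have hm : |(sSup S + s) / 2| < r / 2 := by
      rw [abs_lt] at *
      constructor <;> linarith [hs.1, hs.2, hkabs.1, hkabs.2]
    have : (sSup S + s) / 2 ∈ S :=
      ⟨hm, H.cyl_mem ha (by linarith) hs hm hτ (by linarith) hc⟩
    have := le_csSup hbdd this
    linarith
  have hcont : Continuous fun s : ℝ => cyl x a (s, τ) :=
    (continuous_cyl x a).comp (by fun_prop)
  have hkΩ : cyl x a (sSup S, τ) ∉ Ω := by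
    intro hin
    have h1 : ∀ᶠ s in 𝓝[>] (sSup S), cyl x a (s, τ) ∈ Ω ∧ |s| < r / 2 :=
      (((hcont.tendsto _).eventually (hΩ.mem_nhds hin)).and
        ((continuous_abs.tendsto _).eventually (gt_mem_nhds hkabs))).filter_mono
        nhdsWithin_le_nhds
    obtain ⟨s, ⟨hs1, hs2⟩, hs3⟩ := (h1.and self_mem_nhdsWithin).exists
    exact habove s hs2 hs3 (subset_closure hs1)
  have hkc : cyl x a (sSup S, τ) ∈ closure Ω := by
    have h1 : ∀ᶠ s in 𝓝[<] (sSup S), |s| < r / 2 :=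
      ((continuous_abs.tendsto _).eventually (gt_mem_nhds hkabs)).filter_mono nhdsWithin_le_nhds
    refine mem_closure_of_tendsto ((hcont.tendsto _).mono_left
      (nhdsWithin_le_nhds (s := Iio (sSup S)))) ?_
    filter_upwards [h1, self_mem_nhdsWithin] with s hs hs'
    exact hbelow s hs hs'
  refine ⟨sSup S, hkabs, hΩ.frontier_eq ▸ ⟨hkc, hkΩ⟩, fun s hs => ⟨⟨fun hsΩ => ?_, hbelow s hs⟩,
    fun hsc => ?_⟩⟩
  · refine lt_of_le_of_ne (le_csSup hbdd ⟨hs, hsΩ⟩) ?_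
    rintro rfl
    exact hkΩ hsΩ
  · by_contra hlt
    push Not at hlt
    exact habove s hs hlt hsc

open Classical in
/-- The height of the boundary over the tangent plane. -/
def height (Ω : Set (E n)) (x a : E n) (r : ℝ) (τ : (ℝ ∙ a)ᗮ) : ℝ :=
  if h : ∃ k : ℝ, |k| < r / 2 ∧ cyl x a (k, τ) ∈ frontier Ω ∧
      ∀ s : ℝ, |s| < r / 2 →
        (cyl x a (s, τ) ∈ Ω ↔ s < k) ∧ (cyl x a (s, τ) ∈ closure Ω → s ≤ k)
  then h.choose else 0

/-- The boundary as a graph over the tangent plane. -/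
def graphMap (Ω : Set (E n)) (x a : E n) (r : ℝ) (τ : (ℝ ∙ a)ᗮ) : E n :=
  cyl x a (height Ω x a r τ, τ)

theorem FlatOn.height_spec {Ω : Set (E n)} (hΩ : IsOpen Ω) {x a : E n} {ε r : ℝ}
    (hx : x ∈ frontier Ω) (H : FlatOn Ω x a ε r) (ha : ‖a‖ = 1) (hε : 0 < ε) (hε1 : ε ≤ 1 / 2)
    {τ : (ℝ ∙ a)ᗮ} (hτ : ‖τ‖ < r / 2) :
    |height Ω x a r τ| < r / 2 ∧ graphMap Ω x a r τ ∈ frontier Ω ∧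
      ∀ s : ℝ, |s| < r / 2 → (cyl x a (s, τ) ∈ Ω ↔ s < height Ω x a r τ) ∧
        (cyl x a (s, τ) ∈ closure Ω → s ≤ height Ω x a r τ) := by
  have h := H.exists_height hΩ hx ha hε hε1 hτ
  unfold graphMap height
  rw [dif_pos h]
  exact h.choose_spec

/-- Neither of two boundary points lies in `Ω`, so neither is in the descent cone of the other, and
their heights differ by at most `ε N`, where `N` is their distance. Then `N ≤ ε N + ‖τ - τ'‖`, and
`1 / (1 - ε) ≤ 1 + 2 ε` for `ε ≤ 1/2`. -/
theorem FlatOn.graphMap_lipschitz {Ω : Set (E n)} (hΩ : IsOpen Ω) {x a : E n} {ε r : ℝ}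
    (hx : x ∈ frontier Ω) (H : FlatOn Ω x a ε r) (ha : ‖a‖ = 1) (hε : 0 < ε) (hε1 : ε ≤ 1 / 2) :
    LipschitzOnWith (Real.toNNReal (1 + 2 * ε)) (graphMap Ω x a r) (Metric.ball 0 (r / 2)) := by
  refine LipschitzOnWith.of_dist_le_mul fun τ hτ τ' hτ' => ?_
  rw [mem_ball_zero_iff] at hτ hτ'
  have h1 := H.height_spec hΩ hx ha hε hε1 hτ
  have h2 := H.height_spec hΩ hx ha hε hε1 hτ'
  have hn1 : graphMap Ω x a r τ ∉ Ω := (hΩ.frontier_eq ▸ h1.2.1 : _ ∈ closure Ω \ Ω).2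
  have hn2 : graphMap Ω x a r τ' ∉ Ω := (hΩ.frontier_eq ▸ h2.2.1 : _ ∈ closure Ω \ Ω).2
  have hb1 : graphMap Ω x a r τ ∈ Metric.ball x r := cyl_mem_ball ha h1.1 hτ
  have hb2 : graphMap Ω x a r τ' ∈ Metric.ball x r := cyl_mem_ball ha h2.1 hτ'
  rw [dist_eq_norm, dist_eq_norm, Real.coe_toNNReal _ (by linarith)]
  by_cases heq : graphMap Ω x a r τ = graphMap Ω x a r τ'
  · rw [heq, sub_self, norm_zero]
    positivity
  have hle := norm_cyl_sub_le (x := x) ha (height Ω x a r τ, τ) (height Ω x a r τ', τ')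
  have hi := inner_cyl_sub (x := x) ha (height Ω x a r τ, τ) (height Ω x a r τ', τ')
  change ‖graphMap Ω x a r τ - graphMap Ω x a r τ'‖ ≤ _ at hle
  change ⟪a, graphMap Ω x a r τ - graphMap Ω x a r τ'⟫ = _ at hi
  simp only at hle hi
  set N := ‖graphMap Ω x a r τ - graphMap Ω x a r τ'‖ with hN
  have hA : -(ε * N) < ⟪a, graphMap Ω x a r τ - graphMap Ω x a r τ'⟫ := by
    by_contra hcon
    push Not at hcon
    exact hn1 (H _ hb2 _ hb1 (frontier_subset_closure h2.2.1) (Ne.symm heq) hcon)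
  have hB : ⟪a, graphMap Ω x a r τ - graphMap Ω x a r τ'⟫ < ε * N := by
    by_contra hcon
    push Not at hcon
    refine hn2 (H _ hb1 _ hb2 (frontier_subset_closure h1.2.1) heq ?_)
    rw [← neg_sub, inner_neg_right, norm_neg]
    linarith
  rw [hi] at hA hB
  have habs : |height Ω x a r τ - height Ω x a r τ'| ≤ ε * N := abs_le.2 ⟨hA.le, hB.le⟩
  have h0 := norm_nonneg (τ - τ')
  have h3 : N * (1 - ε) ≤ ‖τ - τ'‖ := by nlinarith
  have h4 : ‖τ - τ'‖ ≤ (1 + 2 * ε) * (‖τ - τ'‖ * (1 - ε)) := by nlinarith [mul_nonneg hε.le h0]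
  have h5 : 0 < 1 - ε := by linarith
  nlinarith [norm_nonneg (graphMap Ω x a r τ - graphMap Ω x a r τ')]

/-! ### The surface measure in graph coordinates -/

open scoped NNReal in
theorem euclideanHausdorffMeasure_image_le {X Y : Type*} [MetricSpace X]
    [MeasurableSpace X] [BorelSpace X] [MetricSpace Y] [MeasurableSpace Y] [BorelSpace Y]
    {K : ℝ≥0} {f : X → Y} {s : Set X} (h : LipschitzOnWith K f s) (d : ℕ) :
    Measure.euclideanHausdorffMeasure d (f '' s) ≤
      (K : ℝ≥0∞) ^ d * Measure.euclideanHausdorffMeasure d s := by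
  rw [Measure.euclideanHausdorffMeasure_def, Measure.euclideanHausdorffMeasure_def,
    Measure.smul_apply, Measure.smul_apply, ENNReal.smul_def, ENNReal.smul_def, smul_eq_mul,
    smul_eq_mul, mul_left_comm]
  gcongr
  have := h.hausdorffMeasure_image_le (d := d) (by positivity)
  rwa [ENNReal.rpow_natCast] at this

/-- The cylinder around `x` with axis `a`. -/
def cylinder (x a : E n) (r : ℝ) : Set (E n) :=
  cyl x a '' {q | |q.1| < r / 2 ∧ ‖q.2‖ < r / 2}

theorem measurableSet_cylinder {x a : E n} (ha : ‖a‖ = 1) (r : ℝ) :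
    MeasurableSet (cylinder x a r) := by
  have h : MeasurableSet {q : ℝ × (ℝ ∙ a)ᗮ | |q.1| < r / 2 ∧ ‖q.2‖ < r / 2} :=
    ((isOpen_lt (f := fun q : ℝ × (ℝ ∙ a)ᗮ => |q.1|) (by fun_prop) continuous_const).inter
      (isOpen_lt (f := fun q : ℝ × (ℝ ∙ a)ᗮ => ‖q.2‖) (by fun_prop)
        continuous_const)).measurableSet
  have := (cylEquiv x ha).measurableSet_image.2 h
  rw [show (cylEquiv x ha : _ → E n) = cyl x a from funext (cylEquiv_apply x ha)] at this
  exact this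

theorem ball_subset_cylinder {x a : E n} (ha : ‖a‖ = 1) (r : ℝ) :
    Metric.ball x (r / 2) ⊆ cylinder x a r := by
  intro y hy
  obtain ⟨q, rfl⟩ := cyl_surjective x ha y
  rw [Metric.mem_ball, dist_eq_norm] at hy
  have h1 := abs_fst_sub_le (x := x) ha q 0
  have h2 := norm_snd_sub_le (x := x) ha q 0
  rw [cyl_zero] at h1 h2
  simp only [Prod.fst_zero, Prod.snd_zero, sub_zero] at h1 h2
  exact ⟨q, ⟨h1.trans_lt hy, h2.trans_lt hy⟩, rfl⟩

/-- Lebesgue measure on the tangent plane, transported to the boundary. -/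
def graphMeasure (Ω : Set (E n)) (x a : E n) (r : ℝ) : Measure (E n) :=
  (volume.restrict (Metric.ball (0 : (ℝ ∙ a)ᗮ) (r / 2))).map (graphMap Ω x a r)

section

variable {Ω : Set (E n)} {x a : E n} {ε r : ℝ}

theorem FlatOn.aemeasurable_graphMap (hΩ : IsOpen Ω)
    (hx : x ∈ frontier Ω) (H : FlatOn Ω x a ε r) (ha : ‖a‖ = 1) (hε : 0 < ε) (hε1 : ε ≤ 1 / 2) :
    AEMeasurable (graphMap Ω x a r) (volume.restrict (Metric.ball 0 (r / 2))) :=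
  (H.graphMap_lipschitz hΩ hx ha hε hε1).continuousOn.aemeasurable Metric.isOpen_ball.measurableSet

theorem FlatOn.image_graphMap (hΩ : IsOpen Ω)
    (hx : x ∈ frontier Ω) (H : FlatOn Ω x a ε r) (ha : ‖a‖ = 1) (hε : 0 < ε) (hε1 : ε ≤ 1 / 2)
    (A : Set (E n)) :
    graphMap Ω x a r '' (graphMap Ω x a r ⁻¹' A ∩ Metric.ball 0 (r / 2)) =
      A ∩ cylinder x a r ∩ frontier Ω := by
  ext y
  constructor
  · rintro ⟨τ, ⟨hτA, hτ⟩, rfl⟩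
    rw [mem_ball_zero_iff] at hτ
    have hs := H.height_spec hΩ hx ha hε hε1 hτ
    refine ⟨⟨hτA, mem_image_of_mem _ ?_⟩, hs.2.1⟩
    exact ⟨hs.1, hτ⟩
  · rintro ⟨⟨hyA, ⟨⟨s, τ⟩, ⟨hs, hτ⟩, rfl⟩⟩, hyΓ⟩
    simp only at hs hτ
    have hspec := H.height_spec hΩ hx ha hε hε1 hτ
    have hyΓ' : cyl x a (s, τ) ∈ closure Ω \ Ω := hΩ.frontier_eq ▸ hyΓ
    have h1 := (hspec.2.2 s hs).2 hyΓ'.1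
    have h2 : ¬ s < height Ω x a r τ := fun h => hyΓ'.2 ((hspec.2.2 s hs).1.2 h)
    have : s = height Ω x a r τ := le_antisymm h1 (not_lt.1 h2)
    have hg : graphMap Ω x a r τ = cyl x a (s, τ) := by rw [graphMap, this]
    exact ⟨τ, ⟨by rwa [mem_preimage, hg], by rwa [mem_ball_zero_iff]⟩, hg⟩

/-- The truncated subtraction is harmless: a unit vector forces `n ≥ 1`. -/
theorem volume_orthogonal_eq (ha : ‖a‖ = 1) :
    (volume : Measure (ℝ ∙ a)ᗮ) = Measure.euclideanHausdorffMeasure (n - 1) := by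
  have ha0 : a ≠ 0 := by
    rintro rfl
    simp at ha
  have h1 := (ℝ ∙ a).finrank_add_finrank_orthogonal
  rw [finrank_span_singleton ha0, finrank_euclideanSpace_fin] at h1
  rw [← InnerProductSpace.euclideanHausdorffMeasure_eq_volume]
  congr 1
  omega

/-- The projection to the tangent plane is 1-Lipschitz and inverts `graphMap`, so it cannot increase
Hausdorff measure. The reverse comparison `FlatOn.le_graphMeasure` uses the Lipschitz constant of
`graphMap` itself; no area formula is needed. -/
theorem FlatOn.graphMeasure_le (hΩ : IsOpen Ω)
    (hx : x ∈ frontier Ω) (H : FlatOn Ω x a ε r) (ha : ‖a‖ = 1) (hε : 0 < ε) (hε1 : ε ≤ 1 / 2) :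
    graphMeasure Ω x a r ≤ (surface Ω).restrict (cylinder x a r) := by
  refine Measure.le_iff.2 fun A hA => ?_
  have hm := H.aemeasurable_graphMap hΩ hx ha hε hε1
  rw [graphMeasure, Measure.map_apply_of_aemeasurable hm hA,
    Measure.restrict_apply₀' (measurableSet_ball.nullMeasurableSet),
    Measure.restrict_apply hA, surface, Measure.restrict_apply
      (hA.inter (measurableSet_cylinder ha r)),
    ← H.image_graphMap hΩ hx ha hε hε1 A, volume_orthogonal_eq ha]
  set S := graphMap Ω x a r ⁻¹' A ∩ Metric.ball 0 (r / 2)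
  have hP : LipschitzOnWith 1 (fun y => ((cylEquiv x ha).symm y).2) (graphMap Ω x a r '' S) := by
    refine LipschitzOnWith.of_dist_le_mul fun y _ z _ => ?_
    have := norm_snd_sub_le (x := x) ha ((cylEquiv x ha).symm y) ((cylEquiv x ha).symm z)
    rw [← cylEquiv_apply x ha, ← cylEquiv_apply x ha, MeasurableEquiv.apply_symm_apply,
      MeasurableEquiv.apply_symm_apply] at this
    simpa [dist_eq_norm] using this
  have h1 := euclideanHausdorffMeasure_image_le hP (n - 1)
  simp only [ENNReal.coe_one, one_pow, one_mul] at h1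
  refine le_trans (le_of_eq ?_) h1
  congr 1
  rw [image_image]
  have : ∀ τ, ((cylEquiv x ha).symm (graphMap Ω x a r τ)).2 = τ := by
    intro τ
    rw [graphMap, ← cylEquiv_apply x ha, MeasurableEquiv.symm_apply_apply]
  simp [this]

theorem FlatOn.le_graphMeasure (hΩ : IsOpen Ω)
    (hx : x ∈ frontier Ω) (H : FlatOn Ω x a ε r) (ha : ‖a‖ = 1) (hε : 0 < ε) (hε1 : ε ≤ 1 / 2) :
    (surface Ω).restrict (cylinder x a r) ≤
      (ENNReal.ofReal (1 + 2 * ε)) ^ (n - 1) • graphMeasure Ω x a r := by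
  refine Measure.le_iff.2 fun A hA => ?_
  have hm := H.aemeasurable_graphMap hΩ hx ha hε hε1
  rw [Measure.smul_apply, graphMeasure, Measure.map_apply_of_aemeasurable hm hA,
    Measure.restrict_apply₀' (measurableSet_ball.nullMeasurableSet),
    Measure.restrict_apply hA, surface, Measure.restrict_apply
      (hA.inter (measurableSet_cylinder ha r)),
    ← H.image_graphMap hΩ hx ha hε hε1 A, volume_orthogonal_eq ha, smul_eq_mul]
  exact euclideanHausdorffMeasure_image_le
    ((H.graphMap_lipschitz hΩ hx ha hε hε1).mono inter_subset_right) (n - 1)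

theorem FlatOn.surface_cylinder_lt_top (hΩ : IsOpen Ω)
    (hx : x ∈ frontier Ω) (H : FlatOn Ω x a ε r) (ha : ‖a‖ = 1) (hε : 0 < ε) (hε1 : ε ≤ 1 / 2) :
    surface Ω (cylinder x a r) < ⊤ := by
  have h := H.le_graphMeasure hΩ hx ha hε hε1 univ
  rw [Measure.restrict_apply_univ] at h
  refine h.trans_lt ?_
  have hm := H.aemeasurable_graphMap hΩ hx ha hε hε1
  rw [Measure.smul_apply, graphMeasure, Measure.map_apply_of_aemeasurable hm MeasurableSet.univ,
    preimage_univ, Measure.restrict_apply_univ, smul_eq_mul]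
  exact ENNReal.mul_lt_top (ENNReal.pow_lt_top ENNReal.ofReal_lt_top) measure_ball_lt_top

/-- Integrals of nonnegative functions over the boundary and over the tangent plane are
comparable. -/
theorem FlatOn.integral_surface_compare (hΩ : IsOpen Ω)
    (hx : x ∈ frontier Ω) (H : FlatOn Ω x a ε r) (ha : ‖a‖ = 1) (hε : 0 < ε) (hε1 : ε ≤ 1 / 2)
    {f : E n → ℝ} (hf : Continuous f) (hf0 : ∀ y, 0 ≤ f y) (hfc : HasCompactSupport f)
    (hsupp : tsupport f ⊆ Metric.ball x (r / 2)) :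
    ∫ τ in Metric.ball (0 : (ℝ ∙ a)ᗮ) (r / 2), f (graphMap Ω x a r τ) ≤ ∫ y, f y ∂(surface Ω) ∧
    ∫ y, f y ∂(surface Ω) ≤ (1 + 2 * ε) ^ (n - 1) *
      ∫ τ in Metric.ball (0 : (ℝ ∙ a)ᗮ) (r / 2), f (graphMap Ω x a r τ) := by
  have hm := H.aemeasurable_graphMap hΩ hx ha hε hε1
  have h1 : ∫ τ in Metric.ball (0 : (ℝ ∙ a)ᗮ) (r / 2), f (graphMap Ω x a r τ) =
      ∫ y, f y ∂(graphMeasure Ω x a r) := by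
    rw [graphMeasure, integral_map hm hf.aestronglyMeasurable]
  have h2 : ∫ y, f y ∂(surface Ω) = ∫ y in cylinder x a r, f y ∂(surface Ω) := by
    rw [setIntegral_eq_integral_of_forall_compl_eq_zero]
    intro y hy
    exact image_eq_zero_of_notMem_tsupport fun h => hy (ball_subset_cylinder ha r (hsupp h))
  have hfin : IsFiniteMeasure ((surface Ω).restrict (cylinder x a r)) :=
    ⟨by rw [Measure.restrict_apply_univ]; exact H.surface_cylinder_lt_top hΩ hx ha hε hε1⟩
  have hfin' : IsFiniteMeasure (graphMeasure Ω x a r) :=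
    isFiniteMeasure_of_le _ (H.graphMeasure_le hΩ hx ha hε hε1)
  have hi : Integrable f ((surface Ω).restrict (cylinder x a r)) :=
    hf.integrable_of_hasCompactSupport hfc
  have hi' : Integrable f (graphMeasure Ω x a r) := hf.integrable_of_hasCompactSupport hfc
  rw [h1, h2]
  refine ⟨integral_mono_measure (H.graphMeasure_le hΩ hx ha hε hε1)
    (Eventually.of_forall hf0) hi, ?_⟩
  have h3 := integral_mono_measure (H.le_graphMeasure hΩ hx ha hε hε1)
    (Eventually.of_forall hf0) (hi'.smul_measure (ENNReal.pow_lt_top ENNReal.ofReal_lt_top).ne)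
  rw [integral_smul_measure, ENNReal.toReal_pow, ENNReal.toReal_ofReal (by linarith)] at h3
  simpa using h3

/-- The flux in the normal direction, by Fubini's theorem along the axis of the cylinder. -/
theorem FlatOn.integral_fderiv_normal (hΩ : IsOpen Ω)
    (hx : x ∈ frontier Ω) (H : FlatOn Ω x a ε r) (ha : ‖a‖ = 1) (hε : 0 < ε) (hε1 : ε ≤ 1 / 2)
    {f : E n → ℝ} (hf : ContDiff ℝ 1 f) (hfc : HasCompactSupport f)
    (hsupp : tsupport f ⊆ Metric.ball x (r / 2)) :
    ∫ y in Ω, fderiv ℝ f y a =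
      ∫ τ in Metric.ball (0 : (ℝ ∙ a)ᗮ) (r / 2), f (graphMap Ω x a r τ) := by
  have hcont : Continuous fun y => fderiv ℝ f y a :=
    (hf.continuous_fderiv (by norm_num)).clm_apply continuous_const
  have hcs : HasCompactSupport fun y => fderiv ℝ f y a := hfc.fderiv_apply ℝ a
  have hint : Integrable (fun y => fderiv ℝ f y a) := hcont.integrable_of_hasCompactSupport hcs
  rw [← integral_indicator hΩ.measurableSet, integral_eq_cyl x ha (hint.indicator hΩ.measurableSet),
    ← integral_indicator measurableSet_ball]
  refine integral_congr_ae (Eventually.of_forall fun τ => ?_)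
  simp only
  have hmem : ∀ s : ℝ, cyl x a (s, τ) ∈ tsupport f → |s| < r / 2 ∧ ‖τ‖ < r / 2 := by
    intro s hs
    have hy := hsupp hs
    rw [Metric.mem_ball, dist_eq_norm] at hy
    have h1 := abs_fst_sub_le (x := x) ha (s, τ) 0
    have h2 := norm_snd_sub_le (x := x) ha (s, τ) 0
    rw [cyl_zero] at h1 h2
    simp only [Prod.fst_zero, Prod.snd_zero, sub_zero] at h1 h2
    exact ⟨h1.trans_lt hy, h2.trans_lt hy⟩
  have hd0 : ∀ y, y ∉ tsupport f → fderiv ℝ f y a = 0 := by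
    intro y hy
    have : fderiv ℝ f y = 0 := by
      by_contra h
      exact hy (support_fderiv_subset ℝ h)
    rw [this]
    rfl
  by_cases hτ : ‖τ‖ < r / 2
  · rw [indicator_of_mem (by rwa [mem_ball_zero_iff])]
    have hspec := H.height_spec hΩ hx ha hε hε1 hτ
    set k := height Ω x a r τ with hk
    set g : ℝ → ℝ := fun s => f (cyl x a (s, τ)) with hg
    have hder : ∀ s : ℝ, HasDerivAt (fun s : ℝ => cyl x a (s, τ)) a s := by
      intro s
      unfold cyl
      simpa using ((hasDerivAt_id s).smul_const a).add_const (τ : E n) |>.add_const x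
    have hgd : ∀ s, HasDerivAt g (fderiv ℝ f (cyl x a (s, τ)) a) s := fun s =>
      ((hf.differentiable (by norm_num)) _).hasFDerivAt.comp_hasDerivAt s (hder s)
    have hcs' : HasCompactSupport g := by
      refine HasCompactSupport.intro (isCompact_Icc (a := -(r / 2)) (b := r / 2)) fun s hs => ?_
      refine image_eq_zero_of_notMem_tsupport (f := f) fun h => hs ?_
      have := (hmem s h).1
      exact ⟨(abs_lt.1 this).1.le, (abs_lt.1 this).2.le⟩
    have hgC : ContDiff ℝ 1 g := by
      have h : ContDiff ℝ 1 fun s : ℝ => s • a + (τ : E n) + x :=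
        ((contDiff_id.smul contDiff_const).add contDiff_const).add contDiff_const
      exact hf.comp h
    -- On a line parallel to the axis, `Ω` is the half-line below `k` within the support of `f`, so
    -- the fundamental theorem of calculus leaves only the value at the boundary point.
    have h1 := hcs'.integral_Iic_deriv_eq hgC k
    have h2 : f (graphMap Ω x a r τ) = g k := rfl
    rw [h2, ← h1, integral_Iic_eq_integral_Iio, ← integral_indicator measurableSet_Iio]
    refine integral_congr_ae (Eventually.of_forall fun s => ?_)
    simp only
    by_cases hs : |s| < r / 2
    · by_cases hsk : s < k
      · rw [indicator_of_mem (((hspec.2.2 s hs).1.2 hsk)), indicator_of_mem (mem_Iio.2 hsk),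
          (hgd s).deriv]
      · rw [indicator_of_notMem (fun h => hsk ((hspec.2.2 s hs).1.1 h)),
          indicator_of_notMem (by simpa using hsk)]
    · have hz : fderiv ℝ f (cyl x a (s, τ)) a = 0 := hd0 _ fun h => hs (hmem s h).1
      have h3 : Ω.indicator (fun y => fderiv ℝ f y a) (cyl x a (s, τ)) = 0 :=
        indicator_apply_eq_zero.2 fun _ => hz
      have h4 : (Iio k).indicator (deriv g) s = 0 :=
        indicator_apply_eq_zero.2 fun _ => by rw [(hgd s).deriv, hz]
      rw [h3, h4]
  · rw [indicator_of_notMem (by rwa [mem_ball_zero_iff])]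
    refine integral_eq_zero_of_ae (Eventually.of_forall fun s => ?_)
    exact indicator_apply_eq_zero.2 fun _ => hd0 _ fun h => hτ (hmem s h).2

end

/-! ### The divergence theorem -/

section

variable {Ω : Set (E n)} {x a : E n} {ε r : ℝ}

/-- The integral is the derivative at `t = 0` of `∫_Ω f(y + t w) dy`, the integral of `f` over the
translate `Ω + t w`. Near the support of `f` this translate contains `Ω` for small `t > 0`, because
`-w` points inwards; as `f ≥ 0`, the difference quotients from the right are nonnegative. -/
theorem FlatOn.integral_fderiv_nonneg (hΩ : IsOpen Ω) (hb : Bornology.IsBounded Ω)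
    (H : FlatOn Ω x a ε r) (hr : 0 < r)
    {f : E n → ℝ} (hf : ContDiff ℝ 1 f) (hf0 : ∀ y, 0 ≤ f y) (hfc : HasCompactSupport f)
    (hsupp : tsupport f ⊆ Metric.ball x (r / 2)) {w : E n} (hw : ε * ‖w‖ ≤ ⟪a, w⟫) :
    0 ≤ ∫ y in Ω, fderiv ℝ f y w := by
  by_cases hw0 : w = 0
  · simp [hw0]
  have hwn : 0 < ‖w‖ := norm_pos_iff.2 hw0
  have hcont : Continuous fun y => fderiv ℝ f y w :=
    (hf.continuous_fderiv (by norm_num)).clm_apply continuous_const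
  have hcs : HasCompactSupport fun y => fderiv ℝ f y w := hfc.fderiv_apply ℝ w
  obtain ⟨C, hC⟩ := hcs.exists_bound_of_continuous hcont
  have hfin : IsFiniteMeasure (volume.restrict Ω) :=
    ⟨by rw [Measure.restrict_apply_univ]; exact hb.measure_lt_top⟩
  have hder : HasDerivAt (fun t : ℝ => ∫ y in Ω, f (y + t • w))
      (∫ y in Ω, fderiv ℝ f (y + (0 : ℝ) • w) w) 0 := by
    refine (hasDerivAt_integral_of_dominated_loc_of_deriv_le (s := univ) (bound := fun _ => C)
      (F' := fun t y => fderiv ℝ f (y + t • w) w) univ_mem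
      (Eventually.of_forall fun t => ?_) ?_ ?_ ?_ (integrable_const C) ?_).2
    · exact (hf.continuous.comp (by fun_prop)).aestronglyMeasurable
    · simpa using (hf.continuous.integrable_of_hasCompactSupport hfc).restrict
    · exact (hcont.comp (by fun_prop)).aestronglyMeasurable
    · exact Eventually.of_forall fun y t _ => hC _
    · refine Eventually.of_forall fun y t _ => ?_
      have h1 : HasDerivAt (fun t : ℝ => y + t • w) w t := by
        simpa using ((hasDerivAt_id t).smul_const w).const_add y
      exact (hf.differentiable (by norm_num) _).hasFDerivAt.comp_hasDerivAt t h1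
  simp only [zero_smul, add_zero] at hder
  refine ge_of_tendsto hder.tendsto_slope_zero_right ?_
  have hev : Ioo (0 : ℝ) (r / 2 / ‖w‖) ∈ 𝓝[>] (0 : ℝ) := Ioo_mem_nhdsGT (by positivity)
  filter_upwards [hev] with t ht
  have hmeas : MeasurableSet {z | z - t • w ∈ Ω} := (hΩ.preimage (by fun_prop)).measurableSet
  have hfi := hf.continuous.integrable_of_hasCompactSupport (μ := volume) hfc
  have hFt : ∫ y in Ω, f (y + t • w) = ∫ z, {z | z - t • w ∈ Ω}.indicator f z := by
    rw [← integral_indicator hΩ.measurableSet,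
      ← integral_add_right_eq_self ({z | z - t • w ∈ Ω}.indicator f) (t • w)]
    refine integral_congr_ae (Eventually.of_forall fun y => ?_)
    have h : y + t • w ∈ {z | z - t • w ∈ Ω} ↔ y ∈ Ω := by
      rw [mem_ofPred_eq, add_sub_cancel_right]
    change _ = {z | z - t • w ∈ Ω}.indicator f (y + t • w)
    by_cases hy : y ∈ Ω
    · rw [indicator_of_mem hy, indicator_of_mem (h.2 hy)]
    · rw [indicator_of_notMem hy, indicator_of_notMem fun h' => hy (h.1 h')]
  have hle : ∫ y in Ω, f y ≤ ∫ y in Ω, f (y + t • w) := by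
    rw [hFt, ← integral_indicator hΩ.measurableSet]
    refine integral_mono (hfi.indicator hΩ.measurableSet) (hfi.indicator hmeas) fun z => ?_
    by_cases hz : z ∈ Ω
    · by_cases hfz : f z = 0
      · simp [indicator, hfz]
      · have hzb : z ∈ Metric.ball x (r / 2) := hsupp (subset_tsupport f hfz)
        have hmem : z - t • w ∈ Ω := by
          have htw : t * ‖w‖ < r / 2 := by
            have := ht.2
            rwa [lt_div_iff₀ hwn] at this
          refine H z (Metric.ball_subset_ball (by linarith) hzb) _ ?_ (subset_closure hz) ?_ ?_
          · rw [Metric.mem_ball, dist_eq_norm] at hzb ⊢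
            have h1 : z - t • w - x = (z - x) - t • w := by abel
            have h2 := norm_sub_le (z - x) (t • w)
            rw [norm_smul, Real.norm_eq_abs, abs_of_pos ht.1] at h2
            rw [h1]
            linarith
          · intro h
            have : t • w = 0 := by
              have h' := sub_eq_self.1 h.symm
              exact h'
            rcases smul_eq_zero.1 this with h | h
            · exact ht.1.ne' h
            · exact hw0 h
          · have h1 : z - t • w - z = -(t • w) := by abel
            rw [h1, inner_neg_right, norm_neg, inner_smul_right, norm_smul, Real.norm_eq_abs,
              abs_of_pos ht.1]
            nlinarith [mul_le_mul_of_nonneg_left hw ht.1.le]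
        rw [indicator_of_mem hz, indicator_of_mem (by exact hmem)]
    · rw [indicator_of_notMem hz]
      exact indicator_nonneg (fun y _ => hf0 y) z
  simp only [zero_add, zero_smul, add_zero, smul_eq_mul]
  exact mul_nonneg (inv_nonneg.2 ht.1.le) (by linarith)

/-- Tilting `± v` by `2 ε ‖v‖ a` produces directions satisfying the hypothesis of
`FlatOn.integral_fderiv_nonneg`, because `ε (‖v‖ + 2 ε ‖v‖) ≤ 2 ε ‖v‖` for `ε ≤ 1/2`. The two signs
give the absolute value. -/
theorem FlatOn.abs_integral_fderiv_tangent_le (hΩ : IsOpen Ω) (hb : Bornology.IsBounded Ω)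
    (H : FlatOn Ω x a ε r) (hr : 0 < r) (ha : ‖a‖ = 1) (hε : 0 < ε) (hε1 : ε ≤ 1 / 2)
    {f : E n → ℝ} (hf : ContDiff ℝ 1 f) (hf0 : ∀ y, 0 ≤ f y) (hfc : HasCompactSupport f)
    (hsupp : tsupport f ⊆ Metric.ball x (r / 2)) {v : E n} (hv : ⟪a, v⟫ = 0) :
    |∫ y in Ω, fderiv ℝ f y v| ≤ 2 * ε * ‖v‖ * ∫ y in Ω, fderiv ℝ f y a := by
  have hi : ∀ w : E n, Integrable (fun y => fderiv ℝ f y w) (volume.restrict Ω) := fun w =>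
    (((hf.continuous_fderiv (by norm_num)).clm_apply
      continuous_const).integrable_of_hasCompactSupport (hfc.fderiv_apply ℝ w)).restrict
  have key : ∀ u : E n, ‖u‖ = ‖v‖ → ⟪a, u⟫ = 0 →
      0 ≤ ∫ y in Ω, fderiv ℝ f y u + 2 * ε * ‖v‖ * fderiv ℝ f y a := by
    intro u hu hau
    have h1 : ∀ y, fderiv ℝ f y u + 2 * ε * ‖v‖ * fderiv ℝ f y a =
        fderiv ℝ f y (u + (2 * ε * ‖v‖) • a) := by
      intro y
      simp
    simp only [h1]
    refine H.integral_fderiv_nonneg hΩ hb hr hf hf0 hfc hsupp ?_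
    rw [inner_add_right, hau, inner_smul_right, real_inner_self_eq_norm_sq, ha]
    have h2 := norm_add_le u ((2 * ε * ‖v‖) • a)
    rw [norm_smul, ha, Real.norm_eq_abs, abs_of_nonneg (by positivity), hu] at h2
    have h3 := norm_nonneg v
    have h4 : ε * ‖u + (2 * ε * ‖v‖) • a‖ ≤ ε * (‖v‖ + 2 * ε * ‖v‖ * 1) := by gcongr
    nlinarith [mul_nonneg hε.le h3, mul_nonneg (mul_nonneg hε.le h3) (sub_nonneg.2 hε1)]
  have h1 := key v rfl hv
  have h2 := key (-v) (norm_neg v) (by rw [inner_neg_right, hv, neg_zero])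
  rw [integral_add (hi _) ((hi a).const_mul _), integral_const_mul] at h1 h2
  simp only [map_neg] at h2
  rw [integral_neg] at h2
  exact abs_le.2 ⟨by linarith, by linarith⟩

end

variable {Ω : Set (E n)}

theorem IsC6Domain.exists_flatOn (hΩ : IsC6Domain Ω) {x : E n} (hx : x ∈ frontier Ω) {ε : ℝ}
    (hε : 0 < ε) : ∃ r, 0 < r ∧ FlatOn Ω x (outwardNormal Ω x) ε r :=
  (hΩ.isFlatAt_outwardNormal hx).2 ε hε

theorem IsC6Domain.norm_outwardNormal (hΩ : IsC6Domain Ω) {x : E n} (hx : x ∈ frontier Ω) :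
    ‖outwardNormal Ω x‖ = 1 :=
  (hΩ.isFlatAt_outwardNormal hx).1

theorem IsC6Domain.isCompact_closure (hΩ : IsC6Domain Ω) : IsCompact (closure Ω) :=
  hΩ.isBounded.isCompact_closure

theorem IsC6Domain.isFiniteMeasure_surface (hΩ : IsC6Domain Ω) :
    IsFiniteMeasure (surface Ω) := by
  have hK : IsCompact (frontier Ω) :=
    hΩ.isCompact_closure.of_isClosed_subset isClosed_frontier frontier_subset_closure
  have h : surface Ω (frontier Ω) < ⊤ := by
    refine hK.measure_lt_top_of_nhdsWithin fun x hx => ?_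
    obtain ⟨r, hr, H⟩ := hΩ.exists_flatOn hx (ε := 1 / 2) (by norm_num)
    refine ⟨Metric.ball x (r / 2), mem_nhdsWithin_of_mem_nhds
      (Metric.ball_mem_nhds x (by positivity)), ?_⟩
    exact (measure_mono (ball_subset_cylinder (hΩ.norm_outwardNormal hx) r)).trans_lt
      (H.surface_cylinder_lt_top hΩ.isOpen hx (hΩ.norm_outwardNormal hx) (by norm_num) le_rfl)
  refine ⟨?_⟩
  rw [surface, Measure.restrict_apply_univ]
  rwa [surface, Measure.restrict_apply_self] at h

theorem ae_surface_mem_frontier (Ω : Set (E n)) : ∀ᵐ y ∂(surface Ω), y ∈ frontier Ω :=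
  ae_restrict_mem isClosed_frontier.measurableSet

theorem aestronglyMeasurable_surface {F : Type*} [TopologicalSpace F]
    [TopologicalSpace.PseudoMetrizableSpace F] [SecondCountableTopology F]
    [MeasurableSpace F] [BorelSpace F] {f : E n → F} (hf : ContinuousOn f (frontier Ω)) :
    AEStronglyMeasurable f (surface Ω) :=
  hf.aestronglyMeasurable isClosed_frontier.measurableSet

theorem IsC6Domain.integrable_surface (hΩ : IsC6Domain Ω) {f : E n → ℝ}
    (hf : ContinuousOn f (frontier Ω)) : Integrable f (surface Ω) := by
  have := hΩ.isFiniteMeasure_surface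
  have hK : IsCompact (frontier Ω) :=
    hΩ.isCompact_closure.of_isClosed_subset isClosed_frontier frontier_subset_closure
  obtain ⟨C, hC⟩ := hK.exists_bound_of_continuousOn hf
  refine Integrable.of_bound (aestronglyMeasurable_surface hf) C ?_
  filter_upwards [ae_surface_mem_frontier Ω] with y hy using hC y hy

theorem IsC6Domain.continuousOn_inner_normal (hΩ : IsC6Domain Ω) (w : E n) :
    ContinuousOn (fun y => ⟪w, outwardNormal Ω y⟫) (frontier Ω) :=
  continuousOn_const.inner hΩ.continuousOn_outwardNormal

/-- The local flux estimate. -/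
theorem FlatOn.abs_flux_sub_le (hΩ : IsC6Domain Ω) {x : E n} {ε r : ℝ} (hx : x ∈ frontier Ω)
    (H : FlatOn Ω x (outwardNormal Ω x) ε r) (hr : 0 < r) (hε : 0 < ε) (hε1 : ε ≤ 1 / 2)
    {f : E n → ℝ} (hf : ContDiff ℝ 1 f) (hf0 : ∀ y, 0 ≤ f y) (hfc : HasCompactSupport f)
    (hsupp : tsupport f ⊆ Metric.ball x (r / 2)) (w : E n) :
    |(∫ y in Ω, fderiv ℝ f y w) - ∫ y, ⟪w, outwardNormal Ω y⟫ * f y ∂(surface Ω)| ≤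
      (4 * ε + ((1 + 2 * ε) ^ (n - 1) - 1)) * ‖w‖ * ∫ y, f y ∂(surface Ω) := by
  set a := outwardNormal Ω x with ha_def
  have ha : ‖a‖ = 1 := hΩ.norm_outwardNormal hx
  set α : ℝ := ⟪a, w⟫ with hα
  -- Splitting `w = α a + v` isolates three errors: `2 ε` from the tangential flux, `2 ε` from the
  -- oscillation of the normal, and `(1 + 2 ε) ^ (n - 1) - 1` from replacing the surface measure by
  -- Lebesgue measure on the tangent plane.
  set v := w - α • a with hv
  have hav : ⟪a, v⟫ = (0 : ℝ) := by
    rw [hv, inner_sub_right, inner_smul_right, real_inner_self_eq_norm_sq, ha, hα]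
    ring
  have hαw : |α| ≤ ‖w‖ := by
    have := abs_real_inner_le_norm a w
    rwa [ha, one_mul] at this
  have hvw : ‖v‖ ≤ ‖w‖ := by
    refine abs_le_of_sq_le_sq' ?_ (norm_nonneg _) |>.2
    have h1 : ‖v‖ ^ 2 = ‖w‖ ^ 2 - α ^ 2 := by
      rw [hv, norm_sub_sq_real, inner_smul_right, norm_smul, ha, real_inner_comm, ← hα,
        Real.norm_eq_abs, mul_one, sq_abs]
      ring
    rw [h1]
    nlinarith [sq_nonneg α]
  set I := ∫ y in Ω, fderiv ℝ f y a with hI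
  have hIeq : I = _ := H.integral_fderiv_normal hΩ.isOpen hx ha hε hε1 hf hfc hsupp
  obtain ⟨hcmp1, hcmp2⟩ := H.integral_surface_compare hΩ.isOpen hx ha hε hε1 hf.continuous hf0
    hfc hsupp
  rw [← hIeq] at hcmp1 hcmp2
  have htan := H.abs_integral_fderiv_tangent_le hΩ.isOpen hΩ.isBounded hr ha hε hε1 hf hf0 hfc
    hsupp hav
  rw [← hI] at htan
  set M := ∫ y, f y ∂(surface Ω) with hM
  have hi : ∀ w : E n, Integrable (fun y => fderiv ℝ f y w) (volume.restrict Ω) := fun w =>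
    (((hf.continuous_fderiv (by norm_num)).clm_apply
      continuous_const).integrable_of_hasCompactSupport (hfc.fderiv_apply ℝ w)).restrict
  have hI0 : 0 ≤ I := by
    rw [hIeq]
    exact integral_nonneg fun _ => hf0 _
  have hM0 : 0 ≤ M := hI0.trans hcmp1
  have hsplit : ∫ y in Ω, fderiv ℝ f y w = α * I + ∫ y in Ω, fderiv ℝ f y v := by
    rw [hI, ← integral_const_mul, ← integral_add ((hi a).const_mul _) (hi v)]
    refine integral_congr_ae (Eventually.of_forall fun y => ?_)
    simp [hv]
  have hfs : Integrable f (surface Ω) := hΩ.integrable_surface hf.continuous.continuousOn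
  have hνf : Integrable (fun y => ⟪w, outwardNormal Ω y⟫ * f y) (surface Ω) :=
    hΩ.integrable_surface ((hΩ.continuousOn_inner_normal w).mul hf.continuous.continuousOn)
  have hdiff : |(∫ y, ⟪w, outwardNormal Ω y⟫ * f y ∂(surface Ω)) - α * M| ≤
      2 * ε * ‖w‖ * M := by
    rw [hM, ← integral_const_mul, ← integral_const_mul, ← integral_sub hνf (hfs.const_mul _),
      ← Real.norm_eq_abs]
    refine norm_integral_le_of_norm_le (hfs.const_mul _) ?_
    filter_upwards [ae_surface_mem_frontier Ω] with y hy
    by_cases hfy : f y = 0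
    · simp [hfy]
    have hyb : y ∈ Metric.ball x r :=
      Metric.ball_subset_ball (by linarith) (hsupp (subset_tsupport f hfy))
    have hn := IsFlatAt.norm_sub_le hε ha H hyb (frontier_subset_closure hy)
      ((hΩ.isFlatAt_outwardNormal hy).isOutwardNormal hΩ.isOpen hy)
    have h1 : ⟪w, outwardNormal Ω y⟫ * f y - α * f y = ⟪w, outwardNormal Ω y - a⟫ * f y := by
      rw [inner_sub_right, real_inner_comm a w]
      ring
    rw [h1, norm_mul, Real.norm_eq_abs, Real.norm_eq_abs, abs_of_nonneg (hf0 y)]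
    have h2 := abs_real_inner_le_norm w (outwardNormal Ω y - a)
    have h3 : ‖w‖ * ‖outwardNormal Ω y - a‖ ≤ ‖w‖ * (2 * ε) := by gcongr
    have h4 : |⟪w, outwardNormal Ω y - a⟫| ≤ 2 * ε * ‖w‖ := by linarith
    gcongr
    exact hf0 y
  have hw0 := norm_nonneg w
  have hB : 0 ≤ (1 + 2 * ε) ^ (n - 1) - 1 :=
    sub_nonneg.2 (one_le_pow₀ (by linarith))
  have hIM : |α * I - α * M| ≤ ((1 + 2 * ε) ^ (n - 1) - 1) * ‖w‖ * M := by
    rw [← mul_sub, abs_mul, abs_sub_comm, abs_of_nonneg (sub_nonneg.2 hcmp1)]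
    have h1 : M - I ≤ ((1 + 2 * ε) ^ (n - 1) - 1) * M := by nlinarith
    calc |α| * (M - I) ≤ ‖w‖ * (((1 + 2 * ε) ^ (n - 1) - 1) * M) :=
          mul_le_mul hαw h1 (sub_nonneg.2 hcmp1) hw0
      _ = _ := by ring
  have htan' : |∫ y in Ω, fderiv ℝ f y v| ≤ 2 * ε * ‖w‖ * M := by
    refine htan.trans ?_
    gcongr
  rw [hsplit]
  have h5 := abs_le.1 hdiff
  have h6 := abs_le.1 hIM
  have h7 := abs_le.1 htan'
  rw [abs_le]
  constructor <;> nlinarith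

theorem integral_fderiv_eq_zero_of_compact {f : E n → ℝ} (hf : ContDiff ℝ 1 f)
    (hfc : HasCompactSupport f) (w : E n) : ∫ y, fderiv ℝ f y w = 0 := by
  have hi : Integrable (fun y => fderiv ℝ f y w) :=
    ((hf.continuous_fderiv (by norm_num)).clm_apply
      continuous_const).integrable_of_hasCompactSupport (hfc.fderiv_apply ℝ w)
  have := integral_mul_fderiv_eq_neg_fderiv_mul_of_integrable (μ := (volume : Measure (E n)))
    (f := fun _ => (1 : ℝ)) (g := f) (v := w) (by simp) (by simpa using hi)
    (by simpa using hf.continuous.integrable_of_hasCompactSupport hfc)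
    (fun _ _ => differentiableAt_const _) (fun _ _ => hf.differentiable (by norm_num) _)
  simpa using this

theorem setIntegral_fderiv_eq_zero {f : E n → ℝ} (hf : ContDiff ℝ 1 f)
    (hfc : HasCompactSupport f) (hsupp : tsupport f ⊆ Ω) (w : E n) :
    ∫ y in Ω, fderiv ℝ f y w = 0 := by
  rw [setIntegral_eq_integral_of_forall_compl_eq_zero, integral_fderiv_eq_zero_of_compact hf hfc]
  intro y hy
  have : fderiv ℝ f y = 0 := by
    by_contra h
    exact hy (hsupp (support_fderiv_subset ℝ h))
  rw [this]
  rfl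

/-- The local error is proportional to `∫ ψ_c f ds`. Over a partition of unity these add up to `∫ f
ds`, so the total error is at most `δ ‖w‖ ∫ f ds` however many pieces the scale requires, and `δ` is
arbitrary. -/
theorem IsC6Domain.integral_fderiv_of_nonneg (hΩ : IsC6Domain Ω) {f : E n → ℝ}
    (hf : ContDiff ℝ 1 f) (hf0 : ∀ y, 0 ≤ f y) (w : E n) :
    ∫ y in Ω, fderiv ℝ f y w = ∫ y, ⟪w, outwardNormal Ω y⟫ * f y ∂(surface Ω) := by
  have hfs : ∀ {g : E n → ℝ}, Continuous g → Integrable g (surface Ω) := fun hg =>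
    hΩ.integrable_surface hg.continuousOn
  have hνf : ∀ {g : E n → ℝ}, Continuous g →
      Integrable (fun y => ⟪w, outwardNormal Ω y⟫ * g y) (surface Ω) := fun hg =>
    hΩ.integrable_surface ((hΩ.continuousOn_inner_normal w).mul hg.continuousOn)
  set M := ∫ y, f y ∂(surface Ω) with hM
  have hM0 : 0 ≤ M := integral_nonneg hf0
  suffices h : ∀ δ : ℝ, 0 < δ → |(∫ y in Ω, fderiv ℝ f y w) -
      ∫ y, ⟪w, outwardNormal Ω y⟫ * f y ∂(surface Ω)| ≤ δ * (‖w‖ * M) by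
    rw [← sub_eq_zero, ← abs_nonpos_iff]
    have hlim : Tendsto (fun δ : ℝ => δ * (‖w‖ * M)) (𝓝[>] 0) (𝓝 0) := by
      have : Tendsto (fun δ : ℝ => δ * (‖w‖ * M)) (𝓝 0) (𝓝 (0 * (‖w‖ * M))) :=
        Continuous.tendsto (by fun_prop) 0
      rw [zero_mul] at this
      exact this.mono_left nhdsWithin_le_nhds
    exact ge_of_tendsto hlim (by filter_upwards [self_mem_nhdsWithin] with δ hδ using h δ hδ)
  intro δ hδ
  obtain ⟨ε, hε, hε1, hεδ⟩ : ∃ ε : ℝ, 0 < ε ∧ ε ≤ 1 / 2 ∧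
      4 * ε + ((1 + 2 * ε) ^ (n - 1) - 1) ≤ δ := by
    have hlim : Tendsto (fun ε : ℝ => 4 * ε + ((1 + 2 * ε) ^ (n - 1) - 1)) (𝓝[>] 0) (𝓝 0) := by
      have : Tendsto (fun ε : ℝ => 4 * ε + ((1 + 2 * ε) ^ (n - 1) - 1)) (𝓝 0)
        (𝓝 (4 * 0 + ((1 + 2 * 0) ^ (n - 1) - 1))) := Continuous.tendsto (by fun_prop) 0
      norm_num at this
      exact this.mono_left nhdsWithin_le_nhds
    have h1 : Ioo (0 : ℝ) (1 / 2) ∈ 𝓝[>] (0 : ℝ) := Ioo_mem_nhdsGT (by norm_num)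
    obtain ⟨ε, h2, h3⟩ := ((hlim.eventually (gt_mem_nhds hδ)).and h1).exists
    exact ⟨ε, h3.1, h3.2.le, h2.le⟩
  have hloc : ∀ c ∈ closure Ω, ∃ ρ : ℝ, 0 < ρ ∧ ∀ g : E n → ℝ, ContDiff ℝ 1 g → (∀ y, 0 ≤ g y) →
      HasCompactSupport g → tsupport g ⊆ Metric.ball c ρ →
      |(∫ y in Ω, fderiv ℝ g y w) - ∫ y, ⟪w, outwardNormal Ω y⟫ * g y ∂(surface Ω)| ≤
        δ * ‖w‖ * ∫ y, g y ∂(surface Ω) := by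
    intro c hc
    by_cases hcΩ : c ∈ Ω
    · obtain ⟨ρ, hρ, hsub⟩ := Metric.isOpen_iff.1 hΩ.isOpen c hcΩ
      refine ⟨ρ, hρ, fun g hg hg0 hgc hgs => ?_⟩
      have h1 := setIntegral_fderiv_eq_zero hg hgc (hgs.trans hsub) w
      have h2 : ∀ᵐ y ∂(surface Ω), g y = 0 := by
        filter_upwards [ae_surface_mem_frontier Ω] with y hy
        refine image_eq_zero_of_notMem_tsupport fun h => ?_
        exact (hΩ.isOpen.frontier_eq ▸ hy : y ∈ closure Ω \ Ω).2 (hsub (hgs h))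
      have h3 : ∫ y, ⟪w, outwardNormal Ω y⟫ * g y ∂(surface Ω) = 0 :=
        integral_eq_zero_of_ae (by filter_upwards [h2] with y hy; simp [hy])
      rw [h1, h3, sub_zero, abs_zero]
      exact mul_nonneg (by positivity) (integral_nonneg hg0)
    · have hcΓ : c ∈ frontier Ω := hΩ.isOpen.frontier_eq ▸ ⟨hc, hcΩ⟩
      obtain ⟨r, hr, H⟩ := hΩ.exists_flatOn hcΓ hε
      refine ⟨r / 2, by positivity, fun g hg hg0 hgc hgs => ?_⟩
      refine (H.abs_flux_sub_le hΩ hcΓ hr hε hε1 hg hg0 hgc hgs w).trans ?_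
      have : 0 ≤ ∫ y, g y ∂(surface Ω) := integral_nonneg hg0
      gcongr
  choose! ρ hρ hloc using hloc
  obtain ⟨s, ψ, hsK, hψ, hψ0, hψs, hψ1⟩ := exists_finite_partition hΩ.isCompact_closure ρ hρ
  have hψf : ∀ c, ContDiff ℝ 1 fun y => ψ c y * f y := fun c =>
    ((hψ c).of_le (by exact_mod_cast le_top)).mul hf
  have hts : ∀ c, tsupport (fun y => ψ c y * f y) ⊆ tsupport (ψ c) := fun c =>
    tsupport_mul_subset_left
  have hcpt : ∀ c ∈ s, HasCompactSupport fun y => ψ c y * f y := fun c hc =>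
    Metric.isCompact_of_isClosed_isBounded (isClosed_tsupport _)
      (Metric.isBounded_ball.subset ((hts c).trans (hψs c hc)))
  have hbd : ∀ c ∈ s, _ := fun c hc => hloc c (hsK c hc) (fun y => ψ c y * f y) (hψf c)
    (fun y => mul_nonneg (hψ0 c y) (hf0 y)) (hcpt c hc) ((hts c).trans (hψs c hc))
  have hsum1 : ∫ y in Ω, fderiv ℝ f y w =
      ∑ c ∈ s, ∫ y in Ω, fderiv ℝ (fun y => ψ c y * f y) y w := by
    rw [← integral_finsetSum]
    · refine setIntegral_congr_fun hΩ.isOpen.measurableSet fun y hy => ?_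
      have h1 : f =ᶠ[𝓝 y] fun y => ∑ c ∈ s, ψ c y * f y := by
        filter_upwards [hΩ.isOpen.mem_nhds hy] with z hz
        rw [← Finset.sum_mul, hψ1 z (subset_closure hz), one_mul]
      rw [h1.fderiv_eq, fderiv_fun_sum fun c _ => (hψf c).differentiable (by norm_num) y]
      simp
    · exact fun c hc => ((((hψf c).continuous_fderiv (by norm_num)).clm_apply
        continuous_const).integrable_of_hasCompactSupport ((hcpt c hc).fderiv_apply ℝ w)).restrict
  have hone : ∀ᵐ y ∂(surface Ω), ∑ c ∈ s, ψ c y = 1 := by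
    filter_upwards [ae_surface_mem_frontier Ω] with y hy using hψ1 y (frontier_subset_closure hy)
  have hsum2 : ∫ y, ⟪w, outwardNormal Ω y⟫ * f y ∂(surface Ω) =
      ∑ c ∈ s, ∫ y, ⟪w, outwardNormal Ω y⟫ * (ψ c y * f y) ∂(surface Ω) := by
    rw [← integral_finsetSum _ fun c _ => hνf (hψf c).continuous]
    refine integral_congr_ae ?_
    filter_upwards [hone] with y hy
    rw [← Finset.mul_sum, ← Finset.sum_mul, hy, one_mul]
  have hsum3 : M = ∑ c ∈ s, ∫ y, ψ c y * f y ∂(surface Ω) := by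
    rw [hM, ← integral_finsetSum _ fun c _ => hfs (hψf c).continuous]
    refine integral_congr_ae ?_
    filter_upwards [hone] with y hy
    rw [← Finset.sum_mul, hy, one_mul]
  rw [hsum1, hsum2, ← Finset.sum_sub_distrib, ← mul_assoc, hsum3, Finset.mul_sum]
  exact (Finset.abs_sum_le_sum_abs _ _).trans (Finset.sum_le_sum hbd)

/-- The divergence theorem on a smooth bounded domain. -/
theorem IsC6Domain.integral_fderiv_eq (hΩ : IsC6Domain Ω) {f : E n → ℝ}
    (hf : ContDiff ℝ 1 f) (w : E n) :
    ∫ y in Ω, fderiv ℝ f y w = ∫ y, ⟪w, outwardNormal Ω y⟫ * f y ∂(surface Ω) := by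
  -- A `C¹` function is the difference of the positive `C¹` functions `f² + f + 1` and `f² + 1`; the
  -- positive and negative parts of `f` need not be `C¹`.
  have h1 := hΩ.integral_fderiv_of_nonneg (f := fun y => f y ^ 2 + f y + 1)
    (((hf.pow 2).add hf).add contDiff_const) (fun y => by nlinarith [sq_nonneg (f y + 1 / 2)]) w
  have h2 := hΩ.integral_fderiv_of_nonneg (f := fun y => f y ^ 2 + 1)
    ((hf.pow 2).add contDiff_const) (fun y => by positivity) w
  have hfd := hf.differentiable (by norm_num)
  have hc1 : Continuous fun y => fderiv ℝ (fun y => f y ^ 2 + 1) y w :=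
    (((hf.pow 2).add contDiff_const).continuous_fderiv (by norm_num)).clm_apply continuous_const
  have hc2 : Continuous fun y => fderiv ℝ f y w :=
    (hf.continuous_fderiv (by norm_num)).clm_apply continuous_const
  have hint : ∀ {g : E n → ℝ}, Continuous g → Integrable g (volume.restrict Ω) := fun hg =>
    (hg.continuousOn.integrableOn_compact hΩ.isCompact_closure).mono_set subset_closure
  have hνf : ∀ {g : E n → ℝ}, Continuous g →
      Integrable (fun y => ⟪w, outwardNormal Ω y⟫ * g y) (surface Ω) := fun hg =>
    hΩ.integrable_surface ((hΩ.continuousOn_inner_normal w).mul hg.continuousOn)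
  have h3 : ∀ y, fderiv ℝ (fun y => f y ^ 2 + f y + 1) y w =
      fderiv ℝ (fun y => f y ^ 2 + 1) y w + fderiv ℝ f y w := by
    intro y
    have : (fun y => f y ^ 2 + f y + 1) = fun y => (f y ^ 2 + 1) + f y := by
      funext y
      ring
    have hd : DifferentiableAt ℝ (fun y => f y ^ 2 + 1) y := ((hfd y).pow 2).add_const 1
    rw [this, fderiv_fun_add hd (hfd y)]
    rfl
  simp only [h3] at h1
  rw [integral_add (hint hc1) (hint hc2), h2] at h1
  have h4 : ∫ y, ⟪w, outwardNormal Ω y⟫ * (f y ^ 2 + f y + 1) ∂(surface Ω) =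
      ∫ y, ⟪w, outwardNormal Ω y⟫ * (f y ^ 2 + 1) ∂(surface Ω) +
      ∫ y, ⟪w, outwardNormal Ω y⟫ * f y ∂(surface Ω) := by
    rw [← integral_add (hνf (by have := hf.continuous; fun_prop)) (hνf hf.continuous)]
    refine integral_congr_ae (Eventually.of_forall fun y => ?_)
    simp only
    ring
  linarith

/-! ### One-sided mollifiers -/

/-- The truncated cone `{y - t b : 0 < t ≤ R, |b - a| ≤ 1 / 4}` is contained in `Ω` for all points
`y` of `closure Ω` near `x`. -/
structure ConeAt (Ω : Set (E n)) (x a : E n) (R : ℝ) : Prop where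
  norm_le : ‖a‖ ≤ 1
  pos : 0 < R
  mem : ∀ y ∈ closure Ω, y ∈ Metric.ball x R → ∀ t : ℝ, 0 < t → t ≤ R →
    ∀ b ∈ Metric.closedBall a (1 / 4), y - t • b ∈ Ω

theorem ConeAt.norm_dir_le {Ω : Set (E n)} {x a : E n} {R : ℝ} (h : ConeAt Ω x a R) {b : E n}
    (hb : b ∈ Metric.closedBall a (1 / 4)) : ‖b‖ ≤ 5 / 4 := by
  rw [mem_closedBall_iff_norm] at hb
  have := norm_add_le (b - a) a
  rw [sub_add_cancel] at this
  linarith [h.norm_le]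

/-- At an interior point the axis is `0` and the cone is a full ball of directions. At a boundary
point the axis is the normal: `⟪a, b⟫ ≥ 3/4` and `‖b‖ ≤ 5/4` meet the flatness condition with `ε =
1/2`, since `3/4 ≥ 5/8`, and `R = r / 3` keeps `y - t b` in the ball of radius `r`. -/
theorem IsC6Domain.exists_coneAt {Ω : Set (E n)} (hΩ : IsC6Domain Ω) {x : E n}
    (hx : x ∈ closure Ω) : ∃ a R, ConeAt Ω x a R := by
  by_cases hxΩ : x ∈ Ω
  · obtain ⟨ρ, hρ, hsub⟩ := Metric.isOpen_iff.1 hΩ.isOpen x hxΩ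
    refine ⟨0, ρ / 2, by simp, by positivity, fun y _ hy t ht htR b hb => hsub ?_⟩
    rw [mem_closedBall_zero_iff] at hb
    rw [mem_ball_iff_norm] at hy ⊢
    have h1 : y - t • b - x = (y - x) - t • b := by abel
    have h2 := norm_sub_le (y - x) (t • b)
    rw [norm_smul, Real.norm_eq_abs, abs_of_pos ht] at h2
    rw [h1]
    nlinarith [norm_nonneg b]
  · have hxΓ : x ∈ frontier Ω := hΩ.isOpen.frontier_eq ▸ ⟨hx, hxΩ⟩
    have ha := hΩ.norm_outwardNormal hxΓ
    obtain ⟨r, hr, H⟩ := hΩ.exists_flatOn hxΓ (ε := 1 / 2) (by norm_num)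
    refine ⟨outwardNormal Ω x, r / 3, ha.le, by positivity, fun y hyc hy t ht htR b hb => ?_⟩
    rw [mem_closedBall_iff_norm] at hb
    rw [mem_ball_iff_norm] at hy
    have hbn : ‖b‖ ≤ 5 / 4 := by
      have := norm_add_le (b - outwardNormal Ω x) (outwardNormal Ω x)
      rw [sub_add_cancel] at this
      linarith
    have hin : 3 / 4 ≤ ⟪outwardNormal Ω x, b⟫ := by
      have h1 : b = outwardNormal Ω x + (b - outwardNormal Ω x) := by abel
      have h2 := abs_real_inner_le_norm (outwardNormal Ω x) (b - outwardNormal Ω x)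
      rw [ha, one_mul] at h2
      rw [h1, inner_add_right, real_inner_self_eq_norm_sq, ha]
      have := (abs_le.1 h2).1
      linarith
    refine H y (by rw [mem_ball_iff_norm]; linarith) _ ?_ hyc ?_ ?_
    · rw [mem_ball_iff_norm]
      have h1 : y - t • b - x = (y - x) - t • b := by abel
      have h2 := norm_sub_le (y - x) (t • b)
      rw [norm_smul, Real.norm_eq_abs, abs_of_pos ht] at h2
      rw [h1]
      nlinarith [norm_nonneg b]
    · intro h
      have h0 : t • b = 0 := sub_eq_self.1 h.symm
      rcases smul_eq_zero.1 h0 with h | h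
      · exact ht.ne' h
      · rw [h, inner_zero_right] at hin
        linarith
    · have h1 : y - t • b - y = -(t • b) := by abel
      rw [h1, inner_neg_right, norm_neg, inner_smul_right, norm_smul, Real.norm_eq_abs,
        abs_of_pos ht]
      nlinarith

/-- The rescaled kernel `t⁻ⁿ κ(u / t)`. -/
def kern (κ : E n → ℝ) (t : ℝ) (u : E n) : ℝ := t⁻¹ ^ n * κ (t⁻¹ • u)

/-- Smooth kernels supported in the ball of radius `1 / 4` around `a`. -/
structure IsKernel (κ : E n → ℝ) (a : E n) : Prop where
  contDiff : ContDiff ℝ ∞ κ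
  tsupport_subset : tsupport κ ⊆ Metric.closedBall a (1 / 4)

theorem IsKernel.hasCompactSupport {κ : E n → ℝ} {a : E n} (h : IsKernel κ a) :
    HasCompactSupport κ :=
  (isCompact_closedBall a _).of_isClosed_subset (isClosed_tsupport _) h.tsupport_subset

theorem IsKernel.mul_left {κ m : E n → ℝ} {a : E n} (h : IsKernel κ a) (hm : ContDiff ℝ ∞ m) :
    IsKernel (fun b => m b * κ b) a :=
  ⟨hm.mul h.contDiff, tsupport_mul_subset_right.trans h.tsupport_subset⟩

theorem IsKernel.contDiff_kern {κ : E n → ℝ} {a : E n} (h : IsKernel κ a) (t : ℝ) :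
    ContDiff ℝ ∞ (kern κ t) :=
  contDiff_const.mul (h.contDiff.comp (contDiff_const_smul _))

theorem IsKernel.hasCompactSupport_kern {κ : E n → ℝ} {a : E n} (h : IsKernel κ a) {t : ℝ}
    (ht : 0 < t) : HasCompactSupport (kern κ t) :=
  (h.hasCompactSupport.comp_smul (inv_ne_zero ht.ne')).mul_left

theorem IsKernel.fderiv_kern {κ : E n → ℝ} {a : E n} (h : IsKernel κ a) (t : ℝ) (u w : E n) :
    fderiv ℝ (kern κ t) u w = t⁻¹ * kern (fun b => fderiv ℝ κ b w) t u := by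
  have h1 : HasFDerivAt (fun u : E n => t⁻¹ • u) (t⁻¹ • ContinuousLinearMap.id ℝ (E n)) u :=
    (t⁻¹ • ContinuousLinearMap.id ℝ (E n)).hasFDerivAt
  have h2 := ((h.contDiff.differentiable (by simp) (t⁻¹ • u)).hasFDerivAt.comp u h1).const_mul
    (t⁻¹ ^ n)
  have h3 : fderiv ℝ (kern κ t) u = _ := h2.fderiv
  rw [h3]
  simp [kern]
  ring

/-- `∇κ` in direction `w` is again a kernel. -/
theorem IsKernel.fderiv_apply {κ : E n → ℝ} {a : E n} (h : IsKernel κ a) (w : E n) :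
    IsKernel (fun b => fderiv ℝ κ b w) a :=
  ⟨(h.contDiff.fderiv_right (m := ∞) (by simp)).clm_apply contDiff_const,
    (tsupport_fderiv_apply_subset ℝ w).trans h.tsupport_subset⟩

/-- The mollification `J f(y) = ∫_Ω f(z) t⁻ⁿ κ((y - z) / t) dz`. -/
def moll (Ω : Set (E n)) (κ : E n → ℝ) (t : ℝ) (f : E n → ℝ) (y : E n) : ℝ :=
  ∫ z in Ω, f z * kern κ t (y - z)

section

variable {Ω : Set (E n)} {κ : E n → ℝ} {x a : E n} {R t : ℝ}

theorem ConeAt.mem_of_kern_ne_zero (hC : ConeAt Ω x a R)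
    (hκ : tsupport κ ⊆ Metric.closedBall a (1 / 4))
    {y z : E n} (hyc : y ∈ closure Ω) (hy : y ∈ Metric.ball x R) (ht : 0 < t) (htR : t ≤ R)
    (hz : kern κ t (y - z) ≠ 0) : z ∈ Ω := by
  have h1 : κ (t⁻¹ • (y - z)) ≠ 0 := fun h => hz (by simp [kern, h])
  have h2 := hC.mem y hyc hy t ht htR _ (hκ (subset_tsupport κ h1))
  rwa [smul_smul, mul_inv_cancel₀ ht.ne', one_smul, sub_sub_cancel] at h2

/-- The support of the kernel lies in `y - t B(a, 1/4)`, hence in `Ω` even when `y` is on the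
boundary. This is why weak identities in `Ω` can be mollified up to the boundary without extending
functions across it. -/
theorem ConeAt.isTest_kern (hC : ConeAt Ω x a R) (hκ : IsKernel κ a)
    {y : E n} (hyc : y ∈ closure Ω) (hy : y ∈ Metric.ball x R) (ht : 0 < t) (htR : t ≤ R) :
    IsTest Ω (fun z => kern κ t (y - z)) := by
  have hK : IsCompact ((fun b => y - t • b) '' Metric.closedBall a (1 / 4)) :=
    (isCompact_closedBall a _).image (by fun_prop)
  have hsub : tsupport (fun z => kern κ t (y - z)) ⊆
      (fun b => y - t • b) '' Metric.closedBall a (1 / 4) := by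
    refine closure_minimal (fun z hz => ?_) hK.isClosed
    have h1 : κ (t⁻¹ • (y - z)) ≠ 0 := fun h => hz (by simp [kern, h])
    refine ⟨t⁻¹ • (y - z), hκ.tsupport_subset (subset_tsupport κ h1), ?_⟩
    simp only
    rw [smul_smul, mul_inv_cancel₀ ht.ne', one_smul, sub_sub_cancel]
  refine ⟨(hκ.contDiff_kern t).comp (contDiff_const.sub contDiff_id),
    hK.of_isClosed_subset (isClosed_tsupport _) hsub, hsub.trans ?_⟩
  rintro _ ⟨b, hb, rfl⟩
  exact hC.mem y hyc hy t ht htR b hb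

theorem moll_eq_convolution (hΩ : IsOpen Ω) (f : E n → ℝ) :
    moll Ω κ t f = convolution (Ω.indicator f) (kern κ t) (ContinuousLinearMap.mul ℝ ℝ) volume := by
  funext y
  rw [moll, convolution, ← integral_indicator hΩ.measurableSet]
  refine integral_congr_ae (Eventually.of_forall fun z => ?_)
  by_cases hz : z ∈ Ω <;> simp [hz]

theorem contDiff_moll (hΩ : IsOpen Ω) (hκ : IsKernel κ a) (ht : 0 < t) {f : E n → ℝ}
    (hf : IntegrableOn f Ω) : ContDiff ℝ ∞ (moll Ω κ t f) := by
  rw [moll_eq_convolution hΩ]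
  exact (hκ.hasCompactSupport_kern ht).contDiff_convolution_right _
    (hf.integrable_indicator hΩ.measurableSet).locallyIntegrable (hκ.contDiff_kern t)

theorem fderiv_moll (hΩ : IsOpen Ω) (hκ : IsKernel κ a) (ht : 0 < t) {f : E n → ℝ}
    (hf : IntegrableOn f Ω) (y w : E n) :
    fderiv ℝ (moll Ω κ t f) y w = ∫ z in Ω, f z * fderiv ℝ (kern κ t) (y - z) w := by
  have hfl : LocallyIntegrable (Ω.indicator f) :=
    (hf.integrable_indicator hΩ.measurableSet).locallyIntegrable
  have hK1 : ContDiff ℝ 1 (kern κ t) := (hκ.contDiff_kern t).of_le (by exact_mod_cast le_top)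
  rw [moll_eq_convolution hΩ, ((hκ.hasCompactSupport_kern ht).hasFDerivAt_convolution_right
    (ContinuousLinearMap.mul ℝ ℝ) hfl hK1 y).fderiv, convolution,
    ContinuousLinearMap.integral_apply, ← integral_indicator hΩ.measurableSet]
  · refine integral_congr_ae (Eventually.of_forall fun z => ?_)
    by_cases hz : z ∈ Ω <;> simp [hz]
  · exact ((hκ.hasCompactSupport_kern ht).fderiv ℝ).convolutionExists_right _ hfl
      (hK1.continuous_fderiv (by norm_num)) y

theorem gradient_apply (φ : E n → ℝ) (y : E n) (i : Fin n) :
    gradient φ y i = fderiv ℝ φ y (EuclideanSpace.single i 1) := by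
  rw [← InnerProductSpace.toDual_symm_apply (𝕜 := ℝ), EuclideanSpace.inner_single_right]
  simp [gradient]

theorem inner_gradient (φ : E n → ℝ) (y w : E n) : ⟪w, gradient φ y⟫ = fderiv ℝ φ y w := by
  rw [real_inner_comm, gradient, InnerProductSpace.toDual_symm_apply]

theorem fderiv_comp_sub_left {φ : E n → ℝ} (hφ : Differentiable ℝ φ) (y z w : E n) :
    fderiv ℝ (fun z => φ (y - z)) z w = -fderiv ℝ φ (y - z) w := by
  have h1 : HasFDerivAt (fun z : E n => y - z) (-ContinuousLinearMap.id ℝ (E n)) z :=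
    (hasFDerivAt_id z).const_sub y
  have h2 := (hφ (y - z)).hasFDerivAt.comp z h1
  have h3 : fderiv ℝ (fun z => φ (y - z)) z = _ := h2.fderiv
  rw [h3]
  simp

/-- Mollification commutes with weak derivatives. -/
theorem ConeAt.fderiv_moll_eq (hΩ : IsOpen Ω) (hC : ConeAt Ω x a R) (hκ : IsKernel κ a)
    {y : E n} (hyc : y ∈ closure Ω) (hy : y ∈ Metric.ball x R) (ht : 0 < t) (htR : t ≤ R)
    {f g : E n → ℝ} {i : Fin n} (hf : IntegrableOn f Ω) (hg : HasWeakPartial Ω i f g) :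
    fderiv ℝ (moll Ω κ t f) y (EuclideanSpace.single i 1) = moll Ω κ t g y := by
  have h1 := hg.2.2 _ (hC.isTest_kern hκ hyc hy ht htR)
  rw [fderiv_moll hΩ hκ ht hf, moll, eq_comm, ← neg_eq_iff_eq_neg.2 h1, ← integral_neg]
  refine integral_congr_ae (Eventually.of_forall fun z => ?_)
  simp only
  rw [gradient_apply, fderiv_comp_sub_left ((hκ.contDiff_kern t).differentiable (by simp))]
  ring

end

/-! ### `L²` convergence of mollifications -/

theorem eLpNorm_two_sq {α : Type*} [MeasurableSpace α] (μ : Measure α) (f : α → ℝ) :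
    eLpNorm f 2 μ ^ 2 = ∫⁻ x, ‖f x‖ₑ ^ 2 ∂μ := by
  have := eLpNorm_nnreal_pow_eq_lintegral (f := f) (μ := μ) (p := 2) (by norm_num)
  simpa using this

theorem tendsto_eLpNorm_two_iff {α ι : Type*} [MeasurableSpace α] {μ : Measure α}
    {l : Filter ι} {f : ι → α → ℝ} :
    Tendsto (fun i => eLpNorm (f i) 2 μ) l (𝓝 0) ↔
      Tendsto (fun i => ∫⁻ x, ‖f i x‖ₑ ^ 2 ∂μ) l (𝓝 0) := by
  simp only [← eLpNorm_two_sq]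
  constructor
  · intro h
    have := ENNReal.Tendsto.pow (n := 2) h
    simpa using this
  · intro h
    have := h.ennrpow_const (1 / 2)
    simp only [← ENNReal.rpow_natCast, ← ENNReal.rpow_mul] at this
    simpa using this

/-- This is the Cauchy–Schwarz inequality for the functions `1` and `g` in the measure `k dμ`. -/
theorem sq_lintegral_mul_le {α : Type*} [MeasurableSpace α] {μ : Measure α} {k g : α → ℝ≥0∞}
    (hk : Measurable k) (hg : Measurable g) :
    (∫⁻ x, k x * g x ∂μ) ^ 2 ≤ (∫⁻ x, k x ∂μ) * ∫⁻ x, k x * g x ^ 2 ∂μ := by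
  have h := ENNReal.lintegral_mul_le_Lp_mul_Lq (μ.withDensity k) Real.HolderConjugate.two_two
    (f := fun _ => 1) (g := g) aemeasurable_const hg.aemeasurable
  have h1 : ∫⁻ x, k x * g x ∂μ = ∫⁻ a, ((fun _ => 1 : α → ℝ≥0∞) * g) a ∂(μ.withDensity k) := by
    rw [lintegral_withDensity_eq_lintegral_mul _ hk (measurable_const.mul hg)]
    simp
  rw [← h1] at h
  have h2 := pow_le_pow_left' h 2
  refine h2.trans (le_of_eq ?_)
  rw [mul_pow, ← ENNReal.rpow_natCast, ← ENNReal.rpow_natCast, ← ENNReal.rpow_mul,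
    ← ENNReal.rpow_mul]
  norm_num
  rw [lintegral_withDensity_eq_lintegral_mul _ hk (by fun_prop)]
  simp

theorem lintegral_eq_smul_comp (t : ℝ) (ht : 0 < t) (y : E n) {G : E n → ℝ≥0∞}
    (hG : Measurable G) :
    ∫⁻ z, G z = ENNReal.ofReal (t ^ n) * ∫⁻ b, G (y - t • b) := by
  have h1 : ∫⁻ z, G z = ∫⁻ u, G (y - u) :=
    ((Measure.measurePreserving_sub_left volume y).lintegral_comp hG).symm
  have h2 := Measure.map_addHaar_smul (volume : Measure (E n)) ht.ne'
  have h3 : ∫⁻ b, G (y - t • b) = ∫⁻ u, G (y - u) ∂(Measure.map (t • ·) volume) :=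
    (lintegral_map (f := fun u => G (y - u)) (by fun_prop) (by fun_prop)).symm
  have hpos : 0 < t ^ n := by positivity
  rw [h3, h2, lintegral_smul_measure, finrank_euclideanSpace_fin, h1, abs_of_pos (by positivity),
    smul_eq_mul, ← mul_assoc, ← ENNReal.ofReal_mul hpos.le, mul_inv_cancel₀ hpos.ne',
    ENNReal.ofReal_one, one_mul]

/-- The mean oscillation of `F` around `y`, at scale `t`. -/
def osc (κ F : E n → ℝ) (t : ℝ) (y : E n) : ℝ≥0∞ := ∫⁻ z, ‖kern κ t (y - z)‖ₑ * ‖F z - F y‖ₑ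

theorem osc_eq {κ F : E n → ℝ} (hκ : Continuous κ) (hF : Measurable F) {t : ℝ} (ht : 0 < t)
    (y : E n) : osc κ F t y = ∫⁻ b, ‖κ b‖ₑ * ‖F (y - t • b) - F y‖ₑ := by
  have hk : Continuous fun z => kern κ t (y - z) := by
    unfold kern
    fun_prop
  have hpos : 0 < t ^ n := by positivity
  rw [osc, lintegral_eq_smul_comp t ht y (G := fun z => ‖kern κ t (y - z)‖ₑ * ‖F z - F y‖ₑ)
    (hk.measurable.enorm.mul (hF.sub_const _).enorm), ← lintegral_const_mul']
  · refine lintegral_congr fun b => ?_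
    simp only [kern, sub_sub_cancel]
    rw [smul_smul, inv_mul_cancel₀ ht.ne', one_smul, enorm_mul, inv_pow,
      Real.enorm_of_nonneg (by positivity), ← mul_assoc, ← mul_assoc, ← ENNReal.ofReal_mul hpos.le,
      mul_inv_cancel₀ hpos.ne', ENNReal.ofReal_one, one_mul]
  · exact ENNReal.ofReal_ne_top

theorem tendsto_translate {F : E n → ℝ} (hF : MemLp F 2 volume) :
    Tendsto (fun h : E n => ∫⁻ y, ‖F (y - h) - F y‖ₑ ^ 2) (𝓝 0) (𝓝 0) := by
  rw [← tendsto_eLpNorm_two_iff (f := fun h y => F (y - h) - F y)]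
  have hmp : ∀ h : E n, MeasurePreserving (fun y : E n => y - h) volume volume := fun h =>
    measurePreserving_sub_right volume h
  let g : C(E n, C(E n, E n)) := (ContinuousMap.mk (fun p : E n × E n => p.2 - p.1)
    (by fun_prop)).curry
  have hg : ∀ h y, g h y = y - h := fun h y => rfl
  have h1 := Continuous.compMeasurePreservingLp (μ := (volume : Measure (E n)))
    (ν := (volume : Measure (E n))) (p := 2)
    (f := fun _ : E n => hF.toLp F) (g := g) continuous_const g.continuous hmp (by norm_num)
  have h2 := h1.tendsto 0
  rw [Lp.tendsto_Lp_iff_tendsto_eLpNorm'] at h2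
  refine h2.congr fun h => eLpNorm_congr_ae ?_
  have e1 := Lp.coeFn_compMeasurePreserving (hF.toLp F) (f := g h) (hmp h)
  have e2 := (hmp h).quasiMeasurePreserving.ae_eq_comp hF.coeFn_toLp
  have e3 := Lp.coeFn_compMeasurePreserving (hF.toLp F) (f := g 0) (hmp 0)
  have e4 := (hmp 0).quasiMeasurePreserving.ae_eq_comp hF.coeFn_toLp
  filter_upwards [e1, e2, e3, e4] with y h1 h2 h3 h4
  simp only [Pi.sub_apply, h1, h3]
  simp only [Function.comp, hg] at *
  rw [h2, h4, sub_zero]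

/-- After the substitution `z = y - t b`, Cauchy–Schwarz and Tonelli bound the integral by an
average over `b` of the squared `L²` norms of `F(· - t b) - F`. The vectors `b` stay in a bounded
set, and translations are continuous in `L²`. -/
theorem tendsto_osc {κ F : E n → ℝ} (hκ : Continuous κ) (hκc : HasCompactSupport κ)
    (hF : MemLp F 2 volume) (hFm : Measurable F) :
    Tendsto (fun t => ∫⁻ y, osc κ F t y ^ 2) (𝓝[>] 0) (𝓝 0) := by
  obtain ⟨ρ, hρ⟩ := hκc.isBounded.subset_closedBall (0 : E n)
  set A : ℝ≥0∞ := ∫⁻ b, ‖κ b‖ₑ with hA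
  have hAfin : A ≠ ⊤ := (hκ.integrable_of_hasCompactSupport hκc).hasFiniteIntegral.ne
  have hbound : ∀ t : ℝ, 0 < t → ∫⁻ y, osc κ F t y ^ 2 ≤
      A * ∫⁻ b, ‖κ b‖ₑ * ∫⁻ y, ‖F (y - t • b) - F y‖ₑ ^ 2 := by
    intro t ht
    have hm : Measurable (Function.uncurry fun (y b : E n) =>
        ‖κ b‖ₑ * ‖F (y - t • b) - F y‖ₑ ^ 2) := by
      have := hκ.measurable
      simp only [Function.uncurry_def]
      fun_prop
    calc ∫⁻ y, osc κ F t y ^ 2 ≤ ∫⁻ y, A * ∫⁻ b, ‖κ b‖ₑ * ‖F (y - t • b) - F y‖ₑ ^ 2 := by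
          refine lintegral_mono fun y => ?_
          rw [osc_eq hκ hFm ht]
          exact sq_lintegral_mul_le hκ.measurable.enorm (by fun_prop)
      _ = A * ∫⁻ b, ‖κ b‖ₑ * ∫⁻ y, ‖F (y - t • b) - F y‖ₑ ^ 2 := by
          rw [lintegral_const_mul' _ _ hAfin, lintegral_lintegral_swap hm.aemeasurable]
          congr 1
          refine lintegral_congr fun b => ?_
          rw [lintegral_const_mul' _ _ enorm_ne_top]
  rw [ENNReal.tendsto_nhds_zero]
  intro η hη
  obtain ⟨η', hη', hη''⟩ : ∃ η' : ℝ≥0∞, 0 < η' ∧ A * (A * η') ≤ η := by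
    have hlim : Tendsto (fun c : ℝ≥0∞ => A * (A * c)) (𝓝[>] 0) (𝓝 0) := by
      have h1 := ENNReal.Tendsto.const_mul (a := A) (ENNReal.Tendsto.const_mul (a := A)
        (tendsto_id (α := ℝ≥0∞) (x := 𝓝 0)) (Or.inr hAfin)) (Or.inr hAfin)
      simp only [mul_zero, id] at h1
      exact h1.mono_left nhdsWithin_le_nhds
    obtain ⟨c, h1, h2⟩ := (((ENNReal.tendsto_nhds_zero.1 hlim) η hη).and
      self_mem_nhdsWithin).exists
    exact ⟨c, h2, h1⟩
  have h1 := ENNReal.tendsto_nhds_zero.1 (tendsto_translate hF) η' hη'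
  obtain ⟨δ, hδ, h2⟩ := Metric.eventually_nhds_iff.1 h1
  have h3 : Ioo (0 : ℝ) (δ / (|ρ| + 1)) ∈ 𝓝[>] (0 : ℝ) := Ioo_mem_nhdsGT (by positivity)
  filter_upwards [h3] with t ht
  refine (hbound t ht.1).trans (le_trans ?_ hη'')
  gcongr
  rw [hA, ← lintegral_mul_const _ hκ.measurable.enorm]
  refine lintegral_mono fun b => ?_
  by_cases hb : κ b = 0
  · simp [hb]
  gcongr
  refine h2 ?_
  have hbρ := hρ (subset_tsupport κ hb)
  rw [mem_closedBall_zero_iff] at hbρ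
  rw [dist_zero_right, norm_smul, Real.norm_eq_abs, abs_of_pos ht.1]
  have h4 := (lt_div_iff₀ (by positivity)).1 ht.2
  have h5 := le_abs_self ρ
  nlinarith [norm_nonneg b, ht.1]

/-- Both the mollification error and the Friedrichs commutator are pointwise bounded by an
oscillation, with different kernels, so this covers both limits. -/
theorem tendsto_eLpNorm_of_le_osc {κ F : E n → ℝ} (hκ : Continuous κ) (hκc : HasCompactSupport κ)
    (hF : MemLp F 2 volume) (hFm : Measurable F) {W : Set (E n)} {h : ℝ → E n → ℝ}
    (hle : ∀ᶠ t in 𝓝[>] 0, ∀ᵐ y ∂(volume.restrict W), ‖h t y‖ₑ ≤ osc κ F t y) :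
    Tendsto (fun t => eLpNorm (h t) 2 (volume.restrict W)) (𝓝[>] 0) (𝓝 0) := by
  rw [tendsto_eLpNorm_two_iff]
  refine tendsto_of_tendsto_of_tendsto_of_le_of_le' tendsto_const_nhds (tendsto_osc hκ hκc hF hFm)
    (Eventually.of_forall fun _ => zero_le) ?_
  filter_upwards [hle] with t ht
  calc ∫⁻ y in W, ‖h t y‖ₑ ^ 2 ≤ ∫⁻ y in W, osc κ F t y ^ 2 := by
        refine lintegral_mono_ae ?_
        filter_upwards [ht] with y hy
        gcongr
    _ ≤ ∫⁻ y, osc κ F t y ^ 2 := setLIntegral_le_lintegral _ _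

/-! ### Convergence of one-sided mollifications and the Friedrichs commutator -/

/-- Nonnegative kernels of integral one. -/
structure IsMollifier (κ : E n → ℝ) (a : E n) : Prop extends IsKernel κ a where
  nonneg : ∀ b, 0 ≤ κ b
  integral_eq_one : ∫ b, κ b = 1

theorem exists_isMollifier (a : E n) : ∃ κ, IsMollifier κ a := by
  let b : ContDiffBump a := ⟨1 / 8, 1 / 4, by norm_num, by norm_num⟩
  refine ⟨b.normed volume, ⟨b.contDiff_normed, ?_⟩, fun x => b.nonneg_normed x,
    b.integral_normed⟩
  rw [b.tsupport_normed_eq]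

section

variable {Ω : Set (E n)} {κ : E n → ℝ} {x a : E n} {R t : ℝ}

theorem IsKernel.exists_bound_kern (hκ : IsKernel κ a) (ht : 0 < t) :
    ∃ C, ∀ u, ‖kern κ t u‖ ≤ C :=
  (hκ.hasCompactSupport_kern ht).exists_bound_of_continuous (hκ.contDiff_kern t).continuous

theorem IsKernel.integrableOn_mul_kern (hκ : IsKernel κ a) (ht : 0 < t) {f : E n → ℝ}
    (hf : IntegrableOn f Ω) (y : E n) : IntegrableOn (fun z => f z * kern κ t (y - z)) Ω := by
  obtain ⟨C, hC⟩ := hκ.exists_bound_kern ht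
  exact Integrable.mul_bdd (c := C) hf
    ((hκ.contDiff_kern t).continuous.comp (by fun_prop)).aestronglyMeasurable
    (Eventually.of_forall fun z => hC _)

theorem integral_kern (κ : E n → ℝ) (ht : 0 < t) : ∫ u, kern κ t u = ∫ b, κ b := by
  have h := Measure.integral_comp_inv_smul (volume : Measure (E n)) κ t
  have hpos : 0 < t ^ n := by positivity
  simp only [kern]
  rw [integral_const_mul, h, finrank_euclideanSpace_fin, abs_of_pos hpos, smul_eq_mul, ← mul_assoc,
    inv_pow, inv_mul_cancel₀ hpos.ne', one_mul]

theorem ConeAt.setIntegral_kern (hC : ConeAt Ω x a R) (hκ : IsKernel κ a)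
    {y : E n} (hyc : y ∈ closure Ω) (hy : y ∈ Metric.ball x R) (ht : 0 < t) (htR : t ≤ R) :
    ∫ z in Ω, kern κ t (y - z) = ∫ b, κ b := by
  rw [← integral_kern κ ht, ← integral_sub_left_eq_self (kern κ t) volume y]
  refine setIntegral_eq_integral_of_forall_compl_eq_zero fun z hz => ?_
  by_contra h
  exact hz (hC.mem_of_kern_ne_zero hκ.tsupport_subset hyc hy ht htR h)

theorem ConeAt.moll_sub (hC : ConeAt Ω x a R) (hκ : IsMollifier κ a)
    {y : E n} (hyc : y ∈ closure Ω) (hy : y ∈ Metric.ball x R) (ht : 0 < t) (htR : t ≤ R)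
    {f : E n → ℝ} (hf : IntegrableOn f Ω) (c : ℝ) :
    moll Ω κ t f y - c = ∫ z in Ω, (f z - c) * kern κ t (y - z) := by
  have h1 := hC.setIntegral_kern hκ.toIsKernel hyc hy ht htR
  rw [hκ.integral_eq_one] at h1
  have hi : IntegrableOn (fun z => kern κ t (y - z)) Ω :=
    (((hκ.contDiff_kern t).continuous.integrable_of_hasCompactSupport
      (hκ.hasCompactSupport_kern ht)).comp_sub_left y).integrableOn
  have h2 : c = ∫ z in Ω, c * kern κ t (y - z) := by rw [integral_const_mul, h1, mul_one]
  nth_rewrite 1 [h2]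
  rw [moll, ← integral_sub (hκ.integrableOn_mul_kern ht hf y) (hi.const_mul c)]
  refine integral_congr_ae (Eventually.of_forall fun z => ?_)
  simp only
  ring

theorem IsKernel.dist_le_of_kern_ne_zero (hκ : IsKernel κ a) (ha : ‖a‖ ≤ 1) (ht : 0 < t)
    {y z : E n} (h : kern κ t (y - z) ≠ 0) : dist z y ≤ 2 * t := by
  have h1 : κ (t⁻¹ • (y - z)) ≠ 0 := fun h' => h (by simp [kern, h'])
  have h2 := hκ.tsupport_subset (subset_tsupport κ h1)
  rw [mem_closedBall_iff_norm] at h2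
  have h3 := norm_add_le (t⁻¹ • (y - z) - a) a
  rw [sub_add_cancel, norm_smul, norm_inv, Real.norm_eq_abs, abs_of_pos ht] at h3
  have h4 : t⁻¹ * ‖y - z‖ ≤ 2 := by linarith
  rw [dist_comm, dist_eq_norm]
  rw [inv_mul_le_iff₀ ht] at h4
  linarith

theorem ConeAt.moll_uniform (hΩ : IsOpen Ω) (hK : IsCompact (closure Ω))
    (hC : ConeAt Ω x a R) (hκ : IsMollifier κ a)
    {f : E n → ℝ} (hf : ContinuousOn f (closure Ω)) {ε : ℝ} (hε : 0 < ε) :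
    ∃ δ > 0, ∀ t, 0 < t → t < δ → ∀ y ∈ closure Ω, y ∈ Metric.ball x R →
      |moll Ω κ t f y - f y| ≤ ε := by
  have hfi : IntegrableOn f Ω := (hf.integrableOn_compact hK).mono_set subset_closure
  obtain ⟨δ, hδ, H⟩ := Metric.uniformContinuousOn_iff.1
    (hK.uniformContinuousOn_of_continuous hf) ε hε
  refine ⟨min (δ / 2) R, lt_min (by positivity) hC.pos, fun t ht htδ y hyc hy => ?_⟩
  have htR : t ≤ R := (htδ.trans_le (min_le_right _ _)).le
  have htδ' : t < δ / 2 := htδ.trans_le (min_le_left _ _)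
  have hi : IntegrableOn (fun z => kern κ t (y - z)) Ω :=
    (((hκ.contDiff_kern t).continuous.integrable_of_hasCompactSupport
      (hκ.hasCompactSupport_kern ht)).comp_sub_left y).integrableOn
  rw [hC.moll_sub hκ hyc hy ht htR hfi, ← Real.norm_eq_abs]
  have h1 : ∫ z in Ω, ε * kern κ t (y - z) = ε := by
    rw [integral_const_mul, hC.setIntegral_kern hκ.toIsKernel hyc hy ht htR, hκ.integral_eq_one,
      mul_one]
  rw [← h1]
  refine norm_integral_le_of_norm_le (hi.const_mul ε) ?_
  filter_upwards [ae_restrict_mem hΩ.measurableSet] with z hz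
  by_cases hk : kern κ t (y - z) = 0
  · simp [hk]
  have hk0 : 0 ≤ kern κ t (y - z) := mul_nonneg (by positivity) (hκ.nonneg _)
  have hd := hκ.dist_le_of_kern_ne_zero hC.norm_le ht hk
  have h2 := H z (subset_closure hz) y hyc (by linarith)
  rw [norm_mul, Real.norm_of_nonneg hk0]
  rw [Real.dist_eq] at h2
  exact mul_le_mul_of_nonneg_right h2.le hk0

theorem moll_congr {f g : E n → ℝ} (h : f =ᵐ[volume.restrict Ω] g) (y : E n) :
    moll Ω κ t f y = moll Ω κ t g y := by
  refine integral_congr_ae ?_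
  filter_upwards [h] with z hz
  rw [hz]

theorem exists_measurable_rep (hΩ : IsOpen Ω) {f : E n → ℝ}
    (hf : MemLp f 2 (volume.restrict Ω)) : ∃ F : E n → ℝ, Measurable F ∧ MemLp F 2 volume ∧
      f =ᵐ[volume.restrict Ω] F := by
  refine ⟨Ω.indicator (hf.1.mk f), hf.1.stronglyMeasurable_mk.measurable.indicator
    hΩ.measurableSet, ?_, ?_⟩
  · rw [memLp_indicator_iff_restrict hΩ.measurableSet]
    exact (memLp_congr_ae hf.1.ae_eq_mk).1 hf
  · filter_upwards [hf.1.ae_eq_mk, ae_restrict_mem hΩ.measurableSet] with z h1 h2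
    rw [h1, indicator_of_mem h2]

/-- Mollifications converge in `L²`, locally up to the boundary. -/
theorem ConeAt.tendsto_moll (hΩ : IsOpen Ω) (hb : Bornology.IsBounded Ω)
    (hC : ConeAt Ω x a R) (hκ : IsMollifier κ a)
    {f : E n → ℝ} (hf : MemLp f 2 (volume.restrict Ω)) :
    Tendsto (fun t => eLpNorm (fun y => moll Ω κ t f y - f y) 2
      (volume.restrict (Ω ∩ Metric.ball x R))) (𝓝[>] 0) (𝓝 0) := by
  have hfin : IsFiniteMeasure (volume.restrict Ω) :=
    ⟨by rw [Measure.restrict_apply_univ]; exact hb.measure_lt_top⟩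
  obtain ⟨F, hFm, hF, hfF⟩ := exists_measurable_rep hΩ hf
  have hFi : IntegrableOn F Ω := ((memLp_congr_ae hfF).1 hf).integrable (by norm_num)
  refine tendsto_eLpNorm_of_le_osc hκ.contDiff.continuous hκ.hasCompactSupport hF hFm ?_
  filter_upwards [Ioo_mem_nhdsGT hC.pos] with t ht
  have h1 : ∀ᵐ y ∂(volume.restrict (Ω ∩ Metric.ball x R)), f y = F y :=
    ae_mono (Measure.restrict_mono inter_subset_left le_rfl) hfF
  filter_upwards [h1, ae_restrict_mem (hΩ.inter Metric.isOpen_ball).measurableSet] with y hy hyW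
  rw [hy, moll_congr hfF, hC.moll_sub hκ (subset_closure hyW.1) hyW.2 ht.1 ht.2.le hFi, osc]
  refine (enorm_integral_le_lintegral_enorm _).trans ?_
  refine le_trans (lintegral_mono fun z => ?_) (setLIntegral_le_lintegral Ω _)
  rw [enorm_mul, mul_comm]

/-- **Friedrichs' lemma**: the commutator of a transport operator and a mollification tends to
zero in `L²`. -/
theorem ConeAt.tendsto_commutator (hΩ : IsOpen Ω) (hb : Bornology.IsBounded Ω)
    (hC : ConeAt Ω x a R) (hκ : IsKernel κ a) {β : E n → E n} {d v f : E n → ℝ} {L M : ℝ}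
    (hβ : ContinuousOn β Ω) (hβb : ∃ B, ∀ y ∈ Ω, ‖β y‖ ≤ B)
    (hL : ∀ y ∈ Ω, y ∈ Metric.ball x R → ∀ t, 0 < t → t ≤ R → ∀ b ∈ Metric.closedBall a (1 / 4),
      ‖β y - β (y - t • b)‖ ≤ L * t)
    (hd : AEStronglyMeasurable d (volume.restrict Ω))
    (hM : ∀ᵐ z ∂(volume.restrict Ω), |d z| ≤ M)
    (hdiv : ∀ φ, IsTest Ω φ → ∫ z in Ω, (⟪β z, gradient φ z⟫ + d z * φ z) = 0)
    (hv : MemLp v 2 (volume.restrict Ω))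
    (hvf : ∀ φ, IsTest Ω φ → ∫ z in Ω, f z * φ z =
      -∫ z in Ω, v z * (⟪β z, gradient φ z⟫ + d z * φ z)) :
    Tendsto (fun t => eLpNorm (fun y => ⟪β y, gradient (moll Ω κ t v) y⟫ - moll Ω κ t f y) 2
      (volume.restrict (Ω ∩ Metric.ball x R))) (𝓝[>] 0) (𝓝 0) := by
  have hfin : IsFiniteMeasure (volume.restrict Ω) :=
    ⟨by rw [Measure.restrict_apply_univ]; exact hb.measure_lt_top⟩
  obtain ⟨F, hFm, hF, hvF⟩ := exists_measurable_rep hΩ hv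
  have hvi : IntegrableOn v Ω := hv.integrable (by norm_num)
  have hFi : IntegrableOn F Ω := hvi.congr hvF
  obtain ⟨B, hB⟩ := hβb
  -- This kernel dominates the commutator at every scale: the factor `t⁻¹` from differentiating the
  -- mollifier is absorbed by `‖β y - β z‖ ≤ L t`, and the second term comes from the divergence.
  set κ' : E n → ℝ := fun b => L * ‖fderiv ℝ κ b‖ + |M| * |κ b| with hκ'
  have hκ'c : Continuous κ' := by
    have h1 := hκ.contDiff.continuous_fderiv (by simp)
    have h2 := hκ.contDiff.continuous
    fun_prop
  have hκ's : HasCompactSupport κ' := by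
    refine HasCompactSupport.intro (isCompact_closedBall a (1 / 4)) fun b hb => ?_
    have h1 : κ b = 0 := by
      by_contra h
      exact hb (hκ.tsupport_subset (subset_tsupport κ h))
    have h2 : fderiv ℝ κ b = 0 := by
      by_contra h
      exact hb (hκ.tsupport_subset (support_fderiv_subset ℝ h))
    simp [hκ', h1, h2]
  refine tendsto_eLpNorm_of_le_osc hκ'c hκ's hF hFm ?_
  filter_upwards [Ioo_mem_nhdsGT hC.pos] with t ht
  filter_upwards [ae_restrict_mem (hΩ.inter Metric.isOpen_ball).measurableSet] with y hyW
  have hyc := subset_closure hyW.1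
  have ht0 := ht.1
  have hKd : Differentiable ℝ (kern κ t) := (hκ.contDiff_kern t).differentiable (by simp)
  have hKc : Continuous (kern κ t) := (hκ.contDiff_kern t).continuous
  have hK1 : ContDiff ℝ 1 (kern κ t) := (hκ.contDiff_kern t).of_le (by exact_mod_cast le_top)
  have hDc : Continuous (fderiv ℝ (kern κ t)) := hK1.continuous_fderiv (by norm_num)
  obtain ⟨CK, hCK⟩ := hκ.exists_bound_kern ht0
  obtain ⟨CD, hCD⟩ := ((hκ.hasCompactSupport_kern ht0).fderiv ℝ).exists_bound_of_continuous hDc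
  have htest := hC.isTest_kern hκ hyc hyW.2 ht0 ht.2.le
  have hgrad : ∀ z w, ⟪w, gradient (fun z => kern κ t (y - z)) z⟫ =
      -fderiv ℝ (kern κ t) (y - z) w := fun z w => by
    rw [inner_gradient, fderiv_comp_sub_left hKd]
  -- the total kernel of the commutator
  set k : E n → ℝ := fun z => fderiv ℝ (kern κ t) (y - z) (β y - β z) + d z * kern κ t (y - z)
    with hk
  have hkm : AEStronglyMeasurable k (volume.restrict Ω) := by
    have e1 : ContinuousOn (fun z => fderiv ℝ (kern κ t) (y - z) (β y - β z)) Ω :=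
      (hDc.comp (continuous_const.sub continuous_id)).continuousOn.clm_apply
        (continuousOn_const.sub hβ)
    exact (e1.aestronglyMeasurable hΩ.measurableSet).add
      (hd.mul (hKc.comp (by fun_prop)).aestronglyMeasurable)
  have hkb : ∀ᵐ z ∂(volume.restrict Ω), ‖k z‖ ≤ CD * (2 * B) + |M| * CK := by
    filter_upwards [hM, ae_restrict_mem hΩ.measurableSet] with z hz hzΩ
    refine (norm_add_le _ _).trans (add_le_add ?_ ?_)
    · refine (ContinuousLinearMap.le_opNorm _ _).trans ?_
      refine mul_le_mul (hCD _) ?_ (norm_nonneg _) ((norm_nonneg _).trans (hCD 0))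
      refine (norm_sub_le _ _).trans ?_
      linarith [hB y hyW.1, hB z hzΩ]
    · rw [norm_mul]
      exact mul_le_mul (hz.trans (le_abs_self M)) (hCK _) (norm_nonneg _) (abs_nonneg _)
  have hki : IntegrableOn k Ω := Integrable.of_bound hkm _ hkb
  have hFk : ∀ {g : E n → ℝ}, IntegrableOn g Ω → IntegrableOn (fun z => g z * k z) Ω := fun hg =>
    Integrable.mul_bdd hg hkm hkb
  have hD1m : AEStronglyMeasurable (fun z => fderiv ℝ (kern κ t) (y - z) (β y))
      (volume.restrict Ω) :=
    ((hDc.comp (continuous_const.sub continuous_id)).clm_apply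
      continuous_const).aestronglyMeasurable
  have hD1b : ∀ᵐ z ∂(volume.restrict Ω), ‖fderiv ℝ (kern κ t) (y - z) (β y)‖ ≤ CD * ‖β y‖ :=
    Eventually.of_forall fun z => (ContinuousLinearMap.le_opNorm _ _).trans
      (mul_le_mul_of_nonneg_right (hCD _) (norm_nonneg _))
  have hD1 : ∀ {g : E n → ℝ}, IntegrableOn g Ω →
      IntegrableOn (fun z => g z * fderiv ℝ (kern κ t) (y - z) (β y)) Ω := fun hg =>
    Integrable.mul_bdd hg hD1m hD1b
  have hsplit : ∀ z, ⟪β z, gradient (fun z => kern κ t (y - z)) z⟫ + d z * kern κ t (y - z) =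
      k z - fderiv ℝ (kern κ t) (y - z) (β y) := by
    intro z
    rw [hgrad, hk]
    simp only [map_sub]
    ring
  -- The commutator kernel has mean zero, by the divergence identity for `β` and the vanishing
  -- integral of a derivative in the fixed direction `β y`. This permits subtracting `F y`, and so
  -- an oscillation appears.
  have hk0 : ∫ z in Ω, k z = 0 := by
    have e1 := hdiv _ htest
    simp only [hsplit] at e1
    rw [integral_sub hki (Integrable.of_bound hD1m _ hD1b)] at e1
    have e2 : ∫ z in Ω, fderiv ℝ (fun z => kern κ t (y - z)) z (β y) = 0 :=
      setIntegral_fderiv_eq_zero (htest.1.of_le (by exact_mod_cast le_top)) htest.2.1 htest.2.2 _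
    simp only [fderiv_comp_sub_left hKd, integral_neg, neg_eq_zero] at e2
    rw [e2, sub_zero] at e1
    exact e1
  have hcomm : ⟪β y, gradient (moll Ω κ t v) y⟫ - moll Ω κ t f y =
      ∫ z in Ω, (F z - F y) * k z := by
    have e1 : moll Ω κ t f y = -∫ z in Ω, v z * (k z - fderiv ℝ (kern κ t) (y - z) (β y)) := by
      rw [moll, hvf _ htest]
      simp only [hsplit]
    have e2 : ∫ z in Ω, (F z - F y) * k z = ∫ z in Ω, F z * k z := by
      simp only [sub_mul]
      rw [integral_sub (hFk hFi) (hki.const_mul _), integral_const_mul, hk0, mul_zero, sub_zero]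
    have e3 : ∫ z in Ω, F z * k z = ∫ z in Ω, v z * k z :=
      integral_congr_ae (by filter_upwards [hvF] with z hz; rw [hz])
    rw [inner_gradient, fderiv_moll hΩ hκ ht0 hvi, e1, e2, e3]
    simp only [mul_sub]
    rw [integral_sub (hFk hvi) (hD1 hvi)]
    ring
  rw [hcomm, osc]
  refine (enorm_integral_le_lintegral_enorm _).trans ?_
  refine le_trans (lintegral_mono_ae ?_) (setLIntegral_le_lintegral Ω _)
  filter_upwards [hM, ae_restrict_mem hΩ.measurableSet] with z hz hzΩ
  rw [enorm_mul, mul_comm]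
  gcongr
  refine enorm_le_iff_norm_le.2 ?_
  have hpos : 0 < t⁻¹ ^ n := by positivity
  have hbound : ‖k z‖ ≤ kern κ' t (y - z) := by
    set b := t⁻¹ • (y - z) with hbdef
    have e1 : fderiv ℝ (kern κ t) (y - z) (β y - β z) =
        t⁻¹ ^ n * (t⁻¹ * fderiv ℝ κ b (β y - β z)) := by
      rw [hκ.fderiv_kern, kern]
      ring
    have e2 : |t⁻¹ * fderiv ℝ κ b (β y - β z)| ≤ L * ‖fderiv ℝ κ b‖ := by
      by_cases hb0 : fderiv ℝ κ b = 0
      · simp [hb0]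
      have hbm : b ∈ Metric.closedBall a (1 / 4) :=
        hκ.tsupport_subset (support_fderiv_subset ℝ hb0)
      have e3 := hL y hyW.1 hyW.2 t ht0 ht.2.le b hbm
      have e4 : y - t • b = z := by
        rw [hbdef, smul_smul, mul_inv_cancel₀ ht0.ne', one_smul, sub_sub_cancel]
      rw [e4] at e3
      have e5 := (fderiv ℝ κ b).le_opNorm (β y - β z)
      rw [abs_mul, abs_of_pos (inv_pos.2 ht0), inv_mul_le_iff₀ ht0, ← Real.norm_eq_abs]
      calc ‖fderiv ℝ κ b (β y - β z)‖ ≤ ‖fderiv ℝ κ b‖ * (L * t) :=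
            e5.trans (mul_le_mul_of_nonneg_left e3 (norm_nonneg _))
        _ = _ := by ring
    calc ‖k z‖ = t⁻¹ ^ n * |t⁻¹ * fderiv ℝ κ b (β y - β z) + d z * κ b| := by
          rw [hk]
          simp only
          rw [e1, kern, Real.norm_eq_abs, ← abs_of_pos hpos, ← abs_mul, abs_of_pos hpos]
          congr 1
          ring
      _ ≤ t⁻¹ ^ n * (L * ‖fderiv ℝ κ b‖ + |M| * |κ b|) := by
          refine mul_le_mul_of_nonneg_left ((abs_add_le _ _).trans (add_le_add e2 ?_)) hpos.le
          rw [abs_mul]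
          exact mul_le_mul_of_nonneg_right (hz.trans (le_abs_self M)) (abs_nonneg _)
      _ = kern κ' t (y - z) := rfl
  exact hbound.trans (Real.le_norm_self _)

end

/-! ### A Sobolev embedding up to the boundary -/

section

variable {Ω : Set (E n)} {κ : E n → ℝ} {x a : E n} {R t : ℝ}

/-- Under the derivative bound, `j - B` is antitone and `j + B` is monotone. The interval is open at
`0` because the bounds used below blow up there. -/
theorem abs_sub_le_of_deriv_le {j j' B B' : ℝ → ℝ} {T : ℝ}
    (hj : ∀ t ∈ Ioo 0 T, HasDerivAt j (j' t) t) (hB : ∀ t ∈ Ioo 0 T, HasDerivAt B (B' t) t)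
    (hle : ∀ t ∈ Ioo 0 T, |j' t| ≤ B' t) {s t : ℝ} (hs : 0 < s) (hst : s ≤ t) (htT : t < T) :
    |j t - j s| ≤ B t - B s := by
  have hsm : s ∈ Ioo 0 T := ⟨hs, hst.trans_lt htT⟩
  have htm : t ∈ Ioo 0 T := ⟨hs.trans_le hst, htT⟩
  have hint : ∀ u, u ∈ interior (Ioo 0 T) → u ∈ Ioo 0 T := fun u hu => interior_subset hu
  have h1 : AntitoneOn (fun u => j u - B u) (Ioo 0 T) := by
    refine antitoneOn_of_deriv_nonpos (convex_Ioo 0 T)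
      (fun u hu => ((hj u hu).sub (hB u hu)).continuousAt.continuousWithinAt)
      (fun u hu => ((hj u (hint u hu)).sub
        (hB u (hint u hu))).differentiableAt.differentiableWithinAt)
      fun u hu => ?_
    have h : deriv (fun u => j u - B u) u = j' u - B' u :=
      ((hj u (hint u hu)).sub (hB u (hint u hu))).deriv
    rw [h]
    linarith [(abs_le.1 (hle u (hint u hu))).2]
  have h2 : MonotoneOn (fun u => j u + B u) (Ioo 0 T) := by
    refine monotoneOn_of_deriv_nonneg (convex_Ioo 0 T)
      (fun u hu => ((hj u hu).add (hB u hu)).continuousAt.continuousWithinAt)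
      (fun u hu => ((hj u (hint u hu)).add
        (hB u (hint u hu))).differentiableAt.differentiableWithinAt)
      fun u hu => ?_
    have h : deriv (fun u => j u + B u) u = j' u + B' u :=
      ((hj u (hint u hu)).add (hB u (hint u hu))).deriv
    rw [h]
    linarith [(abs_le.1 (hle u (hint u hu))).1]
  have h3 := h1 hsm htm hst
  have h4 := h2 hsm htm hst
  simp only at h3 h4
  exact abs_le.2 ⟨by linarith, by linarith⟩

/-- The `L²` norm of the rescaled kernel is a constant times `t^(-n/2)`, at most `t^(-3/2)` for `n ≤
3` and `t ≤ 1`. Young's inequality with weight `lam = t^(-n/2)` replaces Cauchy–Schwarz. -/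
theorem exists_moll_bound_of_memLp (hn : n ≤ 3) (hκ : IsKernel κ a) {g : E n → ℝ}
    (hg : MemLp g 2 (volume.restrict Ω)) :
    ∃ C, 0 ≤ C ∧ ∀ y t, 0 < t → t ≤ 1 → |moll Ω κ t g y| ≤ C * (1 / (t * √t)) := by
  set S := ∫ b, κ b ^ 2 with hS
  set G := ∫ z in Ω, g z ^ 2 with hG
  have hS0 : 0 ≤ S := integral_nonneg fun b => sq_nonneg _
  have hG0 : 0 ≤ G := integral_nonneg fun b => sq_nonneg _
  refine ⟨(G + S) / 2, by positivity, fun y t ht ht1 => ?_⟩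
  set lam := √(t⁻¹ ^ n) with hlam
  have hpos : 0 < t⁻¹ ^ n := by positivity
  have hlam0 : 0 < lam := Real.sqrt_pos.2 hpos
  have hlamsq : lam ^ 2 = t⁻¹ ^ n := Real.sq_sqrt hpos.le
  have hK2 : ∀ u, kern κ t u ^ 2 = lam ^ 2 * kern (fun b => κ b ^ 2) t u := by
    intro u
    rw [hlamsq, kern, kern]
    ring
  have hKc := (hκ.contDiff_kern t).continuous
  have hKs := hκ.hasCompactSupport_kern ht
  have hi2 : Integrable (fun z => kern κ t (y - z) ^ 2) := by
    have h1 : Integrable (fun u => kern κ t u ^ 2) := by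
      refine (hKc.pow 2).integrable_of_hasCompactSupport ?_
      have := hKs.mul_right (f' := kern κ t)
      simpa [sq, Pi.mul_def] using this
    exact h1.comp_sub_left y
  have hI2 : ∫ z in Ω, kern κ t (y - z) ^ 2 ≤ lam ^ 2 * S := by
    refine (setIntegral_le_integral hi2 (Eventually.of_forall fun z => sq_nonneg _)).trans
      (le_of_eq ?_)
    rw [integral_sub_left_eq_self (fun u => kern κ t u ^ 2) volume y]
    simp only [hK2]
    rw [integral_const_mul, integral_kern _ ht]
  have hg2 : IntegrableOn (fun z => g z ^ 2) Ω := hg.integrable_sq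
  have hmain : |moll Ω κ t g y| ≤ ∫ z in Ω,
    (lam / 2 * g z ^ 2 + 1 / (2 * lam) * kern κ t (y - z) ^ 2) := by
    rw [← Real.norm_eq_abs, moll]
    refine norm_integral_le_of_norm_le ((hg2.const_mul _).add (hi2.integrableOn.const_mul _))
      (Eventually.of_forall fun z => ?_)
    rw [norm_mul, Real.norm_eq_abs, Real.norm_eq_abs]
    have h1 : lam / 2 * g z ^ 2 + 1 / (2 * lam) * kern κ t (y - z) ^ 2 - |g z| * |kern κ t
      (y - z)| =
        1 / (2 * lam) * (lam * |g z| - |kern κ t (y - z)|) ^ 2 := by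
      rw [← sq_abs (g z), ← sq_abs (kern κ t (y - z))]
      field_simp
      ring
    have h2 : 0 ≤ 1 / (2 * lam) * (lam * |g z| - |kern κ t (y - z)|) ^ 2 := by positivity
    linarith
  rw [integral_add (hg2.const_mul _) (hi2.integrableOn.const_mul _), integral_const_mul,
    integral_const_mul] at hmain
  have h3 : lam ≤ 1 / (t * √t) := by
    have h4 : t⁻¹ ^ n ≤ t⁻¹ ^ 3 := pow_le_pow_right₀ (by rw [one_le_inv₀ ht]; exact ht1) hn
    refine (Real.sqrt_le_sqrt h4).trans (le_of_eq ?_)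
    rw [show t⁻¹ ^ 3 = t⁻¹ ^ 2 * t⁻¹ by ring, Real.sqrt_mul (by positivity),
      Real.sqrt_sq (by positivity), Real.sqrt_inv]
    rw [one_div, mul_inv]
  calc |moll Ω κ t g y| ≤ lam / 2 * G + 1 / (2 * lam) * (lam ^ 2 * S) := by
        refine hmain.trans ?_
        gcongr
    _ = (G + S) / 2 * lam := by
        field_simp
    _ ≤ _ := by gcongr

/-- The function `n κ(b) + κ'(b) b` is the divergence of the field `κ(b) b`. The scale derivative of
the kernel is therefore a spatial divergence, which can be integrated by parts. -/
theorem hasDerivAt_kern (hκ : IsKernel κ a) (ht : 0 < t) (u : E n) :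
    HasDerivAt (fun t => kern κ t u)
      (-t⁻¹ * kern (fun b => n * κ b + fderiv ℝ κ b b) t u) t := by
  have h0 : HasDerivAt (fun t : ℝ => t⁻¹) (-(t ^ 2)⁻¹) t := hasDerivAt_inv ht.ne'
  have h1 := h0.pow n
  have h2 : HasDerivAt (fun t : ℝ => t⁻¹ • u) (-(t ^ 2)⁻¹ • u) t := h0.smul_const u
  have h3 := (hκ.contDiff.differentiable (by simp) (t⁻¹ • u)).hasFDerivAt.comp_hasDerivAt t h2
  have h4 := h1.mul h3
  refine h4.congr_deriv ?_
  simp only [kern, map_smul, smul_eq_mul, Function.comp, Pi.pow_apply]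
  rw [show (t ^ 2)⁻¹ = t⁻¹ * t⁻¹ by rw [sq, mul_inv]]
  rcases n with _ | m
  · simp
    ring
  · simp only [Nat.add_sub_cancel]
    ring

/-- The derivative of a mollification with respect to the scale. -/
theorem ConeAt.hasDerivAt_moll (hC : ConeAt Ω x a R) (hκ : IsKernel κ a)
    {y : E n} (hyc : y ∈ closure Ω) (hy : y ∈ Metric.ball x R) (ht : 0 < t) (htR : t ≤ R)
    {f : E n → ℝ} {g : Fin n → E n → ℝ} (hf : IntegrableOn f Ω)
    (hg : ∀ i, HasWeakPartial Ω i f (g i)) :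
    HasDerivAt (fun t => moll Ω κ t f y) (-∑ i, moll Ω (fun b => b i * κ b) t (g i) y) t := by
  have hcoord : ∀ i, ContDiff ℝ ∞ fun b : E n => b i := fun i =>
    (EuclideanSpace.proj (𝕜 := ℝ) i).contDiff
  have hD : ∀ i, IsKernel (fun b => b i * κ b) a := fun i => hκ.mul_left (hcoord i)
  set m : E n → ℝ := fun b => n * κ b + fderiv ℝ κ b b with hm
  have hmc : Continuous m := by
    have h1 := hκ.contDiff.continuous
    have h2 := (hκ.contDiff.continuous_fderiv (by simp)).clm_apply continuous_id
    exact (continuous_const.mul h1).add h2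
  have hms : HasCompactSupport m := by
    refine HasCompactSupport.intro (isCompact_closedBall a (1 / 4)) fun b hb => ?_
    have h1 : κ b = 0 := by
      by_contra h
      exact hb (hκ.tsupport_subset (subset_tsupport κ h))
    have h2 : fderiv ℝ κ b = 0 := by
      by_contra h
      exact hb (hκ.tsupport_subset (support_fderiv_subset ℝ h))
    simp [hm, h1, h2]
  obtain ⟨B, hB⟩ := hms.exists_bound_of_continuous hmc
  have hkc : ∀ s, Continuous fun z => kern m s (y - z) := fun s => by
    unfold kern
    fun_prop
  have hder : HasDerivAt (fun t => moll Ω κ t f y)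
      (∫ z in Ω, f z * (-t⁻¹ * kern m t (y - z))) t := by
    refine (hasDerivAt_integral_of_dominated_loc_of_deriv_le (s := Ioo (t / 2) (2 * t))
      (bound := fun z => ‖f z‖ * ((t / 2)⁻¹ * ((t / 2)⁻¹ ^ n * B)))
      (F := fun t z => f z * kern κ t (y - z)) (x₀ := t)
      (F' := fun t z => f z * (-t⁻¹ * kern m t (y - z)))
      (Ioo_mem_nhds (by linarith) (by linarith)) (Eventually.of_forall fun s => ?_)
      (hκ.integrableOn_mul_kern ht hf y) ?_ ?_ (hf.norm.mul_const _) ?_).2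
    · exact hf.1.mul ((hκ.contDiff_kern s).continuous.comp (by fun_prop)).aestronglyMeasurable
    · exact hf.1.mul ((hkc t).const_smul (-t⁻¹)).aestronglyMeasurable
    · refine Eventually.of_forall fun z s hs => ?_
      have hs0 : 0 < s := by linarith [hs.1]
      rw [norm_mul, kern, norm_mul, norm_mul, norm_neg, norm_inv, norm_pow, norm_inv,
        Real.norm_of_nonneg hs0.le]
      have h1 : s⁻¹ ≤ (t / 2)⁻¹ := inv_anti₀ (by positivity) hs.1.le
      have h2 := hB (s⁻¹ • (y - z))
      have h3 : 0 ≤ B := (norm_nonneg _).trans h2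
      gcongr
    · refine Eventually.of_forall fun z s hs => ?_
      exact (hasDerivAt_kern hκ (by linarith [hs.1]) (y - z)).const_mul (f z)
  refine hder.congr_deriv ?_
  -- The weak derivative is tested with the kernel built from `b i * κ b`; summing over `i`
  -- assembles the divergence of `κ(b) b`.
  have hparts : ∀ i, moll Ω (fun b => b i * κ b) t (g i) y =
      ∫ z in Ω, f z * (t⁻¹ * kern (fun b => fderiv ℝ (fun b => b i * κ b) b
        (EuclideanSpace.single i 1)) t (y - z)) := by
    intro i
    have h1 := (hg i).2.2 _ (hC.isTest_kern (hD i) hyc hy ht htR)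
    rw [moll, eq_comm, ← neg_eq_iff_eq_neg.2 h1, ← integral_neg]
    refine integral_congr_ae (Eventually.of_forall fun z => ?_)
    simp only
    rw [gradient_apply, fderiv_comp_sub_left (((hD i).contDiff_kern t).differentiable (by simp)),
      (hD i).fderiv_kern]
    ring
  have hint : ∀ i, IntegrableOn (fun z => f z * (t⁻¹ * kern (fun b => fderiv ℝ
      (fun b => b i * κ b) b (EuclideanSpace.single i 1)) t (y - z))) Ω := by
    intro i
    have := (((hD i).fderiv_apply (EuclideanSpace.single i 1)).integrableOn_mul_kern ht hf
      y).const_mul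
      t⁻¹
    refine this.congr (Eventually.of_forall fun z => ?_)
    simp only
    ring
  simp only [hparts]
  rw [← integral_finsetSum _ fun i _ => hint i, ← integral_neg]
  refine integral_congr_ae (Eventually.of_forall fun z => ?_)
  simp only
  have hfd : ∀ i (b : E n), fderiv ℝ (fun b : E n => b i * κ b) b (EuclideanSpace.single i 1) =
      κ b + b i * fderiv ℝ κ b (EuclideanSpace.single i 1) := by
    intro i b
    have h1 : HasFDerivAt (fun b : E n => b i) (EuclideanSpace.proj (𝕜 := ℝ) i) b :=
      (EuclideanSpace.proj (𝕜 := ℝ) i).hasFDerivAt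
    have h2 := h1.mul (hκ.contDiff.differentiable (by simp) b).hasFDerivAt
    have h3 : fderiv ℝ (fun b : E n => b i * κ b) b = _ := h2.fderiv
    rw [h3]
    simp
    ring
  have hsum : ∀ b : E n, ∑ i, b i * fderiv ℝ κ b (EuclideanSpace.single i 1) = fderiv ℝ κ b b := by
    intro b
    have h1 : b = ∑ i, b i • EuclideanSpace.single i (1 : ℝ) := by
      have := (EuclideanSpace.basisFun (Fin n) ℝ).sum_repr b
      simpa using this.symm
    calc _ = fderiv ℝ κ b (∑ i, b i • EuclideanSpace.single i (1 : ℝ)) := by simp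
      _ = _ := by rw [← h1]
  simp only [kern, hfd]
  rw [← Finset.mul_sum, ← Finset.mul_sum, ← Finset.mul_sum, Finset.sum_add_distrib, hsum, hm]
  simp

/-- The scale derivative is a mollification of the `L²` functions `g i`, hence `O(t^(-3/2))`.
Integrating from `t` to the fixed scale `T / 2` gives `O(t^(-1/2))`: one weak derivative gains one
power of `t`. -/
theorem ConeAt.exists_moll_bound_of_partials (hn : n ≤ 3)
    (hb : Bornology.IsBounded Ω) (hC : ConeAt Ω x a R) (hκ : IsKernel κ a)
    {f : E n → ℝ} {g : Fin n → E n → ℝ} (hf : MemLp f 2 (volume.restrict Ω))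
    (hg : ∀ i, HasWeakPartial Ω i f (g i)) (hg2 : ∀ i, MemLp (g i) 2 (volume.restrict Ω)) :
    ∃ C, 0 ≤ C ∧ ∀ y ∈ closure Ω, y ∈ Metric.ball x R → ∀ t, 0 < t → t ≤ min R 1 / 2 →
      |moll Ω κ t f y| ≤ C * (1 / √t) := by
  have hfin : IsFiniteMeasure (volume.restrict Ω) :=
    ⟨by rw [Measure.restrict_apply_univ]; exact hb.measure_lt_top⟩
  have hcoord : ∀ i, ContDiff ℝ ∞ fun b : E n => b i := fun i =>
    (EuclideanSpace.proj (𝕜 := ℝ) i).contDiff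
  choose D hD0 hD using fun i =>
    exists_moll_bound_of_memLp hn (hκ.mul_left (hcoord i)) (hg2 i)
  obtain ⟨C₀, hC₀, hbd₀⟩ := exists_moll_bound_of_memLp hn hκ hf
  set T := min R 1 with hT
  have hT0 : 0 < T := lt_min hC.pos one_pos
  have hT1 : T ≤ 1 := min_le_right _ _
  have hTR : T ≤ R := min_le_left _ _
  set D' := ∑ i, D i with hD'
  have hD'0 : 0 ≤ D' := Finset.sum_nonneg fun i _ => hD0 i
  set A := C₀ * (1 / (T / 2 * √(T / 2))) with hA
  have hA0 : 0 ≤ A := by positivity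
  refine ⟨A + 2 * D', by positivity, fun y hyc hy t ht htT => ?_⟩
  have hB : ∀ s ∈ Ioo 0 T, HasDerivAt (fun s => -(2 * D') * (√s)⁻¹) (D' * (1 / (s * √s))) s := by
    intro s hs
    have h1 := ((Real.hasDerivAt_sqrt hs.1.ne').inv (Real.sqrt_pos.2 hs.1).ne').const_mul
      (-(2 * D'))
    refine h1.congr_deriv ?_
    have h2 : √s ^ 2 = s := Real.sq_sqrt hs.1.le
    have h3 := Real.sqrt_pos.2 hs.1
    rw [h2]
    have h4 := hs.1
    field_simp
  have hle : ∀ s ∈ Ioo 0 T, |-∑ i, moll Ω (fun b => b i * κ b) s (g i) y| ≤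
      D' * (1 / (s * √s)) := by
    intro s hs
    rw [abs_neg, hD', Finset.sum_mul]
    exact (Finset.abs_sum_le_sum_abs _ _).trans
      (Finset.sum_le_sum fun i _ => hD i y s hs.1 (hs.2.le.trans hT1))
  have h1 := abs_sub_le_of_deriv_le (fun s hs => hC.hasDerivAt_moll hκ hyc hy hs.1
    (hs.2.le.trans hTR) (hf.integrable (by norm_num)) hg) hB hle ht htT (by linarith)
  have h2 := hbd₀ y (T / 2) (by linarith) (by linarith)
  rw [← hA] at h2
  have h3 : 0 < √t := Real.sqrt_pos.2 ht
  have h4 : √t ≤ 1 := by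
    exact Real.sqrt_le_iff.2 ⟨by norm_num, by linarith⟩
  have h5 : 1 ≤ 1 / √t := by
    rw [le_div_iff₀ h3]
    linarith
  have h6 : 0 ≤ D' * (√(T / 2))⁻¹ := by positivity
  have h7 : |moll Ω κ t f y| ≤ |moll Ω κ (T / 2) f y| +
      |moll Ω κ (T / 2) f y - moll Ω κ t f y| := by
    have := abs_sub_abs_le_abs_sub (moll Ω κ t f y) (moll Ω κ (T / 2) f y)
    rw [abs_sub_comm] at this
    linarith
  rw [← one_div] at h1
  have h8 : A ≤ A * (1 / √t) := le_mul_of_one_le_right hA0 h5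
  have h9 : -(2 * D') * (1 / √(T / 2)) - -(2 * D') * (√t)⁻¹ ≤ 2 * D' * (1 / √t) := by
    rw [one_div, one_div]
    linarith
  linarith

/-- Mollifications of functions with two derivatives in `L²` form a uniform Cauchy family. -/
theorem ConeAt.exists_moll_sub_le (hn : n ≤ 3)
    (hb : Bornology.IsBounded Ω) (hC : ConeAt Ω x a R) (hκ : IsKernel κ a)
    {f : E n → ℝ} (hf : MemSobolev Ω 2 2 f) :
    ∃ C, 0 ≤ C ∧ ∀ y ∈ closure Ω, y ∈ Metric.ball x R → ∀ s t, 0 < s → s ≤ t →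
      t < min R 1 / 2 → |moll Ω κ t f y - moll Ω κ s f y| ≤ C * √t := by
  have hfin : IsFiniteMeasure (volume.restrict Ω) :=
    ⟨by rw [Measure.restrict_apply_univ]; exact hb.measure_lt_top⟩
  have hcoord : ∀ i, ContDiff ℝ ∞ fun b : E n => b i := fun i =>
    (EuclideanSpace.proj (𝕜 := ℝ) i).contDiff
  obtain ⟨hf2, hpart⟩ := hf
  choose g hg hgS using hpart
  have hgd : ∀ i, ∃ C, 0 ≤ C ∧ ∀ y ∈ closure Ω, y ∈ Metric.ball x R → ∀ t, 0 < t →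
      t ≤ min R 1 / 2 → |moll Ω (fun b => b i * κ b) t (g i) y| ≤ C * (1 / √t) := by
    intro i
    obtain ⟨hgi, hgp⟩ := hgS i
    choose h hh hhS using hgp
    exact hC.exists_moll_bound_of_partials hn hb (hκ.mul_left (hcoord i)) hgi hh hhS
  choose D hD0 hD using hgd
  set D' := ∑ i, D i with hD'
  have hD'0 : 0 ≤ D' := Finset.sum_nonneg fun i _ => hD0 i
  set T := min R 1 / 2 with hT
  have hTR : T ≤ R := by
    have h1 : min R 1 ≤ R := min_le_left _ _
    have h2 : 0 < min R 1 := lt_min hC.pos one_pos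
    linarith
  refine ⟨2 * D', by positivity, fun y hyc hy s t hs hst htT => ?_⟩
  -- With a second weak derivative the scale derivative is `O(s^(-1/2))`, integrable at `0` with
  -- primitive `2 √s`, whence the Cauchy property.
  have hB : ∀ s ∈ Ioo 0 T, HasDerivAt (fun s => 2 * D' * √s) (D' * (1 / √s)) s := by
    intro s hs
    refine ((Real.hasDerivAt_sqrt hs.1.ne').const_mul (2 * D')).congr_deriv ?_
    have h3 := Real.sqrt_pos.2 hs.1
    field_simp
  have hle : ∀ s ∈ Ioo 0 T, |-∑ i, moll Ω (fun b => b i * κ b) s (g i) y| ≤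
      D' * (1 / √s) := by
    intro s hs
    rw [abs_neg, hD', Finset.sum_mul]
    exact (Finset.abs_sum_le_sum_abs _ _).trans
      (Finset.sum_le_sum fun i _ => hD i y hyc hy s hs.1 hs.2.le)
  have h1 := abs_sub_le_of_deriv_le (fun s hs => hC.hasDerivAt_moll hκ hyc hy hs.1
    (hs.2.le.trans hTR) (hf2.integrable (by norm_num)) hg) hB hle hs hst htT
  have h2 : 0 ≤ 2 * D' * √s := by positivity
  linarith

end

/-! ### Global smoothing operators -/

theorem tendsto_eLpNorm_add {α : Type*} [MeasurableSpace α] {μ : Measure α} {l : Filter ℝ}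
    {f g : ℝ → α → ℝ} (hfm : ∀ᶠ t in l, AEStronglyMeasurable (f t) μ)
    (hgm : ∀ᶠ t in l, AEStronglyMeasurable (g t) μ)
    (hf : Tendsto (fun t => eLpNorm (f t) 2 μ) l (𝓝 0))
    (hg : Tendsto (fun t => eLpNorm (g t) 2 μ) l (𝓝 0)) :
    Tendsto (fun t => eLpNorm (fun y => f t y + g t y) 2 μ) l (𝓝 0) := by
  have h := hf.add hg
  rw [add_zero] at h
  refine tendsto_of_tendsto_of_tendsto_of_le_of_le' tendsto_const_nhds h
    (Eventually.of_forall fun _ => zero_le) ?_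
  filter_upwards [hfm, hgm] with t h1 h2 using eLpNorm_add_le h1 h2 (by norm_num)

theorem tendsto_eLpNorm_sum_mul {ι : Type*} {Ω : Set (E n)} (hΩ : MeasurableSet Ω) (s : Finset ι)
    {B : ι → Set (E n)} (hB : ∀ c, MeasurableSet (B c)) {m : ι → E n → ℝ} {h : ι → ℝ → E n → ℝ}
    (hm : ∀ c ∈ s, ∃ C : ℝ, ∀ y ∈ Ω, |m c y| ≤ C) (hm0 : ∀ c ∈ s, ∀ y, y ∉ B c → m c y = 0)
    (hmm : ∀ c ∈ s, AEStronglyMeasurable (m c) (volume.restrict Ω))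
    (hhm : ∀ c ∈ s, ∀ᶠ t in 𝓝[>] 0, AEStronglyMeasurable (h c t) (volume.restrict Ω))
    (hh : ∀ c ∈ s, Tendsto (fun t => eLpNorm (h c t) 2 (volume.restrict (Ω ∩ B c)))
      (𝓝[>] 0) (𝓝 0)) :
    Tendsto (fun t => eLpNorm (fun y => ∑ c ∈ s, m c y * h c t y) 2 (volume.restrict Ω))
      (𝓝[>] 0) (𝓝 0) := by
  classical
  induction s using Finset.induction_on with
  | empty => simp
  | insert c s hc ih =>
    simp only [Finset.sum_insert hc]
    refine tendsto_eLpNorm_add (f := fun t y => m c y * h c t y)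
      (g := fun t y => ∑ c ∈ s, m c y * h c t y) ?_ ?_ ?_ ?_
    · filter_upwards [hhm c (Finset.mem_insert_self c s)] with t ht
      exact (hmm c (Finset.mem_insert_self c s)).mul ht
    · have : ∀ᶠ t in 𝓝[>] (0 : ℝ), ∀ c ∈ s, AEStronglyMeasurable (h c t) (volume.restrict Ω) :=
        (Finset.eventually_all s).2 fun c hc => hhm c (Finset.mem_insert_of_mem hc)
      filter_upwards [this] with t ht
      exact Finset.aestronglyMeasurable_fun_sum s fun c hc =>
        (hmm c (Finset.mem_insert_of_mem hc)).mul (ht c hc)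
    · obtain ⟨C, hC⟩ := hm c (Finset.mem_insert_self c s)
      have h1 := ENNReal.Tendsto.const_mul (a := ENNReal.ofReal C)
        (hh c (Finset.mem_insert_self c s)) (Or.inr ENNReal.ofReal_ne_top)
      rw [mul_zero] at h1
      refine tendsto_of_tendsto_of_tendsto_of_le_of_le tendsto_const_nhds h1
        (fun _ => zero_le) fun t => ?_
      have h2 : (fun y => m c y * h c t y) = (B c).indicator fun y => m c y * h c t y := by
        funext y
        by_cases hy : y ∈ B c
        · rw [indicator_of_mem hy]
        · rw [indicator_of_notMem hy, hm0 c (Finset.mem_insert_self c s) y hy, zero_mul]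
      have h3 : eLpNorm (fun y => m c y * h c t y) 2 (volume.restrict Ω) =
          eLpNorm (fun y => m c y * h c t y) 2 (volume.restrict (Ω ∩ B c)) := by
        rw [h2, eLpNorm_indicator_eq_eLpNorm_restrict (hB c), Measure.restrict_restrict (hB c),
          inter_comm, ← h2]
      simp only
      rw [h3]
      refine eLpNorm_le_mul_eLpNorm_of_ae_le_mul ?_ 2
      filter_upwards [ae_restrict_mem (hΩ.inter (hB c))] with y hy
      rw [norm_mul]
      exact mul_le_mul_of_nonneg_right (hC y hy.1) (norm_nonneg _)
    · exact ih (fun c hc => hm c (Finset.mem_insert_of_mem hc))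
        (fun c hc => hm0 c (Finset.mem_insert_of_mem hc))
        (fun c hc => hmm c (Finset.mem_insert_of_mem hc))
        (fun c hc => hhm c (Finset.mem_insert_of_mem hc))
        (fun c hc => hh c (Finset.mem_insert_of_mem hc))

theorem ConeAt.mono {Ω : Set (E n)} {x a : E n} {R R' : ℝ} (h : ConeAt Ω x a R) (h0 : 0 < R')
    (hR : R' ≤ R) : ConeAt Ω x a R' :=
  ⟨h.norm_le, h0, fun y hy hyb t ht htR b hb =>
    h.mem y hy (Metric.ball_subset_ball hR hyb) t ht (htR.trans hR) b hb⟩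

/-- A finite atlas of `closure Ω` with a one-sided mollifier in every chart. -/
structure SmoothingSystem (Ω : Set (E n)) where
  /-- the centres of the charts -/
  s : Finset (E n)
  /-- the partition of unity -/
  ψ : E n → E n → ℝ
  /-- the mollifiers -/
  κ : E n → E n → ℝ
  /-- the directions of the mollifiers -/
  a : E n → E n
  /-- the radii of the charts -/
  R : E n → ℝ
  ψ_smooth : ∀ c, ContDiff ℝ ∞ (ψ c)
  ψ_nonneg : ∀ c y, 0 ≤ ψ c y
  -- A quarter of the cone radius leaves room for the segments from `y` to `y - t b` with `t ≤ R /
  -- 4`, on which `ConeAt.abs_sub_le` uses the cone again.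
  ψ_supp : ∀ c ∈ s, tsupport (ψ c) ⊆ Metric.ball c (R c / 4)
  ψ_sum : ∀ y ∈ closure Ω, ∑ c ∈ s, ψ c y = 1
  isMollifier : ∀ c, IsMollifier (κ c) (a c)
  coneAt : ∀ c ∈ s, ConeAt Ω c (a c) (R c)

theorem IsC6Domain.nonempty_smoothingSystem {Ω : Set (E n)} (hΩ : IsC6Domain Ω) :
    Nonempty (SmoothingSystem Ω) := by
  have h : ∀ x ∈ closure Ω, ∃ a R, ConeAt Ω x a R := fun x hx => hΩ.exists_coneAt hx
  choose! a R hR using h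
  obtain ⟨s, ψ, hs, h1, h2, h3, h4⟩ := exists_finite_partition hΩ.isCompact_closure
    (fun x => R x / 4) (fun x hx => by have := (hR x hx).pos; positivity)
  choose κ hκ using fun c => exists_isMollifier (a c)
  exact ⟨⟨s, ψ, κ, a, R, h1, h2, h3, h4, hκ, fun c hc => hR c (hs c hc)⟩⟩

namespace SmoothingSystem

variable {Ω : Set (E n)} (S : SmoothingSystem Ω)

/-- The smoothing operator at scale `t`. -/
def smooth (t : ℝ) (f : E n → ℝ) (y : E n) : ℝ := ∑ c ∈ S.s, S.ψ c y * moll Ω (S.κ c) t f y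

theorem coneAt' {c : E n} (hc : c ∈ S.s) : ConeAt Ω c (S.a c) (S.R c / 4) :=
  (S.coneAt c hc).mono (by have := (S.coneAt c hc).pos; positivity)
    (by have := (S.coneAt c hc).pos; linarith)

theorem contDiff_smooth (hΩ : IsOpen Ω) {t : ℝ} (ht : 0 < t) {f : E n → ℝ}
    (hf : IntegrableOn f Ω) : ContDiff ℝ ∞ (S.smooth t f) :=
  ContDiff.sum fun c _ => (S.ψ_smooth c).mul
    (contDiff_moll hΩ (S.isMollifier c).toIsKernel ht hf)

theorem fderiv_smooth (hΩ : IsOpen Ω) {t : ℝ} (ht : 0 < t) {f : E n → ℝ}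
    (hf : IntegrableOn f Ω) (y w : E n) :
    fderiv ℝ (S.smooth t f) y w = ∑ c ∈ S.s, (S.ψ c y * fderiv ℝ (moll Ω (S.κ c) t f) y w +
      fderiv ℝ (S.ψ c) y w * moll Ω (S.κ c) t f y) := by
  have h1 : ∀ c, DifferentiableAt ℝ (S.ψ c) y := fun c => (S.ψ_smooth c).differentiable (by simp) y
  have h2 : ∀ c, DifferentiableAt ℝ (moll Ω (S.κ c) t f) y := fun c =>
    (contDiff_moll hΩ (S.isMollifier c).toIsKernel ht hf).differentiable (by simp) y
  have h3 : S.smooth t f = fun y => ∑ c ∈ S.s, S.ψ c y * moll Ω (S.κ c) t f y := rfl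
  have h4 : ∀ c ∈ S.s, DifferentiableAt ℝ (fun y => S.ψ c y * moll Ω (S.κ c) t f y) y :=
    fun c _ => (h1 c).mul (h2 c)
  rw [h3, fderiv_fun_sum h4, _root_.sum_apply]
  refine Finset.sum_congr rfl fun c _ => ?_
  rw [fderiv_fun_mul (h1 c) (h2 c)]
  simp [mul_comm]

/-- Because these derivatives cancel, `f y` can be subtracted from each mollification in the terms
where the product rule hits the partition of unity; those terms then tend to zero. -/
theorem sum_fderiv_ψ (hΩ : IsOpen Ω) {y : E n} (hy : y ∈ Ω) (w : E n) :
    ∑ c ∈ S.s, fderiv ℝ (S.ψ c) y w = 0 := by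
  have h1 : (fun y => ∑ c ∈ S.s, S.ψ c y) =ᶠ[𝓝 y] fun _ => 1 := by
    filter_upwards [hΩ.mem_nhds hy] with z hz using S.ψ_sum z (subset_closure hz)
  have h2 := h1.fderiv_eq (𝕜 := ℝ)
  rw [fderiv_fun_sum fun c _ => (S.ψ_smooth c).differentiable (by simp) y] at h2
  have h3 := congrArg (fun L : E n →L[ℝ] ℝ => L w) h2
  simpa using h3

theorem ψ_le_one {c : E n} (hc : c ∈ S.s) {y : E n} (hy : y ∈ closure Ω) : |S.ψ c y| ≤ 1 := by
  rw [abs_of_nonneg (S.ψ_nonneg c y), ← S.ψ_sum y hy]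
  exact Finset.single_le_sum (f := fun c => S.ψ c y) (fun c _ => S.ψ_nonneg c y) hc

theorem ψ_eq_zero {c : E n} (hc : c ∈ S.s) {y : E n} (hy : y ∉ Metric.ball c (S.R c / 4)) :
    S.ψ c y = 0 :=
  image_eq_zero_of_notMem_tsupport fun h => hy (S.ψ_supp c hc h)

theorem fderiv_ψ_eq_zero {c : E n} (hc : c ∈ S.s) {y : E n}
    (hy : y ∉ Metric.ball c (S.R c / 4)) : fderiv ℝ (S.ψ c) y = 0 := by
  by_contra h
  exact hy (S.ψ_supp c hc (support_fderiv_subset ℝ h))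

theorem smooth_sub {y : E n} (hy : y ∈ closure Ω) (t : ℝ) (f : E n → ℝ) (A : ℝ) :
    S.smooth t f y - A = ∑ c ∈ S.s, S.ψ c y * (moll Ω (S.κ c) t f y - A) := by
  simp only [mul_sub, Finset.sum_sub_distrib]
  rw [← Finset.sum_mul, S.ψ_sum y hy, one_mul, smooth]

theorem measurable_ψ (c : E n) : AEStronglyMeasurable (S.ψ c) (volume.restrict Ω) :=
  (S.ψ_smooth c).continuous.aestronglyMeasurable

theorem eventually_measurable_moll_sub (hΩ : IsOpen Ω) {f g : E n → ℝ}
    (hf : IntegrableOn f Ω) (hg : AEStronglyMeasurable g (volume.restrict Ω)) (c : E n) :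
    ∀ᶠ t in 𝓝[>] (0 : ℝ), AEStronglyMeasurable (fun y => moll Ω (S.κ c) t f y - g y)
      (volume.restrict Ω) := by
  filter_upwards [self_mem_nhdsWithin] with t ht
  exact (contDiff_moll hΩ (S.isMollifier c).toIsKernel ht
    hf).continuous.aestronglyMeasurable.sub hg

theorem tendsto_sum_ψ_moll (hΩ : IsC6Domain Ω) {f : E n → ℝ}
    (hf : MemLp f 2 (volume.restrict Ω)) :
    Tendsto (fun t => eLpNorm (fun y => ∑ c ∈ S.s, S.ψ c y * (moll Ω (S.κ c) t f y - f y)) 2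
      (volume.restrict Ω)) (𝓝[>] 0) (𝓝 0) := by
  have hfin : IsFiniteMeasure (volume.restrict Ω) :=
    ⟨by rw [Measure.restrict_apply_univ]; exact hΩ.isBounded.measure_lt_top⟩
  exact tendsto_eLpNorm_sum_mul hΩ.isOpen.measurableSet S.s
    (B := fun c => Metric.ball c (S.R c / 4)) (m := S.ψ)
    (h := fun c t y => moll Ω (S.κ c) t f y - f y)
    (fun c => measurableSet_ball) (fun c hc => ⟨1, fun y hy => S.ψ_le_one hc (subset_closure hy)⟩)
    (fun c hc y hy => S.ψ_eq_zero hc hy) (fun c _ => S.measurable_ψ c)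
    (fun c _ => S.eventually_measurable_moll_sub hΩ.isOpen (hf.integrable (by norm_num)) hf.1 c)
    (fun c hc => (S.coneAt' hc).tendsto_moll hΩ.isOpen hΩ.isBounded (S.isMollifier c) hf)

theorem tendsto_smooth (hΩ : IsC6Domain Ω) {f : E n → ℝ}
    (hf : MemLp f 2 (volume.restrict Ω)) :
    Tendsto (fun t => eLpNorm (fun y => S.smooth t f y - f y) 2 (volume.restrict Ω))
      (𝓝[>] 0) (𝓝 0) := by
  refine (S.tendsto_sum_ψ_moll hΩ hf).congr fun t => eLpNorm_congr_ae ?_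
  filter_upwards [ae_restrict_mem hΩ.isOpen.measurableSet] with y hy
  rw [S.smooth_sub (subset_closure hy)]

theorem smooth_uniform (hΩ : IsC6Domain Ω) {f : E n → ℝ} (hf : ContinuousOn f (closure Ω))
    {ε : ℝ} (hε : 0 < ε) :
    ∀ᶠ t in 𝓝[>] (0 : ℝ), ∀ y ∈ closure Ω, |S.smooth t f y - f y| ≤ ε := by
  have h : ∀ c ∈ S.s, ∀ᶠ t in 𝓝[>] (0 : ℝ), ∀ y ∈ closure Ω, y ∈ Metric.ball c (S.R c / 4) →
      |moll Ω (S.κ c) t f y - f y| ≤ ε := by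
    intro c hc
    obtain ⟨δ, hδ, H⟩ := (S.coneAt' hc).moll_uniform hΩ.isOpen hΩ.isCompact_closure
      (S.isMollifier c) hf hε
    filter_upwards [Ioo_mem_nhdsGT hδ] with t ht using H t ht.1 ht.2
  filter_upwards [(Finset.eventually_all S.s).2 h] with t ht y hy
  rw [S.smooth_sub hy]
  refine (Finset.abs_sum_le_sum_abs _ _).trans ?_
  calc ∑ c ∈ S.s, |S.ψ c y * (moll Ω (S.κ c) t f y - f y)| ≤ ∑ c ∈ S.s, S.ψ c y * ε := by
        refine Finset.sum_le_sum fun c hc => ?_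
        rw [abs_mul, abs_of_nonneg (S.ψ_nonneg c y)]
        by_cases hyb : y ∈ Metric.ball c (S.R c / 4)
        · exact mul_le_mul_of_nonneg_left (ht c hc y hy hyb) (S.ψ_nonneg c y)
        · simp [S.ψ_eq_zero hc hyb]
    _ = ε := by rw [← Finset.sum_mul, S.ψ_sum y hy, one_mul]

theorem smooth_uniform_cauchy (hn : n ≤ 3) (hΩ : IsC6Domain Ω) {f : E n → ℝ}
    (hf : MemSobolev Ω 2 2 f) {ε : ℝ} (hε : 0 < ε) :
    ∃ T > 0, ∀ s t, 0 < s → s ≤ t → t < T → ∀ y ∈ closure Ω,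
      |S.smooth t f y - S.smooth s f y| ≤ ε := by
  have h : ∀ c ∈ S.s, ∀ᶠ T in 𝓝[>] (0 : ℝ), ∀ s t, 0 < s → s ≤ t → t < T →
      ∀ y ∈ closure Ω, y ∈ Metric.ball c (S.R c / 4) →
      |moll Ω (S.κ c) t f y - moll Ω (S.κ c) s f y| ≤ ε := by
    intro c hc
    obtain ⟨C, hC0, hC⟩ := (S.coneAt' hc).exists_moll_sub_le hn hΩ.isBounded
      (S.isMollifier c).toIsKernel hf
    have hlim : Tendsto (fun t => C * √t) (𝓝[>] 0) (𝓝 0) := by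
      have : Tendsto (fun t => C * √t) (𝓝 0) (𝓝 (C * √0)) := Continuous.tendsto (by fun_prop) 0
      rw [Real.sqrt_zero, mul_zero] at this
      exact this.mono_left nhdsWithin_le_nhds
    have hpos : 0 < min (S.R c / 4) 1 / 2 := by
      have := lt_min (S.coneAt' hc).pos one_pos
      positivity
    filter_upwards [hlim.eventually (gt_mem_nhds hε), Ioo_mem_nhdsGT hpos] with T hT1 hT2
    intro s t hs hst htT y hy hyb
    refine (hC y hy hyb s t hs hst (htT.trans hT2.2)).trans (le_trans ?_ hT1.le)
    gcongr
  obtain ⟨T, hT, hT0⟩ := (((Finset.eventually_all S.s).2 h).and self_mem_nhdsWithin).exists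
  refine ⟨T, hT0, fun s t hs hst htT y hy => ?_⟩
  have h1 : S.smooth t f y - S.smooth s f y =
      ∑ c ∈ S.s, S.ψ c y * (moll Ω (S.κ c) t f y - moll Ω (S.κ c) s f y) := by
    simp only [smooth, mul_sub, Finset.sum_sub_distrib]
  rw [h1]
  refine (Finset.abs_sum_le_sum_abs _ _).trans ?_
  calc ∑ c ∈ S.s, |S.ψ c y * (moll Ω (S.κ c) t f y - moll Ω (S.κ c) s f y)| ≤
        ∑ c ∈ S.s, S.ψ c y * ε := by
        refine Finset.sum_le_sum fun c hc => ?_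
        rw [abs_mul, abs_of_nonneg (S.ψ_nonneg c y)]
        by_cases hyb : y ∈ Metric.ball c (S.R c / 4)
        · exact mul_le_mul_of_nonneg_left (hT c hc s t hs hst htT y hy hyb) (S.ψ_nonneg c y)
        · simp [S.ψ_eq_zero hc hyb]
    _ = ε := by rw [← Finset.sum_mul, S.ψ_sum y hy, one_mul]

theorem continuous_fderiv_ψ (c : E n) : Continuous (fderiv ℝ (S.ψ c)) :=
  (S.ψ_smooth c).continuous_fderiv (by simp)

/-- Derivatives of the partition of unity multiply terms that tend to zero. -/
theorem tendsto_sum_fderiv_ψ_moll (hΩ : IsC6Domain Ω) {β : E n → E n}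
    (hβ : ContinuousOn β (closure Ω)) {f : E n → ℝ} (hf : MemLp f 2 (volume.restrict Ω)) :
    Tendsto (fun t => eLpNorm (fun y => ∑ c ∈ S.s,
      fderiv ℝ (S.ψ c) y (β y) * (moll Ω (S.κ c) t f y - f y)) 2
      (volume.restrict Ω)) (𝓝[>] 0) (𝓝 0) := by
  have hfin : IsFiniteMeasure (volume.restrict Ω) :=
    ⟨by rw [Measure.restrict_apply_univ]; exact hΩ.isBounded.measure_lt_top⟩
  have hc : ∀ c, ContinuousOn (fun y => fderiv ℝ (S.ψ c) y (β y)) (closure Ω) := fun c =>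
    (S.continuous_fderiv_ψ c).continuousOn.clm_apply hβ
  refine tendsto_eLpNorm_sum_mul hΩ.isOpen.measurableSet S.s
    (B := fun c => Metric.ball c (S.R c / 4)) (m := fun c y => fderiv ℝ (S.ψ c) y (β y))
    (h := fun c t y => moll Ω (S.κ c) t f y - f y)
    (fun c => measurableSet_ball) (fun c _ => ?_)
    (fun c hc y hy => by rw [S.fderiv_ψ_eq_zero hc hy]; rfl) (fun c _ => ?_)
    (fun c _ => S.eventually_measurable_moll_sub hΩ.isOpen (hf.integrable (by norm_num)) hf.1 c)
    (fun c hc => (S.coneAt' hc).tendsto_moll hΩ.isOpen hΩ.isBounded (S.isMollifier c) hf)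
  · obtain ⟨C, hC⟩ := hΩ.isCompact_closure.exists_bound_of_continuousOn (hc c)
    exact ⟨C, fun y hy => hC y (subset_closure hy)⟩
  · exact ((hc c).mono subset_closure).aestronglyMeasurable hΩ.isOpen.measurableSet

theorem measurable_sum_fderiv_ψ_moll (hΩ : IsC6Domain Ω) {β : E n → E n}
    (hβ : ContinuousOn β (closure Ω)) {f : E n → ℝ} (hf : MemLp f 2 (volume.restrict Ω)) {t : ℝ}
    (ht : 0 < t) : AEStronglyMeasurable (fun y => ∑ c ∈ S.s,
      fderiv ℝ (S.ψ c) y (β y) * (moll Ω (S.κ c) t f y - f y)) (volume.restrict Ω) := by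
  have hfin : IsFiniteMeasure (volume.restrict Ω) :=
    ⟨by rw [Measure.restrict_apply_univ]; exact hΩ.isBounded.measure_lt_top⟩
  refine Finset.aestronglyMeasurable_fun_sum _ fun c _ => ?_
  exact ((((S.continuous_fderiv_ψ c).continuousOn.clm_apply hβ).mono
    subset_closure).aestronglyMeasurable hΩ.isOpen.measurableSet).mul
    ((contDiff_moll hΩ.isOpen (S.isMollifier c).toIsKernel ht
    (hf.integrable (by norm_num))).continuous.aestronglyMeasurable.sub hf.1)

theorem measurable_sum_ψ_moll (hΩ : IsC6Domain Ω) {f : E n → ℝ}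
    (hf : IntegrableOn f Ω) {t : ℝ} (ht : 0 < t) : AEStronglyMeasurable (fun y => ∑ c ∈ S.s,
      S.ψ c y * (moll Ω (S.κ c) t f y - f y)) (volume.restrict Ω) := by
  refine Finset.aestronglyMeasurable_fun_sum _ fun c _ => (S.measurable_ψ c).mul ?_
  exact (contDiff_moll hΩ.isOpen (S.isMollifier c).toIsKernel ht
    hf).continuous.aestronglyMeasurable.sub hf.1

/-- Smoothing is compatible with weak derivatives. -/
theorem tendsto_fderiv_smooth (hΩ : IsC6Domain Ω) {f g : E n → ℝ} {i : Fin n}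
    (hf : MemLp f 2 (volume.restrict Ω)) (hg : MemLp g 2 (volume.restrict Ω))
    (hfg : HasWeakPartial Ω i f g) :
    Tendsto (fun t => eLpNorm (fun y =>
      fderiv ℝ (S.smooth t f) y (EuclideanSpace.single i 1) - g y) 2 (volume.restrict Ω))
      (𝓝[>] 0) (𝓝 0) := by
  have hfin : IsFiniteMeasure (volume.restrict Ω) :=
    ⟨by rw [Measure.restrict_apply_univ]; exact hΩ.isBounded.measure_lt_top⟩
  have hfi : IntegrableOn f Ω := hf.integrable (by norm_num)
  have hgi : IntegrableOn g Ω := hg.integrable (by norm_num)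
  -- By the product rule, `∑ ψ_c = 1` and `∑ ∂ψ_c = 0`, the error is the sum of the mollification
  -- error of `g` weighted by `ψ_c` and that of `f` weighted by `∂ψ_c`.
  have h := tendsto_eLpNorm_add (l := 𝓝[>] 0)
    (f := fun t y => ∑ c ∈ S.s, S.ψ c y * (moll Ω (S.κ c) t g y - g y))
    (g := fun t y => ∑ c ∈ S.s, fderiv ℝ (S.ψ c) y (EuclideanSpace.single i 1) *
      (moll Ω (S.κ c) t f y - f y))
    (by
      filter_upwards [self_mem_nhdsWithin] with t ht
      exact S.measurable_sum_ψ_moll hΩ hgi ht)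
    (by
      filter_upwards [self_mem_nhdsWithin] with t ht
      exact S.measurable_sum_fderiv_ψ_moll hΩ (β := fun _ => EuclideanSpace.single i 1)
        continuousOn_const hf ht)
    (S.tendsto_sum_ψ_moll hΩ hg) (S.tendsto_sum_fderiv_ψ_moll hΩ continuousOn_const hf)
  refine h.congr' ?_
  have hev : ∀ᶠ t in 𝓝[>] (0 : ℝ), ∀ c ∈ S.s, t < S.R c / 4 :=
    (Finset.eventually_all S.s).2 fun c hc => by
      filter_upwards [Ioo_mem_nhdsGT (S.coneAt' hc).pos] with t ht using ht.2
  filter_upwards [hev, self_mem_nhdsWithin] with t ht ht0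
  refine eLpNorm_congr_ae ?_
  filter_upwards [ae_restrict_mem hΩ.isOpen.measurableSet] with y hy
  rw [S.fderiv_smooth hΩ.isOpen ht0 hfi, Finset.sum_add_distrib]
  simp only [mul_sub, Finset.sum_sub_distrib, ← Finset.sum_mul, S.ψ_sum y (subset_closure hy),
    S.sum_fderiv_ψ hΩ.isOpen hy]
  have h1 : ∑ c ∈ S.s, S.ψ c y * fderiv ℝ (moll Ω (S.κ c) t f) y (EuclideanSpace.single i 1) =
      ∑ c ∈ S.s, S.ψ c y * moll Ω (S.κ c) t g y := by
    refine Finset.sum_congr rfl fun c hc => ?_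
    by_cases hyb : y ∈ Metric.ball c (S.R c / 4)
    · rw [(S.coneAt' hc).fderiv_moll_eq hΩ.isOpen (S.isMollifier c).toIsKernel (subset_closure hy)
        hyb ht0 (ht c hc).le hfi hfg]
    · simp [S.ψ_eq_zero hc hyb]
  rw [h1]
  ring

/-- Smoothing is compatible with transport operators. -/
theorem tendsto_transport_smooth (hΩ : IsC6Domain Ω) {β : E n → E n} {d v f : E n → ℝ} {L M : ℝ}
    (hβ : ContinuousOn β (closure Ω))
    (hL : ∀ c ∈ S.s, ∀ y ∈ Ω, y ∈ Metric.ball c (S.R c / 4) → ∀ t, 0 < t → t ≤ S.R c / 4 →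
      ∀ b ∈ Metric.closedBall (S.a c) (1 / 4), ‖β y - β (y - t • b)‖ ≤ L * t)
    (hd : AEStronglyMeasurable d (volume.restrict Ω))
    (hM : ∀ᵐ z ∂(volume.restrict Ω), |d z| ≤ M)
    (hdiv : ∀ φ, IsTest Ω φ → ∫ z in Ω, (⟪β z, gradient φ z⟫ + d z * φ z) = 0)
    (hv : MemLp v 2 (volume.restrict Ω)) (hf : MemLp f 2 (volume.restrict Ω))
    (hvf : ∀ φ, IsTest Ω φ → ∫ z in Ω, f z * φ z =
      -∫ z in Ω, v z * (⟪β z, gradient φ z⟫ + d z * φ z)) :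
    Tendsto (fun t => eLpNorm (fun y => ⟪β y, gradient (S.smooth t v) y⟫ - f y) 2
      (volume.restrict Ω)) (𝓝[>] 0) (𝓝 0) := by
  have hfin : IsFiniteMeasure (volume.restrict Ω) :=
    ⟨by rw [Measure.restrict_apply_univ]; exact hΩ.isBounded.measure_lt_top⟩
  have hfi : IntegrableOn f Ω := hf.integrable (by norm_num)
  have hvi : IntegrableOn v Ω := hv.integrable (by norm_num)
  have hβb : ∃ B, ∀ y ∈ Ω, ‖β y‖ ≤ B := by
    obtain ⟨B, hB⟩ := hΩ.isCompact_closure.exists_bound_of_continuousOn hβ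
    exact ⟨B, fun y hy => hB y (subset_closure hy)⟩
  have hcm : ∀ c, ∀ t, 0 < t → AEStronglyMeasurable
      (fun y => ⟪β y, gradient (moll Ω (S.κ c) t v) y⟫ - moll Ω (S.κ c) t f y)
      (volume.restrict Ω) := by
    intro c t ht
    simp only [inner_gradient]
    have h1 := contDiff_moll hΩ.isOpen (S.isMollifier c).toIsKernel ht hvi
    have h2 := contDiff_moll hΩ.isOpen (S.isMollifier c).toIsKernel ht hfi
    exact (((((h1.continuous_fderiv (by simp)).continuousOn.clm_apply hβ).mono
      subset_closure).aestronglyMeasurable hΩ.isOpen.measurableSet)).sub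
      h2.continuous.aestronglyMeasurable
  have hcomm : Tendsto (fun t => eLpNorm (fun y => ∑ c ∈ S.s, S.ψ c y *
      (⟪β y, gradient (moll Ω (S.κ c) t v) y⟫ - moll Ω (S.κ c) t f y)) 2 (volume.restrict Ω))
      (𝓝[>] 0) (𝓝 0) :=
    tendsto_eLpNorm_sum_mul hΩ.isOpen.measurableSet S.s
      (B := fun c => Metric.ball c (S.R c / 4)) (m := S.ψ)
      (h := fun c t y => ⟪β y, gradient (moll Ω (S.κ c) t v) y⟫ - moll Ω (S.κ c) t f y)
      (fun c => measurableSet_ball)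
      (fun c hc => ⟨1, fun y hy => S.ψ_le_one hc (subset_closure hy)⟩)
      (fun c hc y hy => S.ψ_eq_zero hc hy) (fun c _ => S.measurable_ψ c)
      (fun c _ => by filter_upwards [self_mem_nhdsWithin] with t ht using hcm c t ht)
      (fun c hc => (S.coneAt' hc).tendsto_commutator hΩ.isOpen hΩ.isBounded
        (S.isMollifier c).toIsKernel (hβ.mono subset_closure) hβb (hL c hc) hd hM hdiv hv hvf)
  have h5 := tendsto_eLpNorm_add (l := 𝓝[>] 0)
    (f := fun t y => ∑ c ∈ S.s, S.ψ c y *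
      (⟪β y, gradient (moll Ω (S.κ c) t v) y⟫ - moll Ω (S.κ c) t f y))
    (g := fun t y => ∑ c ∈ S.s, S.ψ c y * (moll Ω (S.κ c) t f y - f y))
    (by
      filter_upwards [self_mem_nhdsWithin] with t ht
      exact Finset.aestronglyMeasurable_fun_sum S.s fun c _ =>
        (S.measurable_ψ c).mul (hcm c t ht))
    (by
      filter_upwards [self_mem_nhdsWithin] with t ht
      exact S.measurable_sum_ψ_moll hΩ hfi ht)
    hcomm (S.tendsto_sum_ψ_moll hΩ hf)
  -- The error has three parts: the Friedrichs commutators, the mollification error of `f`, and the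
  -- mollification error of `v` multiplied by derivatives of the partition of unity.
  have h := tendsto_eLpNorm_add (l := 𝓝[>] 0)
    (f := fun t y => (∑ c ∈ S.s, S.ψ c y *
      (⟪β y, gradient (moll Ω (S.κ c) t v) y⟫ - moll Ω (S.κ c) t f y)) +
      ∑ c ∈ S.s, S.ψ c y * (moll Ω (S.κ c) t f y - f y))
    (g := fun t y => ∑ c ∈ S.s, fderiv ℝ (S.ψ c) y (β y) * (moll Ω (S.κ c) t v y - v y))
    (by
      filter_upwards [self_mem_nhdsWithin] with t ht
      exact (Finset.aestronglyMeasurable_fun_sum S.s fun c _ =>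
        (S.measurable_ψ c).mul (hcm c t ht)).add (S.measurable_sum_ψ_moll hΩ hfi ht))
    (by
      filter_upwards [self_mem_nhdsWithin] with t ht
      exact S.measurable_sum_fderiv_ψ_moll hΩ hβ hv ht)
    h5 (S.tendsto_sum_fderiv_ψ_moll hΩ hβ hv)
  refine h.congr' ?_
  filter_upwards [self_mem_nhdsWithin] with t ht0
  refine eLpNorm_congr_ae ?_
  filter_upwards [ae_restrict_mem hΩ.isOpen.measurableSet] with y hy
  simp only [inner_gradient]
  rw [S.fderiv_smooth hΩ.isOpen ht0 hvi, Finset.sum_add_distrib]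
  simp only [mul_sub, Finset.sum_sub_distrib, ← Finset.sum_mul, S.ψ_sum y (subset_closure hy),
    S.sum_fderiv_ψ hΩ.isOpen hy]
  ring

end SmoothingSystem

/-- **Sobolev embedding**: functions in `H²(Ω)` are continuous up to the boundary, `n ≤ 3`. -/
theorem IsC6Domain.exists_continuousOn_rep {Ω : Set (E n)} (hn : n ≤ 3) (hΩ : IsC6Domain Ω)
    {f : E n → ℝ} (hf : MemSobolev Ω 2 2 f) :
    ∃ F : E n → ℝ, ContinuousOn F (closure Ω) ∧ F =ᵐ[volume.restrict Ω] f := by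
  have hfin : IsFiniteMeasure (volume.restrict Ω) :=
    ⟨by rw [Measure.restrict_apply_univ]; exact hΩ.isBounded.measure_lt_top⟩
  obtain ⟨S⟩ := hΩ.nonempty_smoothingSystem
  have hfi : IntegrableOn f Ω := hf.1.integrable (by norm_num)
  set τ : ℕ → ℝ := fun k => 1 / ((k : ℝ) + 1) with hτ
  have hτ0 : ∀ k, 0 < τ k := fun k => by positivity
  have hτlim : Tendsto τ atTop (𝓝[>] 0) :=
    tendsto_nhdsWithin_iff.2 ⟨tendsto_one_div_add_atTop_nhds_zero_nat,
      Eventually.of_forall fun k => hτ0 k⟩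
  have hUC : UniformCauchySeqOn (fun k => S.smooth (τ k) f) atTop (closure Ω) := by
    rw [Metric.uniformCauchySeqOn_iff]
    intro ε hε
    obtain ⟨T, hT, H⟩ := S.smooth_uniform_cauchy hn hΩ hf (half_pos hε)
    have h1 : ∀ᶠ k in atTop, τ k < T := by
      filter_upwards [hτlim.eventually (Ioo_mem_nhdsGT hT)] with k hk using hk.2
    obtain ⟨N, hN⟩ := eventually_atTop.1 h1
    refine ⟨N, fun k hk l hl y hy => ?_⟩
    rw [Real.dist_eq]
    rcases le_total (τ k) (τ l) with h | h
    · rw [abs_sub_comm]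
      linarith [H _ _ (hτ0 k) h (hN l hl) y hy]
    · linarith [H _ _ (hτ0 l) h (hN k hk) y hy]
  have hlimex : ∀ y ∈ closure Ω, ∃ l, Tendsto (fun k => S.smooth (τ k) f y) atTop (𝓝 l) :=
    fun y hy => cauchySeq_tendsto_of_complete (hUC.cauchySeq hy)
  choose! F hF using hlimex
  have hUF := hUC.tendstoUniformlyOn_of_tendsto hF
  refine ⟨F, hUF.continuousOn (Frequently.of_forall fun k =>
    (S.contDiff_smooth hΩ.isOpen (hτ0 k) hfi).continuous.continuousOn), ?_⟩
  -- The uniform limit agrees with `f` almost everywhere, since `L²` convergence gives almost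
  -- everywhere convergence along a subsequence.
  have hL2 := (S.tendsto_smooth hΩ hf.1).comp hτlim
  have hmeas : TendstoInMeasure (volume.restrict Ω) (fun k => S.smooth (τ k) f) atTop f := by
    refine tendstoInMeasure_of_tendsto_eLpNorm (p := 2) (by norm_num)
      (fun k => (S.contDiff_smooth hΩ.isOpen (hτ0 k) hfi).continuous.aestronglyMeasurable)
      hf.1.1 hL2
  obtain ⟨ns, hns, hae⟩ := hmeas.exists_seq_tendsto_ae
  filter_upwards [hae, ae_restrict_mem hΩ.isOpen.measurableSet] with y hy hyΩ
  exact tendsto_nhds_unique ((hF y (subset_closure hyΩ)).comp hns.tendsto_atTop) hy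

/-! ### Weak derivatives -/

section

variable {Ω : Set (E n)}

theorem locallyIntegrableOn_congr {f g : E n → ℝ} (h : f =ᵐ[volume.restrict Ω] g)
    (hf : LocallyIntegrableOn f Ω) : LocallyIntegrableOn g Ω := by
  intro x hx
  obtain ⟨s, hs, hfs⟩ := hf x hx
  refine ⟨s ∩ Ω, inter_mem hs self_mem_nhdsWithin, ?_⟩
  exact (hfs.mono_set inter_subset_left).congr_fun_ae
    (ae_mono (Measure.restrict_mono inter_subset_right le_rfl) h)

theorem HasWeakPartial.congr {f f' g g' : E n → ℝ} {i : Fin n} (h : HasWeakPartial Ω i f g)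
    (hf : f =ᵐ[volume.restrict Ω] f') (hg : g =ᵐ[volume.restrict Ω] g') :
    HasWeakPartial Ω i f' g' := by
  refine ⟨locallyIntegrableOn_congr hf h.1, locallyIntegrableOn_congr hg h.2.1, fun φ hφ => ?_⟩
  have h1 : ∫ x in Ω, f' x * gradient φ x i = ∫ x in Ω, f x * gradient φ x i :=
    integral_congr_ae (by filter_upwards [hf] with x hx; rw [hx])
  have h2 : ∫ x in Ω, g' x * φ x = ∫ x in Ω, g x * φ x :=
    integral_congr_ae (by filter_upwards [hg] with x hx; rw [hx])
  rw [h1, h2, h.2.2 φ hφ]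

/-- The fundamental lemma of the calculus of variations. -/
theorem ae_eq_of_integral_test (hΩ : IsOpen Ω) {f g : E n → ℝ} (hf : LocallyIntegrableOn f Ω)
    (hg : LocallyIntegrableOn g Ω)
    (h : ∀ φ, IsTest Ω φ → ∫ x in Ω, f x * φ x = ∫ x in Ω, g x * φ x) :
    f =ᵐ[volume.restrict Ω] g := by
  have hint : ∀ {f : E n → ℝ}, LocallyIntegrableOn f Ω → ∀ φ, IsTest Ω φ →
      Integrable (fun x => f x * φ x) := fun hf φ hφ => by
    have h1 := (hf.integrableOn_compact_subset hφ.2.2 hφ.2.1).mul_continuousOn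
      hφ.1.continuous.continuousOn hφ.2.1
    exact (integrableOn_iff_integrable_of_support_subset
      ((Function.support_mul_subset_right _ _).trans (subset_tsupport φ))).1 h1
  have h1 := hΩ.ae_eq_zero_of_integral_contDiff_smul_eq_zero (hf.sub hg) (fun φ h1 h2 h3 => by
    have hφ : IsTest Ω φ := ⟨h1, h2, h3⟩
    have h4 : ∀ x, φ x • (f - g) x = f x * φ x - g x * φ x := fun x => by
      simp only [smul_eq_mul, Pi.sub_apply]
      ring
    have h5 : ∀ {f : E n → ℝ}, ∫ x, f x * φ x = ∫ x in Ω, f x * φ x := fun {f} =>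
      (setIntegral_eq_integral_of_forall_compl_eq_zero fun x hx => by
        rw [image_eq_zero_of_notMem_tsupport fun h => hx (h3 h), mul_zero]).symm
    simp only [h4]
    rw [integral_sub (hint hf φ hφ) (hint hg φ hφ), h5, h5, h φ hφ, sub_self])
  rw [EventuallyEq, ae_restrict_iff' hΩ.measurableSet]
  filter_upwards [h1] with x hx hxΩ
  exact sub_eq_zero.1 (hx hxΩ)

theorem HasWeakPartial.ae_eq (hΩ : IsOpen Ω) {f g g' : E n → ℝ} {i : Fin n}
    (h : HasWeakPartial Ω i f g) (h' : HasWeakPartial Ω i f g') :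
    g =ᵐ[volume.restrict Ω] g' :=
  ae_eq_of_integral_test hΩ h.2.1 h'.2.1 fun φ hφ =>
    neg_injective ((h.2.2 φ hφ).symm.trans (h'.2.2 φ hφ))

theorem MemSobolev.memLp {p : ℝ≥0∞} {k : ℕ} {f : E n → ℝ} (h : MemSobolev Ω p k f) :
    MemLp f p (volume.restrict Ω) := by
  cases k with
  | zero => exact h
  | succ k => exact h.1

theorem MemSobolev.of_succ {p : ℝ≥0∞} {k : ℕ} {f : E n → ℝ} (h : MemSobolev Ω p (k + 1) f) :
    MemSobolev Ω p k f := by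
  induction k generalizing f with
  | zero => exact h.1
  | succ k ih =>
    refine ⟨h.1, fun i => ?_⟩
    obtain ⟨g, hg, hgk⟩ := h.2 i
    exact ⟨g, hg, ih hgk⟩

theorem MemSobolev.mono {p : ℝ≥0∞} {k l : ℕ} (hkl : k ≤ l) {f : E n → ℝ}
    (h : MemSobolev Ω p l f) : MemSobolev Ω p k f := by
  induction l, hkl using Nat.le_induction with
  | base => exact h
  | succ l _ ih => exact ih h.of_succ

theorem MemSobolev.congr {p : ℝ≥0∞} {k : ℕ} {f f' : E n → ℝ} (h : MemSobolev Ω p k f)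
    (hf : f =ᵐ[volume.restrict Ω] f') : MemSobolev Ω p k f' := by
  cases k with
  | zero => exact (memLp_congr_ae hf).1 h
  | succ k =>
    refine ⟨(memLp_congr_ae hf).1 h.1, fun i => ?_⟩
    obtain ⟨g, hg, hgk⟩ := h.2 i
    exact ⟨g, hg.congr hf (EventuallyEq.refl _ _), hgk⟩

theorem MemSobolev.hasWeakPartial {p : ℝ≥0∞} {k : ℕ} {f : E n → ℝ}
    (h : MemSobolev Ω p (k + 1) f) (i : Fin n) : HasWeakPartial Ω i f (weakPartial Ω i f) := by
  obtain ⟨g, hg, -⟩ := h.2 i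
  have hex : ∃ g, HasWeakPartial Ω i f g := ⟨g, hg⟩
  rw [weakPartial, dif_pos hex]
  exact hex.choose_spec

theorem MemSobolev.weakPartial (hΩ : IsOpen Ω) {p : ℝ≥0∞} {k : ℕ} {f : E n → ℝ}
    (h : MemSobolev Ω p (k + 1) f) (i : Fin n) :
    MemSobolev Ω p k (weakPartial Ω i f) := by
  obtain ⟨g, hg, hgk⟩ := h.2 i
  exact hgk.congr (hg.ae_eq hΩ (h.hasWeakPartial i))

/-- The default value `0` makes this unconditional. -/
theorem continuousOn_contRep (Ω : Set (E n)) (f : E n → ℝ) :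
    ContinuousOn (contRep Ω f) (closure Ω) := by
  by_cases h : ∃ F : E n → ℝ, ContinuousOn F (closure Ω) ∧ F =ᵐ[volume.restrict Ω] f
  · rw [contRep, dif_pos h]
    exact h.choose_spec.1
  · rw [contRep, dif_neg h]
    exact continuousOn_const

theorem contRep_ae_eq {f : E n → ℝ}
    (h : ∃ F : E n → ℝ, ContinuousOn F (closure Ω) ∧ F =ᵐ[volume.restrict Ω] f) :
    contRep Ω f =ᵐ[volume.restrict Ω] f := by
  rw [contRep, dif_pos h]
  exact h.choose_spec.2

theorem IsC6Domain.isFiniteMeasure_restrict (hΩ : IsC6Domain Ω) :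
    IsFiniteMeasure (volume.restrict Ω) :=
  ⟨by rw [Measure.restrict_apply_univ]; exact hΩ.isBounded.measure_lt_top⟩

theorem IsC6Domain.memLp_of_continuousOn (hΩ : IsC6Domain Ω) {p : ℝ≥0∞} {f : E n → ℝ}
    (hf : ContinuousOn f (closure Ω)) : MemLp f p (volume.restrict Ω) := by
  have := hΩ.isFiniteMeasure_restrict
  obtain ⟨C, hC⟩ := hΩ.isCompact_closure.exists_bound_of_continuousOn hf
  refine MemLp.of_bound ((hf.mono subset_closure).aestronglyMeasurable hΩ.isOpen.measurableSet) C ?_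
  filter_upwards [ae_restrict_mem hΩ.isOpen.measurableSet] with y hy using hC y (subset_closure hy)

theorem IsC6Domain.exists_ae_bound (hn : n ≤ 3) (hΩ : IsC6Domain Ω) {f : E n → ℝ}
    (hf : MemSobolev Ω 2 2 f) : ∃ C, ∀ᵐ y ∂(volume.restrict Ω), |f y| ≤ C := by
  obtain ⟨F, hF, hFf⟩ := hΩ.exists_continuousOn_rep hn hf
  obtain ⟨C, hC⟩ := hΩ.isCompact_closure.exists_bound_of_continuousOn hF
  refine ⟨C, ?_⟩
  filter_upwards [hFf, ae_restrict_mem hΩ.isOpen.measurableSet] with y h1 h2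
  rw [← h1]
  exact hC y (subset_closure h2)

/-! ### Lipschitz bounds along cones -/

theorem norm_le_sum_abs (v : E n) : ‖v‖ ≤ ∑ i, |v i| := by
  nth_rewrite 1 [← (EuclideanSpace.basisFun (Fin n) ℝ).sum_repr v]
  refine (norm_sum_le Finset.univ fun i => (EuclideanSpace.basisFun (Fin n) ℝ).repr v i •
    EuclideanSpace.basisFun (Fin n) ℝ i).trans (Finset.sum_le_sum fun i _ => ?_)
  rw [norm_smul]
  simp

theorem ConeAt.abs_moll_le {κ : E n → ℝ} {x a : E n} {R t : ℝ} (hC : ConeAt Ω x a R)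
    (hκ : IsMollifier κ a) {y : E n} (hyc : y ∈ closure Ω) (hy : y ∈ Metric.ball x R) (ht : 0 < t)
    (htR : t ≤ R) {g : E n → ℝ} {M : ℝ} (hM : ∀ᵐ z ∂(volume.restrict Ω), |g z| ≤ M) :
    |moll Ω κ t g y| ≤ M := by
  have hi : IntegrableOn (fun z => kern κ t (y - z)) Ω :=
    (((hκ.contDiff_kern t).continuous.integrable_of_hasCompactSupport
      (hκ.hasCompactSupport_kern ht)).comp_sub_left y).integrableOn
  have h1 : |moll Ω κ t g y| ≤ ∫ z in Ω, M * kern κ t (y - z) := by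
    rw [moll, ← Real.norm_eq_abs]
    refine norm_integral_le_of_norm_le (hi.const_mul M) ?_
    filter_upwards [hM] with z hz
    have h0 : 0 ≤ kern κ t (y - z) := mul_nonneg (by positivity) (hκ.nonneg _)
    rw [norm_mul, Real.norm_eq_abs, Real.norm_eq_abs, abs_of_nonneg h0]
    exact mul_le_mul_of_nonneg_right hz h0
  rwa [integral_const_mul, hC.setIntegral_kern hκ.toIsKernel hyc hy ht htR, hκ.integral_eq_one,
    mul_one] at h1

/-- The segment from `y` to `y - t b` lies in `Ω` by the cone condition, so the mean value
inequality applies to a mollification of `f`, whose partial derivatives are mollifications of `g i`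
and bounded by `M`. Uniform convergence removes the mollification. Only cone directions are covered,
as `Ω` need not be convex; Friedrichs' lemma needs no others. The factor `5/4` bounds `‖b‖`. -/
theorem ConeAt.abs_sub_le (hΩ : IsC6Domain Ω) {κ : E n → ℝ} {x a : E n} {R : ℝ}
    (hC : ConeAt Ω x a R) (hκ : IsMollifier κ a) {f : E n → ℝ} {g : Fin n → E n → ℝ} {M : ℝ}
    (hf : ContinuousOn f (closure Ω)) (hfg : ∀ i, HasWeakPartial Ω i f (g i))
    (hM0 : 0 ≤ M) (hM : ∀ i, ∀ᵐ z ∂(volume.restrict Ω), |g i z| ≤ M)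
    {y : E n} (hyΩ : y ∈ Ω) (hy : y ∈ Metric.ball x (R / 4)) {t : ℝ} (ht : 0 < t) (htR : t ≤ R / 4)
    {b : E n} (hb : b ∈ Metric.closedBall a (1 / 4)) :
    |f y - f (y - t • b)| ≤ n * M * (5 / 4) * t := by
  have hfin := hΩ.isFiniteMeasure_restrict
  have hfi : IntegrableOn f Ω := memLp_one_iff_integrable.1 (hΩ.memLp_of_continuousOn hf)
  have hRpos := hC.pos
  have hbn := hC.norm_dir_le hb
  have hyc := subset_closure hyΩ
  have hyR : y ∈ Metric.ball x R := Metric.ball_subset_ball (by linarith) hy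
  have hseg : ∀ z ∈ segment ℝ y (y - t • b), z ∈ Ω ∧ z ∈ Metric.ball x R := by
    intro z hz
    rw [segment_eq_image'] at hz
    obtain ⟨θ, hθ, rfl⟩ := hz
    have h1 : y + θ • (y - t • b - y) = y - (θ * t) • b := by
      rw [sub_sub_cancel_left, smul_neg, smul_smul, sub_eq_add_neg]
    simp only
    rw [h1]
    have hθt : θ * t ≤ R / 4 := by nlinarith [hθ.1, hθ.2]
    have hθt0 : 0 ≤ θ * t := mul_nonneg hθ.1 ht.le
    constructor
    · rcases hθt0.eq_or_lt with h | h
      · rw [← h, zero_smul, sub_zero]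
        exact hyΩ
      · exact hC.mem y hyc hyR _ h (by linarith) b hb
    · rw [mem_ball_iff_norm] at hy ⊢
      have h2 : y - (θ * t) • b - x = (y - x) - (θ * t) • b := by abel
      have h3 := norm_sub_le (y - x) ((θ * t) • b)
      rw [norm_smul, Real.norm_eq_abs, abs_of_nonneg hθt0] at h3
      rw [h2]
      nlinarith [norm_nonneg b]
  have hmoll : ∀ s, 0 < s → s ≤ R →
      |moll Ω κ s f y - moll Ω κ s f (y - t • b)| ≤ n * M * (5 / 4) * t := by
    intro s hs hsR
    have h1 := (convex_segment y (y - t • b)).norm_image_sub_le_of_norm_fderiv_le (𝕜 := ℝ)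
      (f := moll Ω κ s f) (C := n * M)
      (fun z _ => (contDiff_moll hΩ.isOpen hκ.toIsKernel hs hfi).differentiable (by simp) z)
      (fun z hz => ?_) (right_mem_segment ℝ _ _) (left_mem_segment ℝ _ _)
    · rw [sub_sub_cancel, norm_smul, Real.norm_of_nonneg ht.le] at h1
      refine h1.trans ?_
      have : t * ‖b‖ ≤ (5 / 4) * t := by nlinarith
      have h0 : 0 ≤ n * M := by positivity
      nlinarith
    · obtain ⟨hzΩ, hzR⟩ := hseg z hz
      refine ContinuousLinearMap.opNorm_le_bound _ (by positivity) fun w => ?_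
      have h2 := congrArg (fderiv ℝ (moll Ω κ s f) z)
        ((EuclideanSpace.basisFun (Fin n) ℝ).sum_repr w)
      rw [← h2, map_sum]
      refine (norm_sum_le _ _).trans ?_
      have h3 : ∀ i ∈ (Finset.univ : Finset (Fin n)), ‖fderiv ℝ (moll Ω κ s f) z
          ((EuclideanSpace.basisFun (Fin n) ℝ).repr w i • EuclideanSpace.basisFun (Fin n) ℝ i)‖ ≤
          M * ‖w‖ := by
        intro i _
        rw [map_smul, norm_smul, EuclideanSpace.basisFun_apply,
          hC.fderiv_moll_eq hΩ.isOpen hκ.toIsKernel (subset_closure hzΩ) hzR hs hsR hfi (hfg i),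
          mul_comm]
        exact mul_le_mul (hC.abs_moll_le hκ (subset_closure hzΩ) hzR hs hsR (hM i))
          (by simpa using PiLp.norm_apply_le w i) (norm_nonneg _) hM0
      refine (Finset.sum_le_sum h3).trans ?_
      simp [mul_assoc]
  refine le_of_forall_pos_le_add fun ε hε => ?_
  obtain ⟨δ, hδ, H⟩ := hC.moll_uniform hΩ.isOpen hΩ.isCompact_closure hκ hf (half_pos hε)
  have hs : 0 < min (δ / 2) R := lt_min (by positivity) hRpos
  have hs' : min (δ / 2) R < δ := (min_le_left _ _).trans_lt (by linarith)
  obtain ⟨hzΩ, hzR⟩ := hseg _ (right_mem_segment ℝ y (y - t • b))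
  have h1 := hmoll _ hs (min_le_right _ _)
  have h2 := H _ hs hs' y hyc hyR
  have h3 := H _ hs hs' _ (subset_closure hzΩ) hzR
  rw [abs_le] at *
  constructor <;> linarith

/-! ### The velocity field -/

variable {U : E n → ℝ}

theorem continuousOn_velocity (Ω : Set (E n)) (U : E n → ℝ) :
    ContinuousOn (velocity Ω U) (closure Ω) := by
  refine (PiLp.continuous_toLp 2 _).comp_continuousOn ?_
  exact continuousOn_pi.2 fun i => continuousOn_contRep Ω _

theorem continuousOn_normalVelocity (hΩ : IsC6Domain Ω) (U : E n → ℝ) :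
    ContinuousOn (normalVelocity Ω U) (frontier Ω) :=
  ((continuousOn_velocity Ω U).mono frontier_subset_closure).inner (𝕜 := ℝ)
    hΩ.continuousOn_outwardNormal

theorem velocity_apply_ae_eq (hn : n ≤ 3) (hΩ : IsC6Domain Ω) (hU : MemSobolev Ω 2 5 U)
    (i : Fin n) : weakPartial Ω i U =ᵐ[volume.restrict Ω] fun y => velocity Ω U y i :=
  (contRep_ae_eq (hΩ.exists_continuousOn_rep hn
    ((hU.weakPartial hΩ.isOpen i).mono (by norm_num)))).symm

theorem hasWeakPartial_velocity (hn : n ≤ 3) (hΩ : IsC6Domain Ω) (hU : MemSobolev Ω 2 5 U)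
    (i l : Fin n) : HasWeakPartial Ω i (fun y => velocity Ω U y l)
      (weakPartial Ω i (weakPartial Ω l U)) :=
  ((hU.weakPartial hΩ.isOpen l).hasWeakPartial i).congr (velocity_apply_ae_eq hn hΩ hU l)
    (EventuallyEq.refl _ _)

theorem memSobolev_hessian (hΩ : IsC6Domain Ω) (hU : MemSobolev Ω 2 5 U)
    (i l : Fin n) : MemSobolev Ω 2 3 (weakPartial Ω i (weakPartial Ω l U)) :=
  (hU.weakPartial hΩ.isOpen l).weakPartial hΩ.isOpen i

theorem memLp_lap (hΩ : IsC6Domain Ω) (hU : MemSobolev Ω 2 5 U) :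
    MemLp (lap Ω U) 2 (volume.restrict Ω) :=
  memLp_finsetSum _ fun i _ => (memSobolev_hessian hΩ hU i i).memLp

/-- Second derivatives of `U` are in `H³(Ω)`, hence bounded by the Sobolev embedding. This gives
both the Lipschitz bound for `β` and the bound for its divergence. -/
theorem exists_bound_hessian (hn : n ≤ 3) (hΩ : IsC6Domain Ω) (hU : MemSobolev Ω 2 5 U) :
    ∃ M, 0 ≤ M ∧ ∀ i l, ∀ᵐ y ∂(volume.restrict Ω),
      |weakPartial Ω i (weakPartial Ω l U) y| ≤ M := by
  choose M hM using fun i l => hΩ.exists_ae_bound hn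
    ((memSobolev_hessian hΩ hU i l).mono (k := 2) (by norm_num))
  refine ⟨∑ i, ∑ l, |M i l|, by positivity, fun i l => ?_⟩
  filter_upwards [hM i l] with y hy
  refine (hy.trans (le_abs_self _)).trans ?_
  refine (Finset.single_le_sum (f := fun l => |M i l|) (fun _ _ => abs_nonneg _)
    (Finset.mem_univ l)).trans ?_
  exact Finset.single_le_sum (f := fun i => ∑ l, |M i l|)
    (fun _ _ => Finset.sum_nonneg fun _ _ => abs_nonneg _) (Finset.mem_univ i)

theorem exists_bound_lap (hn : n ≤ 3) (hΩ : IsC6Domain Ω) (hU : MemSobolev Ω 2 5 U) :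
    ∃ M, ∀ᵐ y ∂(volume.restrict Ω), |lap Ω U y| ≤ M := by
  obtain ⟨M, -, hM⟩ := exists_bound_hessian hn hΩ hU
  refine ⟨n * M, ?_⟩
  filter_upwards [ae_all_iff.2 fun i => hM i i] with y hy
  refine (Finset.abs_sum_le_sum_abs _ _).trans ((Finset.sum_le_sum fun i _ => hy i).trans ?_)
  simp

theorem SmoothingSystem.norm_velocity_sub_le (S : SmoothingSystem Ω) (hn : n ≤ 3)
    (hΩ : IsC6Domain Ω) (hU : MemSobolev Ω 2 5 U) :
    ∃ L, ∀ c ∈ S.s, ∀ y ∈ Ω, y ∈ Metric.ball c (S.R c / 4) → ∀ t, 0 < t → t ≤ S.R c / 4 →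
      ∀ b ∈ Metric.closedBall (S.a c) (1 / 4),
      ‖velocity Ω U y - velocity Ω U (y - t • b)‖ ≤ L * t := by
  obtain ⟨M, hM0, hM⟩ := exists_bound_hessian hn hΩ hU
  refine ⟨n * (n * M * (5 / 4)), fun c hc y hy hyb t ht htR b hb => ?_⟩
  refine (norm_le_sum_abs _).trans ?_
  have h : ∀ i ∈ (Finset.univ : Finset (Fin n)),
      |(velocity Ω U y - velocity Ω U (y - t • b)) i| ≤ n * M * (5 / 4) * t := fun i _ =>
    (S.coneAt c hc).abs_sub_le hΩ (S.isMollifier c) (continuousOn_contRep Ω _)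
      (fun l => hasWeakPartial_velocity hn hΩ hU l i) hM0 (fun l => hM l i) hy hyb ht htR hb
  refine (Finset.sum_le_sum h).trans ?_
  simp [mul_assoc]

theorem contDiff_memLp_gradient (hΩ : IsC6Domain Ω) {φ : E n → ℝ} (hφ : ContDiff ℝ 1 φ) :
    MemLp (fun y => ⟪velocity Ω U y, gradient φ y⟫) 2 (volume.restrict Ω) := by
  simp only [inner_gradient]
  exact hΩ.memLp_of_continuousOn
    ((hφ.continuous_fderiv (by norm_num)).continuousOn.clm_apply (continuousOn_velocity Ω U))

theorem inner_velocity_gradient (φ : E n → ℝ) (y : E n) :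
    ⟪velocity Ω U y, gradient φ y⟫ = ∑ i, velocity Ω U y i * gradient φ y i := by
  rw [PiLp.inner_apply]
  exact Finset.sum_congr rfl fun i _ => mul_comm _ _

theorem integral_velocity_test (hn : n ≤ 3) (hΩ : IsC6Domain Ω) (hU : MemSobolev Ω 2 5 U)
    {φ : E n → ℝ} (hφ : IsTest Ω φ) :
    ∫ y in Ω, (⟪velocity Ω U y, gradient φ y⟫ + lap Ω U y * φ y) = 0 := by
  have h1 : ∀ y, ⟪velocity Ω U y, gradient φ y⟫ + lap Ω U y * φ y =
      ∑ i, (velocity Ω U y i * gradient φ y i +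
        weakPartial Ω i (weakPartial Ω i U) y * φ y) := fun y => by
    rw [inner_velocity_gradient, lap, Finset.sum_mul, Finset.sum_add_distrib]
  have h0 : MemLp φ 2 (volume.restrict Ω) :=
    hΩ.memLp_of_continuousOn hφ.1.continuous.continuousOn
  have h2 : ∀ i, Integrable (fun y => velocity Ω U y i * gradient φ y i)
      (volume.restrict Ω) := fun i =>
    (hΩ.memLp_of_continuousOn (continuousOn_contRep Ω _)).integrable_mul (p := 2) (q := 2)
      (hΩ.memLp_of_continuousOn (by
        simp only [gradient_apply]
        exact ((hφ.1.continuous_fderiv (by simp)).clm_apply continuous_const).continuousOn))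
  have h3 : ∀ i, Integrable (fun y => weakPartial Ω i (weakPartial Ω i U) y * φ y)
      (volume.restrict Ω) := fun i => (memSobolev_hessian hΩ hU i i).memLp.integrable_mul h0
  simp only [h1]
  have h4 : ∀ i, Integrable (fun y => velocity Ω U y i * gradient φ y i +
      weakPartial Ω i (weakPartial Ω i U) y * φ y) (volume.restrict Ω) := fun i =>
    (h2 i).add (h3 i)
  rw [integral_finsetSum _ fun i _ => h4 i]
  refine Finset.sum_eq_zero fun i _ => ?_
  rw [integral_add (h2 i) (h3 i), (hasWeakPartial_velocity hn hΩ hU i i).2.2 φ hφ, neg_add_cancel]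

/-- Functions of the graph space are approximated by their smoothings. -/
theorem SmoothingSystem.tendsto_transport (S : SmoothingSystem Ω) (hn : n ≤ 3)
    (hΩ : IsC6Domain Ω) (hU : MemSobolev Ω 2 5 U) {v f : E n → ℝ}
    (hv : MemLp v 2 (volume.restrict Ω)) (hf : MemLp f 2 (volume.restrict Ω))
    (hvf : HasTransportDeriv Ω U v f) :
    Tendsto (fun t => eLpNorm (fun y => ⟪velocity Ω U y, gradient (S.smooth t v) y⟫ - f y) 2
      (volume.restrict Ω)) (𝓝[>] 0) (𝓝 0) := by
  obtain ⟨L, hL⟩ := S.norm_velocity_sub_le hn hΩ hU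
  obtain ⟨M, hM⟩ := exists_bound_lap hn hΩ hU
  exact S.tendsto_transport_smooth hΩ (continuousOn_velocity Ω U) hL (memLp_lap hΩ hU).1 hM
    (fun φ hφ => integral_velocity_test hn hΩ hU hφ) hv hf hvf

end

/-! ### Green's formula -/

theorem tendsto_integral_mul_of_eLpNorm {α : Type*} [MeasurableSpace α] {μ : Measure α}
    {l : Filter ℝ} {h : ℝ → α → ℝ} {g m : α → ℝ} (hh : ∀ᶠ t in l, MemLp (h t) 2 μ)
    (hg : MemLp g 2 μ) (hm : MemLp m 2 μ)
    (hlim : Tendsto (fun t => eLpNorm (fun y => h t y - g y) 2 μ) l (𝓝 0)) :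
    Tendsto (fun t => ∫ y, h t y * m y ∂μ) l (𝓝 (∫ y, g y * m y ∂μ)) := by
  refine tendsto_integral_of_L1' _ (hg.integrable_mul hm).1
    (by filter_upwards [hh] with t ht using ht.integrable_mul hm) ?_
  have h1 := ENNReal.Tendsto.mul_const (b := eLpNorm m 2 μ) hlim (Or.inr hm.eLpNorm_ne_top)
  rw [zero_mul] at h1
  refine tendsto_of_tendsto_of_tendsto_of_le_of_le' tendsto_const_nhds h1
    (Eventually.of_forall fun _ => zero_le) ?_
  filter_upwards [hh] with t ht
  have h2 := eLpNorm_smul_le_mul_eLpNorm (p := 2) (q := 2) (r := 1) hm.1 (ht.sub hg).1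
  refine le_trans (le_of_eq ?_) h2
  congr 1
  funext y
  simp [sub_mul]

section

variable {Ω : Set (E n)}

/-- The divergence theorem holds for the smoothings of `f` times `φ`. In the limit the interior
integrals converge by `L²` convergence of the smoothings and their derivatives, the boundary
integral by uniform convergence on the closure. -/
theorem integral_weakPartial_eq (hΩ : IsC6Domain Ω) {f g φ : E n → ℝ} {i : Fin n}
    (hf : ContinuousOn f (closure Ω)) (hg : MemLp g 2 (volume.restrict Ω))
    (hfg : HasWeakPartial Ω i f g) (hφ : ContDiff ℝ 1 φ) :
    ∫ y in Ω, (f y * gradient φ y i + g y * φ y) =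
      ∫ y, ⟪EuclideanSpace.single i 1, outwardNormal Ω y⟫ * (f y * φ y) ∂(surface Ω) := by
  obtain ⟨S⟩ := hΩ.nonempty_smoothingSystem
  have := hΩ.isFiniteMeasure_surface
  have hfL := hΩ.memLp_of_continuousOn (p := 2) hf
  have hfin := hΩ.isFiniteMeasure_restrict
  have hfi : IntegrableOn f Ω := hfL.integrable (by norm_num)
  have hSC : ∀ t, 0 < t → ContDiff ℝ 1 (S.smooth t f) := fun t ht =>
    (S.contDiff_smooth hΩ.isOpen ht hfi).of_le (by exact_mod_cast le_top)
  have hφL := hΩ.memLp_of_continuousOn (p := 2) hφ.continuous.continuousOn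
  have hφ'c : Continuous fun y => gradient φ y i := by
    simp only [gradient_apply]
    exact (hφ.continuous_fderiv (by norm_num)).clm_apply continuous_const
  have hφ'L := hΩ.memLp_of_continuousOn (p := 2) hφ'c.continuousOn
  have hS1 : ∀ᶠ t in 𝓝[>] (0 : ℝ), MemLp (S.smooth t f) 2 (volume.restrict Ω) := by
    filter_upwards [self_mem_nhdsWithin] with t ht
    exact hΩ.memLp_of_continuousOn (hSC t ht).continuous.continuousOn
  have hS2 : ∀ᶠ t in 𝓝[>] (0 : ℝ), MemLp (fun y => fderiv ℝ (S.smooth t f) y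
      (EuclideanSpace.single i 1)) 2 (volume.restrict Ω) := by
    filter_upwards [self_mem_nhdsWithin] with t ht
    exact hΩ.memLp_of_continuousOn (((hSC t ht).continuous_fderiv (by norm_num)).clm_apply
      continuous_const).continuousOn
  have h1 := (tendsto_integral_mul_of_eLpNorm hS1 hfL hφ'L (S.tendsto_smooth hΩ hfL)).add
    (tendsto_integral_mul_of_eLpNorm hS2 hg hφL (S.tendsto_fderiv_smooth hΩ hfL hg hfg))
  have hint : ∀ {p q : E n → ℝ}, MemLp p 2 (volume.restrict Ω) → MemLp q 2 (volume.restrict Ω) →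
      Integrable (fun y => p y * q y) (volume.restrict Ω) := fun hp hq => hp.integrable_mul hq
  rw [← integral_add (hint hfL hφ'L) (hint hg hφL)] at h1
  obtain ⟨A, hA⟩ := hΩ.isCompact_closure.exists_bound_of_continuousOn hf
  obtain ⟨B, hB⟩ := hΩ.isCompact_closure.exists_bound_of_continuousOn
    (f := φ) hφ.continuous.continuousOn
  obtain ⟨N, hN⟩ := (hΩ.isCompact_closure.of_isClosed_subset isClosed_frontier
    frontier_subset_closure).exists_bound_of_continuousOn
    (hΩ.continuousOn_inner_normal (EuclideanSpace.single i 1))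
  have h2 : Tendsto (fun t => ∫ y, ⟪EuclideanSpace.single i 1, outwardNormal Ω y⟫ *
      (S.smooth t f y * φ y) ∂(surface Ω)) (𝓝[>] 0)
      (𝓝 (∫ y, ⟪EuclideanSpace.single i 1, outwardNormal Ω y⟫ * (f y * φ y) ∂(surface Ω))) := by
    refine tendsto_integral_filter_of_norm_le_const ?_ ⟨N * ((A + 1) * B), ?_⟩ ?_
    · filter_upwards [self_mem_nhdsWithin] with t ht
      exact aestronglyMeasurable_surface ((hΩ.continuousOn_inner_normal _).mul
        ((hSC t ht).continuous.mul hφ.continuous).continuousOn)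
    · filter_upwards [S.smooth_uniform hΩ hf one_pos] with t ht
      filter_upwards [ae_surface_mem_frontier Ω] with y hy
      have hyc := frontier_subset_closure hy
      have h3 : ‖S.smooth t f y‖ ≤ A + 1 := by
        have := norm_add_le (S.smooth t f y - f y) (f y)
        rw [sub_add_cancel] at this
        have h4 : ‖S.smooth t f y - f y‖ ≤ 1 := ht y hyc
        linarith [hA y hyc]
      have h5 := hB y hyc
      have h6 := hN y hy
      have h7 := (norm_nonneg _).trans h3
      have h8 := (norm_nonneg _).trans h6
      rw [norm_mul, norm_mul]
      gcongr
    · filter_upwards [ae_surface_mem_frontier Ω] with y hy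
      have hyc := frontier_subset_closure hy
      have h3 : Tendsto (fun t => S.smooth t f y) (𝓝[>] 0) (𝓝 (f y)) := by
        refine Metric.tendsto_nhds.2 fun ε hε => ?_
        filter_upwards [S.smooth_uniform hΩ hf (half_pos hε)] with t ht
        rw [Real.dist_eq]
        linarith [ht y hyc]
      exact (h3.mul_const _).const_mul _
  refine tendsto_nhds_unique h1 (h2.congr' ?_)
  filter_upwards [self_mem_nhdsWithin, hS1, hS2] with t ht ht1 ht2
  rw [← hΩ.integral_fderiv_eq ((hSC t ht).mul hφ), ← integral_add (hint ht1 hφ'L)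
    (hint ht2 hφL)]
  refine integral_congr_ae (Eventually.of_forall fun y => ?_)
  have h3 := (hSC t ht).differentiable (by norm_num) y
  have h4 := hφ.differentiable (by norm_num) y
  simp only
  rw [fderiv_fun_mul h3 h4]
  simp [gradient_apply]
  ring

variable {U : E n → ℝ}

/-- Green's formula for the velocity field. -/
theorem integral_velocity_eq (hn : n ≤ 3) (hΩ : IsC6Domain Ω) (hU : MemSobolev Ω 2 5 U)
    {φ : E n → ℝ} (hφ : ContDiff ℝ 1 φ) :
    ∫ y in Ω, (⟪velocity Ω U y, gradient φ y⟫ + lap Ω U y * φ y) =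
      ∫ y, normalVelocity Ω U y * φ y ∂(surface Ω) := by
  have h1 : ∀ y, ⟪velocity Ω U y, gradient φ y⟫ + lap Ω U y * φ y =
      ∑ i, (velocity Ω U y i * gradient φ y i +
        weakPartial Ω i (weakPartial Ω i U) y * φ y) := fun y => by
    rw [inner_velocity_gradient, lap, Finset.sum_mul, Finset.sum_add_distrib]
  have h0 : MemLp φ 2 (volume.restrict Ω) :=
    hΩ.memLp_of_continuousOn hφ.continuous.continuousOn
  have h4 : ∀ i, Integrable (fun y => velocity Ω U y i * gradient φ y i +
      weakPartial Ω i (weakPartial Ω i U) y * φ y) (volume.restrict Ω) := fun i => by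
    refine Integrable.add ?_ ((memSobolev_hessian hΩ hU i i).memLp.integrable_mul h0)
    refine (hΩ.memLp_of_continuousOn (continuousOn_contRep Ω _)).integrable_mul (p := 2) (q := 2)
      (hΩ.memLp_of_continuousOn ?_)
    simp only [gradient_apply]
    exact ((hφ.continuous_fderiv (by norm_num)).clm_apply continuous_const).continuousOn
  simp only [h1]
  rw [integral_finsetSum _ fun i _ => h4 i]
  have h5 : ∀ i, Integrable (fun y => ⟪EuclideanSpace.single i 1, outwardNormal Ω y⟫ *
      (velocity Ω U y i * φ y)) (surface Ω) := fun i =>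
    hΩ.integrable_surface ((hΩ.continuousOn_inner_normal _).mul
      (((continuousOn_contRep Ω _).mono frontier_subset_closure).mul hφ.continuous.continuousOn))
  have h6 : ∀ y, normalVelocity Ω U y * φ y = ∑ i, ⟪EuclideanSpace.single i 1,
      outwardNormal Ω y⟫ * (velocity Ω U y i * φ y) := fun y => by
    rw [normalVelocity, PiLp.inner_apply, Finset.sum_mul]
    refine Finset.sum_congr rfl fun i _ => ?_
    rw [EuclideanSpace.inner_single_left]
    simp
    ring
  simp only [h6]
  rw [integral_finsetSum _ fun i _ => h5 i]
  exact Finset.sum_congr rfl fun i _ => integral_weakPartial_eq hΩ (continuousOn_contRep Ω _)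
    (memSobolev_hessian hΩ hU i i).memLp (hasWeakPartial_velocity hn hΩ hU i i) hφ

/-! ### The weighted surface measure -/

theorem isFiniteMeasure_weightedSurface (hΩ : IsC6Domain Ω) (U : E n → ℝ) :
    IsFiniteMeasure (weightedSurface Ω U) :=
  isFiniteMeasure_withDensity_ofReal
    (hΩ.integrable_surface (continuousOn_normalVelocity hΩ U).abs).2

theorem aemeasurable_abs_normalVelocity (hΩ : IsC6Domain Ω) (U : E n → ℝ) :
    AEMeasurable (fun x => |normalVelocity Ω U x|.toNNReal) (surface Ω) :=
  (aestronglyMeasurable_surface (continuousOn_normalVelocity hΩ U).abs).aemeasurable.real_toNNReal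

theorem integral_weightedSurface (hΩ : IsC6Domain Ω) (U f : E n → ℝ) :
    ∫ x, f x ∂(weightedSurface Ω U) = ∫ x, |normalVelocity Ω U x| * f x ∂(surface Ω) := by
  have h := integral_withDensity_eq_integral_smul₀ (aemeasurable_abs_normalVelocity hΩ U) f
  rw [weightedSurface]
  refine h.trans (integral_congr_ae (Eventually.of_forall fun x => ?_))
  simp only [NNReal.smul_def, Real.coe_toNNReal _ (abs_nonneg _), smul_eq_mul]

theorem weightedSurface_absolutelyContinuous (Ω : Set (E n)) (U : E n → ℝ) :
    weightedSurface Ω U ≪ surface Ω :=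
  withDensity_absolutelyContinuous _ _

theorem ae_weightedSurface_mem_frontier (Ω : Set (E n)) (U : E n → ℝ) :
    ∀ᵐ x ∂(weightedSurface Ω U), x ∈ frontier Ω :=
  (weightedSurface_absolutelyContinuous Ω U).ae_le (ae_surface_mem_frontier Ω)

theorem ae_weightedSurface_ne_zero (hΩ : IsC6Domain Ω) (U : E n → ℝ) :
    ∀ᵐ x ∂(weightedSurface Ω U), normalVelocity Ω U x ≠ 0 := by
  have h : AEMeasurable (fun x => ENNReal.ofReal |normalVelocity Ω U x|) (surface Ω) :=
    (aemeasurable_abs_normalVelocity hΩ U).coe_nnreal_ennreal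
  rw [weightedSurface, ae_withDensity_iff' h]
  refine Eventually.of_forall fun x hx h0 => hx ?_
  rw [h0, abs_zero, ENNReal.ofReal_zero]

theorem memLp_weightedSurface_of_continuousOn (hΩ : IsC6Domain Ω) (U : E n → ℝ)
    {p : ℝ≥0∞} {f : E n → ℝ} (hf : ContinuousOn f (frontier Ω)) :
    MemLp f p (weightedSurface Ω U) := by
  have := isFiniteMeasure_weightedSurface hΩ U
  obtain ⟨C, hC⟩ := (hΩ.isCompact_closure.of_isClosed_subset isClosed_frontier
    frontier_subset_closure).exists_bound_of_continuousOn hf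
  refine MemLp.of_bound ((aestronglyMeasurable_surface hf).mono_ac
    (weightedSurface_absolutelyContinuous Ω U)) C ?_
  filter_upwards [ae_weightedSurface_mem_frontier Ω U] with y hy using hC y hy

/-- A smooth function that equals the sign of the normal velocity on the in- and outflow
boundary. -/
theorem WellSeparated.exists_contDiff_sign (hsep : WellSeparated Ω U) :
    ∃ χ : E n → ℝ, ContDiff ℝ ∞ χ ∧
      ∀ x ∈ frontier Ω, |normalVelocity Ω U x| * χ x = normalVelocity Ω U x := by
  obtain ⟨d, hd, H⟩ := hsep
  -- Smooth separation needs disjoint closed sets; the positive distance passes to the closures.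
  have hdisj : Disjoint (closure (inflow Ω U)) (closure (outflow Ω U)) := by
    rw [Set.disjoint_left]
    intro x hx hx'
    rw [Metric.mem_closure_iff] at hx hx'
    obtain ⟨y, hy, hxy⟩ := hx (d / 2) (half_pos hd)
    obtain ⟨z, hz, hxz⟩ := hx' (d / 2) (half_pos hd)
    have h1 := H y hy z hz
    have h2 := dist_triangle_left y z x
    linarith
  obtain ⟨f, hf0, hf1, -⟩ := exists_contMDiffMap_zero_one_of_isClosed
    (n := (⊤ : ℕ∞)) (modelWithCornersSelf ℝ (E n)) isClosed_closure isClosed_closure hdisj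
  -- The function is `-1` on the inflow and `1` on the outflow boundary; where the normal velocity
  -- vanishes, its value does not matter.
  refine ⟨fun x => 2 * f x - 1, (contDiff_const.mul f.contMDiff.contDiff).sub contDiff_const,
    fun x hx => ?_⟩
  rcases lt_trichotomy (normalVelocity Ω U x) 0 with h | h | h
  · have := hf0 (subset_closure (show x ∈ inflow Ω U from ⟨hx, h⟩))
    simp only [Pi.zero_apply] at this
    simp only [this, abs_of_neg h]
    ring
  · rw [h]
    simp
  · have := hf1 (subset_closure (show x ∈ outflow Ω U from ⟨hx, h⟩))
    simp only [Pi.one_apply] at this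
    simp only [this, abs_of_pos h]
    ring

end

/-! ### Abstract boundary value problems for transport operators -/

/-- An abstract graph space of a transport operator: a closed space of triples consisting of a
function, its transport derivative and its trace, with Green's formula. -/
structure GraphSpace (A B : Type*) [NormedAddCommGroup A] [InnerProductSpace ℝ A]
    [NormedAddCommGroup B] [InnerProductSpace ℝ B] where
  /-- the graph -/
  graph : Submodule ℝ (A × A × B)
  /-- multiplication by the divergence of the velocity -/
  div : A →L[ℝ] A
  /-- multiplication by the sign of the normal velocity -/
  sign : B →L[ℝ] B
  isClosed : IsClosed (graph : Set (A × A × B))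
  sign_sign : ∀ t, sign (sign t) = t
  inner_sign : ∀ s t, ⟪sign s, t⟫ = ⟪s, sign t⟫
  inner_div : ∀ v w, ⟪div v, w⟫ = ⟪v, div w⟫
  green : ∀ x ∈ graph, ∀ y ∈ graph, ⟪x.2.1, y.1⟫ + ⟪x.1, y.2.1⟫ + ⟪div x.1, y.1⟫ =
    ⟪sign x.2.2, y.2.2⟫
  -- Weak equals strong: a function whose transport derivative exists only by duality with elements
  -- of zero trace already belongs to the graph and has a trace.
  maximal : ∀ w f, (∀ x ∈ graph, x.2.2 = 0 → ⟪w, x.2.1 + div x.1⟫ = -⟪f, x.1⟫) →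
    ∃ t, (w, f, t) ∈ graph
  -- In the application this is multiplication by `½ (1 + χ)`, which keeps the outflow trace and
  -- removes the inflow trace.
  outflow : ∀ x ∈ graph, ∃ y ∈ graph, y.2.2 = (1 / 2 : ℝ) • (x.2.2 + sign x.2.2)

namespace GraphSpace

variable {A B : Type*} [NormedAddCommGroup A] [InnerProductSpace ℝ A]
  [NormedAddCommGroup B] [InnerProductSpace ℝ B] (G : GraphSpace A B)

/-- The bilinear form of the regularized inflow problem. -/
def form (ε : ℝ) (x y : A × A × B) : ℝ :=
  ⟪x.2.1 + ((1 / 2 : ℝ) • G.div x.1 + ε • x.1), y.1⟫ +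
    ⟪(1 / 2 : ℝ) • (x.2.2 - G.sign x.2.2), y.2.2⟫

/-- Green's formula turns the interior transport and divergence terms into `½ ⟪sign t, t⟫`, where
`t` is the trace; the inflow term `½ ⟪t - sign t, t⟫` completes this to `½ ‖t‖²`. This cancellation
is the reason for the coefficient `½ ΔU`. -/
theorem form_self (ε : ℝ) {x : A × A × B} (hx : x ∈ G.graph) :
    G.form ε x x = ε * ‖x.1‖ ^ 2 + 1 / 2 * ‖x.2.2‖ ^ 2 := by
  have h := G.green x hx x hx
  rw [real_inner_comm x.2.1 x.1] at h
  simp only [form, inner_add_left, inner_smul_left, inner_sub_left, real_inner_self_eq_norm_sq,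
    conj_trivial]
  linarith

theorem form_sub (ε : ℝ) (x x' y : A × A × B) :
    G.form ε (x - x') y = G.form ε x y - G.form ε x' y := by
  simp only [form, Prod.fst_sub, Prod.snd_sub, map_sub, inner_add_left, inner_smul_left,
    inner_sub_left, conj_trivial]
  ring

/-- The operator of the regularized inflow problem. -/
def op (ε : ℝ) : (A × A × B) →L[ℝ] WithLp 2 (A × B) :=
  (WithLp.prodContinuousLinearEquiv 2 ℝ A B).symm.toContinuousLinearMap.comp
    (((ContinuousLinearMap.fst ℝ A B).comp (ContinuousLinearMap.snd ℝ A (A × B)) +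
      ((1 / 2 : ℝ) • G.div + ε • ContinuousLinearMap.id ℝ A).comp
        (ContinuousLinearMap.fst ℝ A (A × B))).prod
      (((1 / 2 : ℝ) • (ContinuousLinearMap.id ℝ B - G.sign)).comp
        ((ContinuousLinearMap.snd ℝ A B).comp (ContinuousLinearMap.snd ℝ A (A × B)))))

theorem op_fst (ε : ℝ) (x : A × A × B) :
    (G.op ε x).fst = x.2.1 + ((1 / 2 : ℝ) • G.div x.1 + ε • x.1) := rfl

theorem op_snd (ε : ℝ) (x : A × A × B) :
    (G.op ε x).snd = (1 / 2 : ℝ) • (x.2.2 - G.sign x.2.2) := rfl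

/-- Coercivity bounds the function and its trace by `b N`, where `N` is the norm of the image and `b
= 2 / min ε (1/2)`. The transport derivative is then read off from the first component of the
operator. -/
theorem exists_le_op {ε : ℝ} (hε : 0 < ε) : ∃ K : NNReal, ∀ x ∈ G.graph, ‖x‖ ≤ K * ‖G.op ε x‖ := by
  set a := min ε (1 / 2) with ha
  have ha0 : 0 < a := lt_min hε (by norm_num)
  have ha1 : a ≤ ε := min_le_left _ _
  have ha2 : a ≤ 1 / 2 := min_le_right _ _
  set b : ℝ := 2 / a with hb
  have hb0 : 0 < b := by positivity
  have hK0 : 0 ≤ b + 1 + (1 / 2 * ‖G.div‖ + ε) * b := by positivity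
  refine ⟨Real.toNNReal (b + 1 + (1 / 2 * ‖G.div‖ + ε) * b), fun x hx => ?_⟩
  rw [Real.coe_toNNReal _ hK0]
  set N := ‖G.op ε x‖ with hN
  have hN0 : 0 ≤ N := norm_nonneg _
  have h1 : ‖(G.op ε x).fst‖ ≤ N := WithLp.norm_fst_le _ _
  have h2 : ‖(G.op ε x).snd‖ ≤ N := WithLp.norm_snd_le _ _
  have h3 := G.form_self ε hx
  have h4 : G.form ε x x ≤ N * ‖x.1‖ + N * ‖x.2.2‖ := by
    refine add_le_add ((real_inner_le_norm _ _).trans ?_) ((real_inner_le_norm _ _).trans ?_)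
    · exact mul_le_mul_of_nonneg_right h1 (norm_nonneg _)
    · exact mul_le_mul_of_nonneg_right h2 (norm_nonneg _)
  have h5 : a * (max ‖x.1‖ ‖x.2.2‖) ^ 2 ≤ 2 * N * max ‖x.1‖ ‖x.2.2‖ := by
    have hv := norm_nonneg x.1
    have ht := norm_nonneg x.2.2
    rcases le_total ‖x.1‖ ‖x.2.2‖ with h | h
    · rw [max_eq_right h]
      nlinarith [sq_nonneg ‖x.1‖, sq_nonneg ‖x.2.2‖]
    · rw [max_eq_left h]
      nlinarith [sq_nonneg ‖x.1‖, sq_nonneg ‖x.2.2‖]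
  have h6 : max ‖x.1‖ ‖x.2.2‖ ≤ b * N := by
    rcases (le_max_of_le_left (norm_nonneg x.1) : 0 ≤ max ‖x.1‖ ‖x.2.2‖).eq_or_lt with h | h
    · rw [← h]
      positivity
    · rw [hb, div_mul_eq_mul_div, le_div_iff₀ ha0]
      nlinarith
  have h7 : ‖x.1‖ ≤ b * N := (le_max_left _ _).trans h6
  have h8 : ‖x.2.2‖ ≤ b * N := (le_max_right _ _).trans h6
  have h9 : ‖x.2.1‖ ≤ N + (1 / 2 * ‖G.div‖ + ε) * (b * N) := by
    have h10 : x.2.1 = (G.op ε x).fst - ((1 / 2 : ℝ) • G.div x.1 + ε • x.1) := by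
      rw [op_fst, add_sub_cancel_right]
    rw [h10]
    refine (norm_sub_le _ _).trans (add_le_add h1 ((norm_add_le _ _).trans ?_))
    rw [norm_smul, norm_smul, Real.norm_of_nonneg hε.le, Real.norm_of_nonneg (by norm_num),
      add_mul, mul_assoc]
    have := G.div.le_opNorm x.1
    have h11 : ‖G.div‖ * ‖x.1‖ ≤ ‖G.div‖ * (b * N) := by gcongr
    nlinarith
  have hbN : 0 ≤ b * N := by positivity
  have hcN : 0 ≤ (1 / 2 * ‖G.div‖ + ε) * (b * N) := by positivity
  refine max_le ?_ (max_le ?_ ?_)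
  · linarith
  · linarith
  · linarith

theorem isClosed_map_op [CompleteSpace A] [CompleteSpace B] {ε : ℝ} (hε : 0 < ε) :
    IsClosed ((G.graph.map (G.op ε).toLinearMap : Submodule ℝ (WithLp 2 (A × B))) :
      Set (WithLp 2 (A × B))) := by
  obtain ⟨K, hK⟩ := G.exists_le_op hε
  have : CompleteSpace G.graph := G.isClosed.completeSpace_coe
  have h1 : AntilipschitzWith K ((G.op ε).comp G.graph.subtypeL) :=
    AddMonoidHomClass.antilipschitz_of_bound _ fun x => hK x x.2
  have h2 := h1.isClosed_range ((G.op ε).comp G.graph.subtypeL).uniformContinuous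
  have h3 : ((G.graph.map (G.op ε).toLinearMap : Submodule ℝ (WithLp 2 (A × B))) :
      Set (WithLp 2 (A × B))) = range ((G.op ε).comp G.graph.subtypeL) := by
    ext z
    exact ⟨fun ⟨x, hx, h⟩ => ⟨⟨x, hx⟩, h⟩, fun ⟨x, h⟩ => ⟨x, x.2, h⟩⟩
  rw [h3]
  exact h2

/-- Orthogonality against zero traces says that `w` solves the adjoint equation with derivative `f =
ε w - ½ div w`, so `maximal` provides a trace `t`. The remaining boundary identity yields `⟪sign t,
t⟫ = -‖t‖²`, while Green's formula for `w` with itself yields `⟪sign t, t⟫ = 2 ε ‖w‖²`. Hence `w =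
0`; the second component of `z` is left undetermined. -/
theorem eq_zero_of_orthogonal {ε : ℝ} (hε : 0 < ε) {z : WithLp 2 (A × B)}
    (hz : ∀ x ∈ G.graph, ⟪G.op ε x, z⟫ = 0) : z.fst = 0 := by
  set w := z.fst with hw
  set r := z.snd with hr
  have h0 : ∀ x ∈ G.graph, ⟪x.2.1 + ((1 / 2 : ℝ) • G.div x.1 + ε • x.1), w⟫ +
      ⟪(1 / 2 : ℝ) • (x.2.2 - G.sign x.2.2), r⟫ = 0 := fun x hx => by
    have := hz x hx
    rwa [WithLp.prod_inner_apply] at this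
  set f := ε • w - (1 / 2 : ℝ) • G.div w with hf
  have hself : ∀ v, ⟪v, G.div w⟫ = ⟪w, G.div v⟫ := fun v => by
    rw [← G.inner_div, real_inner_comm]
  obtain ⟨t, ht⟩ := G.maximal w f fun x hx hx0 => by
    have h1 := h0 x hx
    rw [hx0] at h1
    simp only [map_zero, sub_zero, smul_zero, inner_zero_left, add_zero, inner_add_left,
      inner_smul_left, conj_trivial] at h1
    have h2 := hself x.1
    have h3 := G.inner_div x.1 w
    rw [hf]
    simp only [inner_add_right, inner_sub_left, inner_smul_left, conj_trivial]
    rw [real_inner_comm x.2.1 w, G.inner_div w x.1, real_inner_comm x.1 w]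
    linarith
  have h1 : ∀ x ∈ G.graph, ⟪G.sign x.2.2, t⟫ +
      ⟪(1 / 2 : ℝ) • (x.2.2 - G.sign x.2.2), r⟫ = 0 := fun x hx => by
    rw [← h0 x hx, ← G.green x hx _ ht, hf]
    have h3 := G.inner_div x.1 w
    simp only [inner_add_left, inner_sub_right, inner_smul_left, inner_smul_right, conj_trivial]
    linarith
  -- The trace of `y` is fixed by `sign`, so the term containing `r` vanishes.
  obtain ⟨y, hy, hyt⟩ := G.outflow _ ht
  have h2 := h1 y hy
  have h3 := G.form_self ε ht
  have h4 := G.green _ ht _ ht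
  simp only at hyt h4
  rw [hyt] at h2
  simp only [map_add, map_smul, G.sign_sign] at h2
  have h5 : (1 / 2 : ℝ) • (t + G.sign t) - (1 / 2 : ℝ) • (G.sign t + t) = 0 := by
    rw [add_comm, sub_self]
  rw [h5] at h2
  simp only [smul_zero, inner_zero_left, add_zero, inner_smul_left, inner_add_left,
    conj_trivial, real_inner_self_eq_norm_sq] at h2
  rw [hf, G.inner_div] at h4
  simp only [inner_sub_left, inner_sub_right, inner_smul_left, inner_smul_right, conj_trivial,
    real_inner_self_eq_norm_sq] at h4
  rw [G.inner_div] at h4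
  have h6 : ε * ‖w‖ ^ 2 ≤ 0 := by nlinarith [sq_nonneg ‖t‖]
  have h7 : ‖w‖ ^ 2 ≤ 0 := by
    by_contra h
    push Not at h
    nlinarith [mul_pos hε h]
  have h8 : ‖w‖ = 0 := pow_eq_zero_iff (two_ne_zero) |>.1 (le_antisymm h7 (sq_nonneg _))
  exact norm_eq_zero.1 h8

/-- The regularized inflow problem is uniquely solvable. -/
theorem exists_form_eq [CompleteSpace A] [CompleteSpace B] {ε : ℝ} (hε : 0 < ε)
    (t : B) :
    ∃ x ∈ G.graph, ∀ y ∈ G.graph,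
      G.form ε x y = ⟪(1 / 2 : ℝ) • (t - G.sign t), y.2.2⟫ := by
  set M := G.graph.map (G.op ε).toLinearMap with hM
  have : CompleteSpace M := (G.isClosed_map_op hε).completeSpace_coe
  set γ : WithLp 2 (A × B) := WithLp.toLp 2 (0, (1 / 2 : ℝ) • (t - G.sign t)) with hγ
  -- The solution is a preimage of the orthogonal projection of the data onto the closed range. The
  -- residual `z` has first component zero, so the equation holds exactly in the interior.
  obtain ⟨x, hx, hxγ⟩ := Submodule.mem_map.1 (M.starProjection_apply_mem γ)
  set z := γ - M.starProjection γ with hz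
  have hzo : ∀ y ∈ G.graph, ⟪G.op ε y, z⟫ = 0 := fun y hy =>
    (M.mem_orthogonal z).1 (M.sub_starProjection_mem_orthogonal γ) _
      (Submodule.mem_map_of_mem hy)
  have hw := G.eq_zero_of_orthogonal hε hzo
  have hxz : G.op ε x = γ - z := by
    rw [hz, sub_sub_cancel]
    exact hxγ
  have h1 : x.2.1 + ((1 / 2 : ℝ) • G.div x.1 + ε • x.1) = 0 := by
    rw [← op_fst, hxz, WithLp.sub_fst, hw, sub_zero]
    rfl
  have h2 : (1 / 2 : ℝ) • (x.2.2 - G.sign x.2.2) = (1 / 2 : ℝ) • (t - G.sign t) - z.snd := by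
    rw [← op_snd, hxz, WithLp.sub_snd]
    rfl
  -- The boundary residual is supported on the inflow part. Orthogonality to the range then becomes
  -- orthogonality to all traces, which is what the weak formulation requires.
  have h3 : G.sign z.snd = -z.snd := by
    have h4 : z.snd = (1 / 2 : ℝ) • (t - G.sign t) - (1 / 2 : ℝ) • (x.2.2 - G.sign x.2.2) := by
      rw [h2, sub_sub_cancel]
    rw [h4]
    simp only [map_sub, map_smul, G.sign_sign]
    module
  refine ⟨x, hx, fun y hy => ?_⟩
  have h5 : ⟪(G.op ε y).fst, z.fst⟫ + ⟪(G.op ε y).snd, z.snd⟫ = 0 := by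
    have := hzo y hy
    rwa [WithLp.prod_inner_apply] at this
  rw [op_snd, hw] at h5
  simp only [inner_zero_right, zero_add, inner_smul_left, inner_sub_left, conj_trivial,
    G.inner_sign, h3, inner_neg_right] at h5
  rw [form, h1, h2, inner_zero_left, zero_add, inner_sub_left, real_inner_comm y.2.2 z.snd]
  linarith

theorem eq_of_form_eq {ε : ℝ} (hε : 0 < ε) {x x' : A × A × B} (hx : x ∈ G.graph)
    (hx' : x' ∈ G.graph) (h : ∀ y ∈ G.graph, G.form ε x y = G.form ε x' y) : x.1 = x'.1 := by
  have h1 := G.form_self ε (G.graph.sub_mem hx hx')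
  rw [form_sub, h _ (G.graph.sub_mem hx hx'), sub_self] at h1
  by_contra hne
  have h2 : 0 < ‖(x - x').1‖ := norm_pos_iff.2 (sub_ne_zero.2 hne)
  have h3 : 0 < ε * ‖(x - x').1‖ ^ 2 := by positivity
  nlinarith [sq_nonneg ‖(x - x').2.2‖]

end GraphSpace

/-! ### Multiplication operators on `L²` -/

section

variable {α : Type*} [MeasurableSpace α] {μ : Measure α}

theorem inner_eq_integral {f g : Lp ℝ 2 μ} {φ ψ : α → ℝ} (hf : f =ᵐ[μ] φ) (hg : g =ᵐ[μ] ψ) :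
    ⟪f, g⟫ = ∫ x, φ x * ψ x ∂μ := by
  rw [L2.inner_def]
  refine integral_congr_ae ?_
  filter_upwards [hf, hg] with x h1 h2
  rw [h1, h2]
  exact mul_comm _ _

/-- Multiplication by a bounded function. -/
def mulL {m : α → ℝ} (hm : MemLp m ⊤ μ) : Lp ℝ 2 μ →L[ℝ] Lp ℝ 2 μ :=
  (ContinuousLinearMap.mul ℝ ℝ).holderL μ ⊤ 2 2 (hm.toLp m)

theorem mulL_ae_eq {m : α → ℝ} (hm : MemLp m ⊤ μ) {f : Lp ℝ 2 μ} {φ : α → ℝ} (hf : f =ᵐ[μ] φ) :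
    mulL hm f =ᵐ[μ] fun x => m x * φ x := by
  have h := (ContinuousLinearMap.mul ℝ ℝ).coeFn_holder (r := 2) (hm.toLp m) f
  filter_upwards [h, hm.coeFn_toLp, hf] with x h1 h2 h3
  rw [← h2, ← h3]
  exact h1

theorem inner_mulL {m : α → ℝ} (hm : MemLp m ⊤ μ) (f g : Lp ℝ 2 μ) :
    ⟪mulL hm f, g⟫ = ⟪f, mulL hm g⟫ := by
  rw [inner_eq_integral (mulL_ae_eq hm (EventuallyEq.refl _ f)) (EventuallyEq.refl _ g),
    inner_eq_integral (EventuallyEq.refl _ f) (mulL_ae_eq hm (EventuallyEq.refl _ g))]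
  refine integral_congr_ae (Eventually.of_forall fun x => ?_)
  simp only
  ring

end

/-! ### The graph of the transport operator -/

section

variable {Ω : Set (E n)} {U : E n → ℝ}

variable (Ω U) in
/-- Triples in `L²(Ω) × L²(Ω) × L²(|β · ν|; Γ)`. -/
abbrev Triple : Type := Lp ℝ 2 (volume.restrict Ω) × Lp ℝ 2 (volume.restrict Ω) ×
  Lp ℝ 2 (weightedSurface Ω U)

variable (Ω U) in
/-- Triples consisting of a smooth function, its transport derivative and its boundary values. -/
def smoothGraph : Submodule ℝ (Triple Ω U) where
  carrier := {x | ∃ φ : E n → ℝ, ContDiff ℝ ∞ φ ∧ x.1 =ᵐ[volume.restrict Ω] φ ∧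
    x.2.1 =ᵐ[volume.restrict Ω] (fun y => ⟪velocity Ω U y, gradient φ y⟫) ∧
    x.2.2 =ᵐ[weightedSurface Ω U] φ}
  add_mem' := by
    rintro x y ⟨φ, hφ, h1, h2, h3⟩ ⟨ψ, hψ, h4, h5, h6⟩
    refine ⟨fun z => φ z + ψ z, hφ.add hψ, ?_, ?_, ?_⟩
    · filter_upwards [Lp.coeFn_add x.1 y.1, h1, h4] with z h h' h''
      rw [Prod.fst_add, h, Pi.add_apply, h', h'']
    · filter_upwards [Lp.coeFn_add x.2.1 y.2.1, h2, h5] with z h h' h''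
      rw [Prod.snd_add, Prod.fst_add, h, Pi.add_apply, h', h'']
      simp only [inner_gradient]
      rw [fderiv_fun_add (hφ.differentiable (by simp) z) (hψ.differentiable (by simp) z)]
      rfl
    · filter_upwards [Lp.coeFn_add x.2.2 y.2.2, h3, h6] with z h h' h''
      rw [Prod.snd_add, Prod.snd_add, h, Pi.add_apply, h', h'']
  zero_mem' := by
    refine ⟨fun _ => 0, contDiff_const, Lp.coeFn_zero _ _ _, ?_, Lp.coeFn_zero _ _ _⟩
    filter_upwards [Lp.coeFn_zero ℝ 2 (volume.restrict Ω)] with y hy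
    rw [inner_gradient]
    simpa using hy
  smul_mem' := by
    rintro c x ⟨φ, hφ, h1, h2, h3⟩
    refine ⟨fun z => c * φ z, contDiff_const.mul hφ, ?_, ?_, ?_⟩
    · filter_upwards [Lp.coeFn_smul c x.1, h1] with z h h'
      rw [Prod.smul_fst, h, Pi.smul_apply, h', smul_eq_mul]
    · filter_upwards [Lp.coeFn_smul c x.2.1, h2] with z h h'
      rw [Prod.smul_snd, Prod.smul_fst, h, Pi.smul_apply, h']
      simp only [inner_gradient]
      rw [fderiv_const_mul (hφ.differentiable (by simp) z)]
      rfl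
    · filter_upwards [Lp.coeFn_smul c x.2.2, h3] with z h h'
      rw [Prod.smul_snd, Prod.smul_snd, h, Pi.smul_apply, h', smul_eq_mul]

variable (Ω U) in
/-- The graph of the transport operator together with the traces. -/
def closedGraph : Submodule ℝ (Triple Ω U) := (smoothGraph Ω U).topologicalClosure

/-! ### Green's formula, trace bound and density in the closed graph -/

theorem memLp_of_contDiff (hΩ : IsC6Domain Ω) {φ : E n → ℝ} (hφ : ContDiff ℝ ∞ φ) :
    MemLp φ 2 (volume.restrict Ω) ∧
      MemLp (fun y => ⟪velocity Ω U y, gradient φ y⟫) 2 (volume.restrict Ω) ∧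
      MemLp φ 2 (weightedSurface Ω U) :=
  ⟨hΩ.memLp_of_continuousOn hφ.continuous.continuousOn,
    contDiff_memLp_gradient hΩ (hφ.of_le (by exact_mod_cast le_top)),
    memLp_weightedSurface_of_continuousOn hΩ U hφ.continuous.continuousOn⟩

theorem toLp_mem_smoothGraph {φ : E n → ℝ} (hφ : ContDiff ℝ ∞ φ)
    (h1 : MemLp φ 2 (volume.restrict Ω))
    (h2 : MemLp (fun y => ⟪velocity Ω U y, gradient φ y⟫) 2 (volume.restrict Ω))
    (h3 : MemLp φ 2 (weightedSurface Ω U)) :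
    (h1.toLp φ, h2.toLp _, h3.toLp φ) ∈ smoothGraph Ω U :=
  ⟨φ, hφ, h1.coeFn_toLp, h2.coeFn_toLp, h3.coeFn_toLp⟩

theorem IsTest.toLp_mem_smoothGraph (hΩ : IsC6Domain Ω) {φ : E n → ℝ} (hφ : IsTest Ω φ)
    (h1 : MemLp φ 2 (volume.restrict Ω))
    (h2 : MemLp (fun y => ⟪velocity Ω U y, gradient φ y⟫) 2 (volume.restrict Ω)) :
    (h1.toLp φ, h2.toLp _, 0) ∈ smoothGraph Ω U := by
  refine ⟨φ, hφ.1, h1.coeFn_toLp, h2.coeFn_toLp, ?_⟩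
  filter_upwards [Lp.coeFn_zero ℝ 2 (weightedSurface Ω U), ae_weightedSurface_mem_frontier Ω U]
    with y h3 h4
  rw [hΩ.isOpen.frontier_eq] at h4
  rw [h3, Pi.zero_apply]
  exact (image_eq_zero_of_notMem_tsupport fun h => h4.2 (hφ.2.2 h)).symm

theorem memLp_lap_top (hn : n ≤ 3) (hΩ : IsC6Domain Ω) (hU : MemSobolev Ω 2 5 U) :
    MemLp (lap Ω U) ⊤ (volume.restrict Ω) := by
  obtain ⟨M, hM⟩ := exists_bound_lap hn hΩ hU
  exact memLp_top_of_bound (memLp_lap hΩ hU).1 M hM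

variable {χ : E n → ℝ}

/-- For smooth `φ` and `ψ` this is Green's formula for `β` tested with `φ ψ`, where `χ` converts
`|β·ν|` into `β·ν`. Both sides are continuous in each triple, so the identity passes to the closure
one variable at a time. -/
theorem green_closedGraph (hn : n ≤ 3) (hΩ : IsC6Domain Ω) (hU : MemSobolev Ω 2 5 U)
    (hl : MemLp (lap Ω U) ⊤ (volume.restrict Ω)) (hχW : MemLp χ ⊤ (weightedSurface Ω U))
    (hχ : ∀ x ∈ frontier Ω, |normalVelocity Ω U x| * χ x = normalVelocity Ω U x)
    {x y : Triple Ω U} (hx : x ∈ closedGraph Ω U) (hy : y ∈ closedGraph Ω U) :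
    ⟪x.2.1, y.1⟫ + ⟪x.1, y.2.1⟫ + ⟪mulL hl x.1, y.1⟫ = ⟪mulL hχW x.2.2, y.2.2⟫ := by
  have h0 : ∀ x ∈ smoothGraph Ω U, ∀ y ∈ smoothGraph Ω U,
      ⟪x.2.1, y.1⟫ + ⟪x.1, y.2.1⟫ + ⟪mulL hl x.1, y.1⟫ = ⟪mulL hχW x.2.2, y.2.2⟫ := by
    rintro x ⟨φ, hφ, h1, h2, h3⟩ y ⟨ψ, hψ, h4, h5, h6⟩
    obtain ⟨m1, m2, -⟩ := memLp_of_contDiff (U := U) hΩ hφ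
    obtain ⟨m4, m5, -⟩ := memLp_of_contDiff (U := U) hΩ hψ
    have i1 : Integrable (fun y => ⟪velocity Ω U y, gradient φ y⟫ * ψ y) (volume.restrict Ω) :=
      m2.integrable_mul m4
    have i2 : Integrable (fun y => φ y * ⟪velocity Ω U y, gradient ψ y⟫) (volume.restrict Ω) :=
      m1.integrable_mul m5
    have i3 : Integrable (fun y => lap Ω U y * φ y * ψ y) (volume.restrict Ω) := by
      have := (memLp_lap hΩ hU).integrable_mul
        (hΩ.memLp_of_continuousOn (p := 2) (hφ.continuous.mul hψ.continuous).continuousOn)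
      refine this.congr (Eventually.of_forall fun y => ?_)
      simp only [Pi.mul_apply]
      ring
    have i4 : Integrable (fun y => ⟪velocity Ω U y, gradient φ y⟫ * ψ y +
        φ y * ⟪velocity Ω U y, gradient ψ y⟫) (volume.restrict Ω) := i1.add i2
    rw [inner_eq_integral h2 h4, inner_eq_integral h1 h5,
      inner_eq_integral (mulL_ae_eq hl h1) h4, inner_eq_integral (mulL_ae_eq hχW h3) h6,
      integral_weightedSurface hΩ, ← integral_add i1 i2, ← integral_add i4 i3]
    have h7 := integral_velocity_eq hn hΩ hU (φ := fun y => φ y * ψ y)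
      ((hφ.mul hψ).of_le (by exact_mod_cast le_top))
    calc _ = ∫ y in Ω, (⟪velocity Ω U y, gradient (fun y => φ y * ψ y) y⟫ +
          lap Ω U y * (φ y * ψ y)) := by
          refine integral_congr_ae (Eventually.of_forall fun y => ?_)
          simp only [inner_gradient]
          rw [fderiv_fun_mul (hφ.differentiable (by simp) y) (hψ.differentiable (by simp) y)]
          simp
          ring
      _ = _ := by
          rw [h7]
          refine integral_congr_ae ?_
          filter_upwards [ae_surface_mem_frontier Ω] with y hy
          linear_combination -(φ y * ψ y) * hχ y hy
  have h1 : ∀ x ∈ closedGraph Ω U, ∀ y ∈ smoothGraph Ω U,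
      ⟪x.2.1, y.1⟫ + ⟪x.1, y.2.1⟫ + ⟪mulL hl x.1, y.1⟫ = ⟪mulL hχW x.2.2, y.2.2⟫ :=
    fun x hx y hy => closure_minimal (s := (smoothGraph Ω U : Set (Triple Ω U)))
      (t := {x : Triple Ω U | ⟪x.2.1, y.1⟫ + ⟪x.1, y.2.1⟫ + ⟪mulL hl x.1, y.1⟫ = ⟪mulL hχW x.2.2,
        y.2.2⟫})
      (fun x hx => h0 x hx y hy) (isClosed_eq (by fun_prop) (by fun_prop)) hx
  exact closure_minimal (s := (smoothGraph Ω U : Set (Triple Ω U)))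
    (t := {y : Triple Ω U | ⟪x.2.1, y.1⟫ + ⟪x.1, y.2.1⟫ + ⟪mulL hl x.1, y.1⟫ = ⟪mulL hχW x.2.2,
      y.2.2⟫})
    (fun y hy => h1 x hx y hy) (isClosed_eq (by fun_prop) (by fun_prop)) hy

theorem mul_mem_closedGraph (hχs : ContDiff ℝ ∞ χ) (hχ : MemLp χ ⊤ (volume.restrict Ω))
    (hχ' : MemLp (fun y => ⟪velocity Ω U y, gradient χ y⟫) ⊤ (volume.restrict Ω))
    (hχW : MemLp χ ⊤ (weightedSurface Ω U))
    {x : Triple Ω U} (hx : x ∈ closedGraph Ω U) :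
    (mulL hχ x.1, mulL hχ x.2.1 + mulL hχ' x.1, mulL hχW x.2.2) ∈ closedGraph Ω U := by
  refine map_mem_closure (f := fun x : Triple Ω U =>
    (mulL hχ x.1, mulL hχ x.2.1 + mulL hχ' x.1, mulL hχW x.2.2))
    (by fun_prop) hx ?_
  rintro x ⟨φ, hφ, h1, h2, h3⟩
  refine ⟨fun y => χ y * φ y, hχs.mul hφ, mulL_ae_eq hχ h1, ?_, mulL_ae_eq hχW h3⟩
  filter_upwards [Lp.coeFn_add (mulL hχ x.2.1) (mulL hχ' x.1), mulL_ae_eq hχ h2,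
    mulL_ae_eq hχ' h1] with y h4 h5 h6
  rw [h4, Pi.add_apply, h5, h6]
  simp only [inner_gradient]
  rw [fderiv_fun_mul (hχs.differentiable (by simp) y) (hφ.differentiable (by simp) y)]
  simp
  ring

/-- The weighted measure does not charge the zeros of the normal velocity, and elsewhere on the
boundary `|χ| = 1`. -/
theorem mulL_mulL_sign (hΩ : IsC6Domain Ω) (hχW : MemLp χ ⊤ (weightedSurface Ω U))
    (hχ : ∀ x ∈ frontier Ω, |normalVelocity Ω U x| * χ x = normalVelocity Ω U x)
    (t : Lp ℝ 2 (weightedSurface Ω U)) : mulL hχW (mulL hχW t) = t := by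
  refine Lp.ext ?_
  filter_upwards [mulL_ae_eq hχW (mulL_ae_eq hχW (EventuallyEq.refl _ t)),
    ae_weightedSurface_mem_frontier Ω U, ae_weightedSurface_ne_zero hΩ U] with y h1 h2 h3
  have h4 := congrArg abs (hχ y h2)
  rw [abs_mul, abs_abs] at h4
  have h5 : |χ y| = 1 := mul_left_cancel₀ (abs_ne_zero.2 h3) (h4.trans (mul_one _).symm)
  have h6 : χ y * χ y = 1 := by rw [← abs_mul_abs_self, h5, one_mul]
  rw [h1, ← mul_assoc, h6, one_mul]

/-- The trace is controlled by the graph norm. -/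
theorem exists_trace_bound (hn : n ≤ 3) (hΩ : IsC6Domain Ω) (hU : MemSobolev Ω 2 5 U)
    (hχs : ContDiff ℝ ∞ χ)
    (hχ : ∀ x ∈ frontier Ω, |normalVelocity Ω U x| * χ x = normalVelocity Ω U x) :
    ∃ K : ℝ, 0 ≤ K ∧ ∀ x ∈ closedGraph Ω U, ‖x.2.2‖ ≤ K * (‖x.1‖ + ‖x.2.1‖) := by
  have hl := memLp_lap_top hn hΩ hU
  have m1 : MemLp χ ⊤ (volume.restrict Ω) :=
    hΩ.memLp_of_continuousOn hχs.continuous.continuousOn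
  have m2 : MemLp (fun y => ⟪velocity Ω U y, gradient χ y⟫) ⊤ (volume.restrict Ω) := by
    simp only [inner_gradient]
    exact hΩ.memLp_of_continuousOn ((hχs.continuous_fderiv (by simp)).continuousOn.clm_apply
      (continuousOn_velocity Ω U))
  have m3 : MemLp χ ⊤ (weightedSurface Ω U) :=
    memLp_weightedSurface_of_continuousOn hΩ U hχs.continuous.continuousOn
  set K₀ := 2 * ‖mulL m1‖ + ‖mulL m2‖ + ‖mulL hl‖ * ‖mulL m1‖ with hK₀
  have hK₀0 : 0 ≤ K₀ := by positivity
  refine ⟨√K₀, Real.sqrt_nonneg _, fun x hx => ?_⟩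
  -- Green's formula is applied to `v` and `χ v`: the boundary term is `⟪χ t, χ t⟫ = ‖t‖²`, and all
  -- others are bounded by the graph norm.
  have h := green_closedGraph hn hΩ hU hl m3 hχ hx (mul_mem_closedGraph hχs m1 m2 m3 hx)
  simp only at h
  rw [inner_mulL m3, mulL_mulL_sign hΩ m3 hχ, real_inner_self_eq_norm_sq] at h
  have b1 := (real_inner_le_norm x.2.1 (mulL m1 x.1)).trans
    (mul_le_mul_of_nonneg_left ((mulL m1).le_opNorm x.1) (norm_nonneg _))
  have b2 := (real_inner_le_norm x.1 (mulL m1 x.2.1 + mulL m2 x.1)).trans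
    (mul_le_mul_of_nonneg_left ((norm_add_le _ _).trans (add_le_add ((mulL m1).le_opNorm x.2.1)
      ((mulL m2).le_opNorm x.1))) (norm_nonneg _))
  have b3 := (real_inner_le_norm (mulL hl x.1) (mulL m1 x.1)).trans
    (mul_le_mul ((mulL hl).le_opNorm x.1) ((mulL m1).le_opNorm x.1) (norm_nonneg _)
      (by positivity))
  have h1 : ‖x.2.2‖ ^ 2 ≤ K₀ * (‖x.1‖ + ‖x.2.1‖) ^ 2 := by
    rw [← h]
    have p1 : 0 ≤ ‖mulL m1‖ * (‖x.1‖ ^ 2 + ‖x.2.1‖ ^ 2 + ‖x.1‖ * ‖x.2.1‖) := by positivity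
    have p2 : 0 ≤ (‖mulL m2‖ + ‖mulL hl‖ * ‖mulL m1‖) *
        (‖x.2.1‖ ^ 2 + 2 * (‖x.1‖ * ‖x.2.1‖)) := by positivity
    have p3 : 0 ≤ ‖mulL m1‖ * (‖x.1‖ ^ 2 + ‖x.2.1‖ ^ 2 + 2 * (‖x.1‖ * ‖x.2.1‖)) := by positivity
    rw [hK₀]
    linarith
  refine abs_le_of_sq_le_sq' ?_ (by positivity) |>.2
  rwa [mul_pow, Real.sq_sqrt hK₀0]

/-- Test functions are elements of the graph with zero trace, so the duality condition contains the
distributional one. -/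
theorem hasTransportDeriv_of_forall_inner (hΩ : IsC6Domain Ω) 
    (hl : MemLp (lap Ω U) ⊤ (volume.restrict Ω)) {v f : Lp ℝ 2 (volume.restrict Ω)}
    (h : ∀ x ∈ closedGraph Ω U, x.2.2 = 0 → ⟪v, x.2.1 + mulL hl x.1⟫ = -⟪f, x.1⟫) :
    HasTransportDeriv Ω U v f := by
  intro φ hφ
  obtain ⟨m1, m2, -⟩ := memLp_of_contDiff (U := U) hΩ hφ.1
  have h1 := h _ (subset_closure (hφ.toLp_mem_smoothGraph hΩ m1 m2)) rfl
  have h2 : m2.toLp _ + mulL hl (m1.toLp φ) =ᵐ[volume.restrict Ω]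
      fun y => ⟪velocity Ω U y, gradient φ y⟫ + lap Ω U y * φ y := by
    filter_upwards [Lp.coeFn_add (m2.toLp _) (mulL hl (m1.toLp φ)), m2.coeFn_toLp,
      mulL_ae_eq hl m1.coeFn_toLp] with y h3 h4 h5
    rw [h3, Pi.add_apply, h4, h5]
  simp only at h1
  rw [inner_eq_integral (EventuallyEq.refl _ f) m1.coeFn_toLp,
    inner_eq_integral (EventuallyEq.refl _ v) h2] at h1
  rw [h1, neg_neg]

theorem hasTransportDeriv_of_mem (hn : n ≤ 3) (hΩ : IsC6Domain Ω) (hU : MemSobolev Ω 2 5 U)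
    (hχs : ContDiff ℝ ∞ χ)
    (hχ : ∀ x ∈ frontier Ω, |normalVelocity Ω U x| * χ x = normalVelocity Ω U x)
    {x : Triple Ω U} (hx : x ∈ closedGraph Ω U) :
    HasTransportDeriv Ω U x.1 x.2.1 := by
  have hl := memLp_lap_top hn hΩ hU
  have m3 : MemLp χ ⊤ (weightedSurface Ω U) :=
    memLp_weightedSurface_of_continuousOn hΩ U hχs.continuous.continuousOn
  refine hasTransportDeriv_of_forall_inner hΩ hl fun y hy hy0 => ?_
  have h := green_closedGraph hn hΩ hU hl m3 hχ hx hy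
  rw [hy0, inner_zero_right, inner_mulL] at h
  rw [inner_add_right]
  linarith

theorem HasTransportDeriv.ae_eq (hΩ : IsC6Domain Ω) {v v' f f' : E n → ℝ}
    (hf : MemLp f 2 (volume.restrict Ω)) (hf' : MemLp f' 2 (volume.restrict Ω))
    (hv : v =ᵐ[volume.restrict Ω] v')
    (h : HasTransportDeriv Ω U v f) (h' : HasTransportDeriv Ω U v' f') :
    f =ᵐ[volume.restrict Ω] f' := by
  have := hΩ.isFiniteMeasure_restrict
  have hloc : ∀ {f : E n → ℝ}, MemLp f 2 (volume.restrict Ω) → LocallyIntegrableOn f Ω :=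
    fun hf => IntegrableOn.locallyIntegrableOn (hf.integrable (by norm_num))
  refine ae_eq_of_integral_test hΩ.isOpen (hloc hf) (hloc hf') fun φ hφ => ?_
  rw [h φ hφ, h' φ hφ]
  congr 1
  refine integral_congr_ae ?_
  filter_upwards [hv] with y hy
  rw [hy]

/-- Every function of the graph space has a trace. -/
theorem exists_mem_closedGraph (hn : n ≤ 3) (hΩ : IsC6Domain Ω) (hU : MemSobolev Ω 2 5 U)
    (hχs : ContDiff ℝ ∞ χ)
    (hχ : ∀ x ∈ frontier Ω, |normalVelocity Ω U x| * χ x = normalVelocity Ω U x)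
    {v f : E n → ℝ} (hv : MemLp v 2 (volume.restrict Ω)) (hf : MemLp f 2 (volume.restrict Ω))
    (h : HasTransportDeriv Ω U v f) :
    ∃ t, (hv.toLp v, hf.toLp f, t) ∈ closedGraph Ω U := by
  have hfin := hΩ.isFiniteMeasure_restrict
  obtain ⟨S⟩ := hΩ.nonempty_smoothingSystem
  obtain ⟨K, hK0, hK⟩ := exists_trace_bound hn hΩ hU hχs hχ
  have hvi : IntegrableOn v Ω := hv.integrable (by norm_num)
  set τ : ℕ → ℝ := fun k => 1 / ((k : ℝ) + 1) with hτ
  have hτ0 : ∀ k, 0 < τ k := fun k => by positivity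
  have hτlim : Tendsto τ atTop (𝓝[>] 0) :=
    tendsto_nhdsWithin_iff.2 ⟨tendsto_one_div_add_atTop_nhds_zero_nat,
      Eventually.of_forall fun k => hτ0 k⟩
  have hs : ∀ k, ContDiff ℝ ∞ (S.smooth (τ k) v) := fun k =>
    S.contDiff_smooth hΩ.isOpen (hτ0 k) hvi
  choose m1 m2 m3 using fun k => memLp_of_contDiff (U := U) hΩ (hs k)
  have l1 : Tendsto (fun k => (m1 k).toLp _) atTop (𝓝 (hv.toLp v)) :=
    (Lp.tendsto_Lp_iff_tendsto_eLpNorm'' _ m1 _ hv).2 ((S.tendsto_smooth hΩ hv).comp hτlim)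
  have l2 : Tendsto (fun k => (m2 k).toLp _) atTop (𝓝 (hf.toLp f)) :=
    (Lp.tendsto_Lp_iff_tendsto_eLpNorm'' _ m2 _ hf).2
      ((S.tendsto_transport hn hΩ hU hv hf h).comp hτlim)
  have hmem : ∀ k, ((m1 k).toLp _, (m2 k).toLp _, (m3 k).toLp _) ∈ closedGraph Ω U := fun k =>
    subset_closure (toLp_mem_smoothGraph (hs k) (m1 k) (m2 k) (m3 k))
  -- The trace bound applied to differences of smoothings transfers the Cauchy property from the
  -- function and its transport derivative to the boundary values.
  have hcauchy : CauchySeq fun k => (m3 k).toLp (S.smooth (τ k) v) := by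
    rw [Metric.cauchySeq_iff]
    intro ε hε
    have hε' : 0 < ε / (2 * (K + 1)) := by positivity
    obtain ⟨N1, H1⟩ := Metric.cauchySeq_iff.1 l1.cauchySeq _ hε'
    obtain ⟨N2, H2⟩ := Metric.cauchySeq_iff.1 l2.cauchySeq _ hε'
    refine ⟨max N1 N2, fun k hk l hl => ?_⟩
    have h1 := H1 k (le_of_max_le_left hk) l (le_of_max_le_left hl)
    have h2 := H2 k (le_of_max_le_right hk) l (le_of_max_le_right hl)
    have h3 := hK _ ((closedGraph Ω U).sub_mem (hmem k) (hmem l))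
    simp only [Prod.mk_sub_mk] at h3
    rw [dist_eq_norm] at *
    refine h3.trans_lt ?_
    have h4 : K * (‖(m1 k).toLp _ - (m1 l).toLp _‖ + ‖(m2 k).toLp _ - (m2 l).toLp _‖) ≤
        K * (ε / (2 * (K + 1)) + ε / (2 * (K + 1))) := by gcongr
    refine h4.trans_lt ?_
    have h5 : ε / (2 * (K + 1)) + ε / (2 * (K + 1)) = ε / (K + 1) := by
      field_simp
      norm_num
    rw [h5, mul_div_assoc', div_lt_iff₀ (by positivity)]
    nlinarith
  obtain ⟨t, ht⟩ := cauchySeq_tendsto_of_complete hcauchy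
  exact ⟨t, (smoothGraph Ω U).isClosed_topologicalClosure.mem_of_tendsto
    (l1.prodMk_nhds (l2.prodMk_nhds ht)) (Eventually.of_forall hmem)⟩

end

/-! ### Traces and weak solutions -/

section

variable {Ω : Set (E n)} {U χ : E n → ℝ}

theorem MemGraph.transportDeriv_spec {v : E n → ℝ} (hv : MemGraph Ω U v) :
    MemLp (transportDeriv Ω U v) 2 (volume.restrict Ω) ∧
      HasTransportDeriv Ω U v (transportDeriv Ω U v) := by
  rw [transportDeriv, dif_pos hv.2]
  exact hv.2.choose_spec

/-- A sequence in the definition of the trace is precisely a sequence in `smoothGraph` converging to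
the triple, which turns questions about traces into membership in a closed subspace. -/
theorem isTrace_iff (hΩ : IsC6Domain Ω) {v t : E n → ℝ} (hv : MemGraph Ω U v)
    (ht : MemLp t 2 (weightedSurface Ω U)) : IsTrace Ω U v t ↔
      (hv.1.toLp v, hv.transportDeriv_spec.1.toLp _, ht.toLp t) ∈ closedGraph Ω U := by
  constructor
  · rintro ⟨-, φ, hφ, l1, l2, l3⟩
    choose m1 m2 m3 using fun k => memLp_of_contDiff (U := U) hΩ (hφ k)
    exact (smoothGraph Ω U).isClosed_topologicalClosure.mem_of_tendsto
      (((Lp.tendsto_Lp_iff_tendsto_eLpNorm'' _ m1 _ hv.1).2 l1).prodMk_nhds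
        (((Lp.tendsto_Lp_iff_tendsto_eLpNorm'' _ m2 _ hv.transportDeriv_spec.1).2 l2).prodMk_nhds
          ((Lp.tendsto_Lp_iff_tendsto_eLpNorm'' _ m3 _ ht).2 l3)))
      (Eventually.of_forall fun k =>
        subset_closure (toLp_mem_smoothGraph (hφ k) (m1 k) (m2 k) (m3 k)))
  · intro h
    obtain ⟨x, hx, hlim⟩ := mem_closure_iff_seq_limit.1 h
    choose φ hφ e1 e2 e3 using hx
    choose m1 m2 m3 using fun k => memLp_of_contDiff (U := U) hΩ (hφ k)
    have hxk : ∀ k, x k = ((m1 k).toLp _, (m2 k).toLp _, (m3 k).toLp _) := fun k =>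
      Prod.ext (Lp.ext ((e1 k).trans (m1 k).coeFn_toLp.symm))
        (Prod.ext (Lp.ext ((e2 k).trans (m2 k).coeFn_toLp.symm))
          (Lp.ext ((e3 k).trans (m3 k).coeFn_toLp.symm)))
    rw [funext hxk] at hlim
    have h1 := (continuous_fst.tendsto _).comp hlim
    have h2 := ((continuous_fst.comp continuous_snd).tendsto _).comp hlim
    have h3 := ((continuous_snd.comp continuous_snd).tendsto _).comp hlim
    exact ⟨ht, φ, hφ, (Lp.tendsto_Lp_iff_tendsto_eLpNorm'' _ m1 _ hv.1).1 h1,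
      (Lp.tendsto_Lp_iff_tendsto_eLpNorm'' _ m2 _ hv.transportDeriv_spec.1).1 h2,
      (Lp.tendsto_Lp_iff_tendsto_eLpNorm'' _ m3 _ ht).1 h3⟩

variable (Ω U χ) in
/-- The regularity of the domain and of the potential, and a smooth function `χ` that equals the
sign of the normal velocity on the in- and outflow boundary. -/
structure IsTransportSetting : Prop where
  dim_le : n ≤ 3
  domain : IsC6Domain Ω
  potential : MemSobolev Ω 2 5 U
  smooth_sign : ContDiff ℝ ∞ χ
  sign_eq : ∀ x ∈ frontier Ω, |normalVelocity Ω U x| * χ x = normalVelocity Ω U x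

theorem IsTransportSetting.hasTransportDeriv_of_mem (H : IsTransportSetting Ω U χ) {x : Triple Ω U}
    (hx : x ∈ closedGraph Ω U) : HasTransportDeriv Ω U x.1 x.2.1 :=
  Transport.hasTransportDeriv_of_mem H.dim_le H.domain H.potential H.smooth_sign H.sign_eq hx

theorem IsTransportSetting.exists_mem_closedGraph (H : IsTransportSetting Ω U χ) {v f : E n → ℝ}
    (hv : MemLp v 2 (volume.restrict Ω)) (hf : MemLp f 2 (volume.restrict Ω))
    (h : HasTransportDeriv Ω U v f) : ∃ t, (hv.toLp v, hf.toLp f, t) ∈ closedGraph Ω U :=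
  Transport.exists_mem_closedGraph H.dim_le H.domain H.potential H.smooth_sign H.sign_eq hv hf h

/-- The closure is again a graph over the first component: the distributional transport derivative
is determined by the function, and the trace by both through the trace bound. -/
theorem IsTransportSetting.closedGraph_ext (H : IsTransportSetting Ω U χ) {x y : Triple Ω U}
    (hx : x ∈ closedGraph Ω U)
    (hy : y ∈ closedGraph Ω U) (h : x.1 = y.1) : x = y := by
  have h1 : x.2.1 = y.2.1 := Lp.ext ((H.hasTransportDeriv_of_mem hx).ae_eq H.domain
    (Lp.memLp _) (Lp.memLp _) (by rw [h]) (H.hasTransportDeriv_of_mem hy))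
  obtain ⟨K, -, hK⟩ := exists_trace_bound H.dim_le H.domain H.potential H.smooth_sign H.sign_eq
  have h2 := hK _ ((closedGraph Ω U).sub_mem hx hy)
  rw [Prod.fst_sub, Prod.snd_sub, Prod.fst_sub, Prod.snd_sub, h, h1, sub_self, sub_self,
    norm_zero, add_zero, mul_zero] at h2
  exact Prod.ext h (Prod.ext h1 (sub_eq_zero.1 (norm_le_zero_iff.1 h2)))

theorem IsTransportSetting.exists_unique_trace (H : IsTransportSetting Ω U χ) {v : E n → ℝ}
    (hv : MemGraph Ω U v) :
    ∃ t, IsTrace Ω U v t ∧ ∀ t', IsTrace Ω U v t' → t' =ᵐ[weightedSurface Ω U] t := by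
  obtain ⟨t, ht⟩ := H.exists_mem_closedGraph hv.1 hv.transportDeriv_spec.1
    hv.transportDeriv_spec.2
  refine ⟨t, (isTrace_iff H.domain hv (Lp.memLp t)).2 (by rwa [Lp.toLp_coeFn]), fun t' ht' => ?_⟩
  have h := H.closedGraph_ext ((isTrace_iff H.domain hv ht'.1).1 ht') ht rfl
  have h1 : ht'.1.toLp t' = t := congrArg (fun x : Triple Ω U => x.2.2) h
  rw [← h1]
  exact ht'.1.coeFn_toLp.symm

theorem IsTransportSetting.exists_triple (H : IsTransportSetting Ω U χ) {v : E n → ℝ}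
    (hv : MemGraph Ω U v) :
    ∃ x ∈ closedGraph Ω U, x.1 =ᵐ[volume.restrict Ω] v ∧
      x.2.1 =ᵐ[volume.restrict Ω] transportDeriv Ω U v ∧
      x.2.2 =ᵐ[weightedSurface Ω U] trace Ω U v := by
  obtain ⟨t, ht, -⟩ := H.exists_unique_trace hv
  have hex : ∃ t, IsTrace Ω U v t := ⟨t, ht⟩
  have h : IsTrace Ω U v (trace Ω U v) := by
    rw [trace, dif_pos hex]
    exact hex.choose_spec
  exact ⟨_, (isTrace_iff H.domain hv h.1).1 h, hv.1.coeFn_toLp, hv.transportDeriv_spec.1.coeFn_toLp,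
    h.1.coeFn_toLp⟩

theorem IsTransportSetting.memGraph_of_mem (H : IsTransportSetting Ω U χ) {x : Triple Ω U}
    (hx : x ∈ closedGraph Ω U) : MemGraph Ω U x.1 :=
  ⟨Lp.memLp _, _, Lp.memLp _, H.hasTransportDeriv_of_mem hx⟩

/-- On the boundary, `(β·ν)^⊖ = ½ (1 - χ) |β·ν|`. -/
theorem IsTransportSetting.integral_inflowWeight (H : IsTransportSetting Ω U χ) {f : E n → ℝ} :
    ∫ x, inflowWeight Ω U x * f x ∂(surface Ω) =
      ∫ x, (1 / 2 * (1 - χ x)) * f x ∂(weightedSurface Ω U) := by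
  rw [integral_weightedSurface H.domain]
  refine integral_congr_ae ?_
  filter_upwards [ae_surface_mem_frontier Ω] with x hx
  rw [inflowWeight]
  linear_combination (1 / 2 * f x) * H.sign_eq x hx

/-- The graph space of the transport operator. -/
def IsTransportSetting.graphSpace (H : IsTransportSetting Ω U χ) :
    GraphSpace (Lp ℝ 2 (volume.restrict Ω)) (Lp ℝ 2 (weightedSurface Ω U)) where
  graph := closedGraph Ω U
  div := mulL (memLp_lap_top H.dim_le H.domain H.potential)
  sign := mulL (memLp_weightedSurface_of_continuousOn H.domain U
    H.smooth_sign.continuous.continuousOn)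
  isClosed := (smoothGraph Ω U).isClosed_topologicalClosure
  sign_sign := mulL_mulL_sign H.domain _ H.sign_eq
  inner_sign := inner_mulL _
  inner_div := inner_mulL _
  green := fun x hx y hy => green_closedGraph H.dim_le H.domain H.potential _ _ H.sign_eq hx hy
  maximal := fun w f h => by
    obtain ⟨t, ht⟩ := H.exists_mem_closedGraph (Lp.memLp w) (Lp.memLp f)
      (hasTransportDeriv_of_forall_inner H.domain _ h)
    rw [Lp.toLp_coeFn, Lp.toLp_coeFn] at ht
    exact ⟨t, ht⟩
  outflow := fun x hx => by
    have m2 : MemLp (fun y => ⟪velocity Ω U y, gradient χ y⟫) ⊤ (volume.restrict Ω) := by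
      simp only [inner_gradient]
      exact H.domain.memLp_of_continuousOn
        ((H.smooth_sign.continuous_fderiv (by simp)).continuousOn.clm_apply
        (continuousOn_velocity Ω U))
    have h := mul_mem_closedGraph H.smooth_sign
      (H.domain.memLp_of_continuousOn H.smooth_sign.continuous.continuousOn) m2
      (memLp_weightedSurface_of_continuousOn H.domain U H.smooth_sign.continuous.continuousOn) hx
    exact ⟨_, (closedGraph Ω U).smul_mem (1 / 2 : ℝ) ((closedGraph Ω U).add_mem hx h), rfl⟩

theorem IsTransportSetting.inflow_eq_inner (H : IsTransportSetting Ω U χ) {t g : E n → ℝ}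
    {s r : Lp ℝ 2 (weightedSurface Ω U)}
    (hs : s =ᵐ[weightedSurface Ω U] g) (hr : r =ᵐ[weightedSurface Ω U] t) :
    ∫ x, inflowWeight Ω U x * g x * t x ∂(surface Ω) =
      ⟪(1 / 2 : ℝ) • (s - H.graphSpace.sign s), r⟫ := by
  simp only [mul_assoc]
  have h : (1 / 2 : ℝ) • (s - H.graphSpace.sign s) =ᵐ[weightedSurface Ω U]
      fun x => 1 / 2 * (1 - χ x) * g x := by
    filter_upwards [Lp.coeFn_smul (1 / 2 : ℝ) (s - H.graphSpace.sign s),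
      Lp.coeFn_sub s (H.graphSpace.sign s), hs,
      mulL_ae_eq (memLp_weightedSurface_of_continuousOn H.domain U
        H.smooth_sign.continuous.continuousOn) hs] with x h1 h2 h3 h4
    have h5 : H.graphSpace.sign s x = χ x * g x := h4
    rw [h1, Pi.smul_apply, h2, Pi.sub_apply, h3, h5, smul_eq_mul]
    ring
  rw [inner_eq_integral h hr, H.integral_inflowWeight]
  simp only [mul_assoc]

theorem IsTransportSetting.bilin_eq_form (H : IsTransportSetting Ω U χ) (ε : ℝ) {v w : E n → ℝ}
    {x y : Triple Ω U}
    (hx1 : x.1 =ᵐ[volume.restrict Ω] v)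
    (hx2 : x.2.1 =ᵐ[volume.restrict Ω] transportDeriv Ω U v)
    (hx3 : x.2.2 =ᵐ[weightedSurface Ω U] trace Ω U v)
    (hy1 : y.1 =ᵐ[volume.restrict Ω] w) (hy3 : y.2.2 =ᵐ[weightedSurface Ω U] trace Ω U w) :
    bilin Ω U ε v w = H.graphSpace.form ε x y := by
  set G := H.graphSpace with hG
  have h : x.2.1 + ((1 / 2 : ℝ) • G.div x.1 + ε • x.1) =ᵐ[volume.restrict Ω]
      fun z => transportDeriv Ω U v z + (1 / 2 * lap Ω U z + ε) * v z := by
    filter_upwards [Lp.coeFn_add x.2.1 ((1 / 2 : ℝ) • G.div x.1 + ε • x.1),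
      Lp.coeFn_add ((1 / 2 : ℝ) • G.div x.1) (ε • x.1), Lp.coeFn_smul (1 / 2 : ℝ) (G.div x.1),
      Lp.coeFn_smul ε x.1, hx1, hx2, mulL_ae_eq (memLp_lap_top H.dim_le H.domain H.potential) hx1]
      with z h1 h2 h3 h4 h5 h6 h7
    have h8 : G.div x.1 z = lap Ω U z * v z := h7
    rw [h1, Pi.add_apply, h2, Pi.add_apply, h3, Pi.smul_apply, h4, Pi.smul_apply, h5, h6, h8,
      smul_eq_mul, smul_eq_mul]
    ring
  rw [bilin, H.inflow_eq_inner hx3 hy3, GraphSpace.form, inner_eq_integral h hy1]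

/-- Every `w ∈ V` is represented by a triple of the closed graph, and every such triple comes from
some `w ∈ V`. Testing with functions and their chosen traces is thus the same as testing with
triples in the abstract problem. -/
theorem IsTransportSetting.isWeakSolution_iff (H : IsTransportSetting Ω U χ) (σ₀ : E n → ℝ) (ε : ℝ)
    (hσ : MemLp (fun x => √(contRep Ω σ₀ x)) 2 (weightedSurface Ω U)) {v : E n → ℝ}
    {x : Triple Ω U} (hv : MemGraph Ω U v) (hx : x ∈ closedGraph Ω U)
    (hxv : x.1 =ᵐ[volume.restrict Ω] v) :
    IsWeakSolution Ω U σ₀ ε v ↔ ∀ y ∈ closedGraph Ω U,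
      H.graphSpace.form ε x y =
        ⟪(1 / 2 : ℝ) • (hσ.toLp _ - H.graphSpace.sign (hσ.toLp _)), y.2.2⟫ := by
  have key : ∀ {w : E n → ℝ} {y : Triple Ω U}, MemGraph Ω U w → y ∈ closedGraph Ω U →
      y.1 =ᵐ[volume.restrict Ω] w → y.1 =ᵐ[volume.restrict Ω] w ∧
      y.2.1 =ᵐ[volume.restrict Ω] transportDeriv Ω U w ∧
      y.2.2 =ᵐ[weightedSurface Ω U] trace Ω U w := fun hw hy hyw => by
    obtain ⟨z, hz, h1, h2, h3⟩ := H.exists_triple hw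
    rw [H.closedGraph_ext hy hz (Lp.ext (hyw.trans h1.symm))]
    exact ⟨h1, h2, h3⟩
  obtain ⟨hx1, hx2, hx3⟩ := key hv hx hxv
  constructor
  · intro h y hy
    have hw := H.memGraph_of_mem hy
    obtain ⟨hy1, hy2, hy3⟩ := key hw hy (EventuallyEq.refl _ _)
    rw [← H.bilin_eq_form ε hx1 hx2 hx3 hy1 hy3,
      ← H.inflow_eq_inner hσ.coeFn_toLp hy3]
    exact h.2 _ hw
  · refine fun h => ⟨hv, fun w hw => ?_⟩
    obtain ⟨y, hy, hy1, hy2, hy3⟩ := H.exists_triple hw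
    rw [H.bilin_eq_form ε hx1 hx2 hx3 hy1 hy3,
      H.inflow_eq_inner hσ.coeFn_toLp hy3]
    exact h y hy

theorem IsTransportSetting.exists_unique_isWeakSolution (H : IsTransportSetting Ω U χ)
    (σ₀ : E n → ℝ) {ε : ℝ} (hε : 0 < ε) :
    ∃ γ, IsWeakSolution Ω U σ₀ ε γ ∧
      ∀ γ', IsWeakSolution Ω U σ₀ ε γ' → γ' =ᵐ[volume.restrict Ω] γ := by
  have hσ : MemLp (fun x => √(contRep Ω σ₀ x)) 2 (weightedSurface Ω U) :=
    memLp_weightedSurface_of_continuousOn H.domain U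
      (((continuousOn_contRep Ω σ₀).mono frontier_subset_closure).sqrt)
  set G := H.graphSpace with hG
  obtain ⟨x, hx, hform⟩ := G.exists_form_eq hε (hσ.toLp _)
  refine ⟨x.1, (H.isWeakSolution_iff σ₀ ε hσ
    (H.memGraph_of_mem hx) hx (EventuallyEq.refl _ _)).2 hform, fun γ' hγ' => ?_⟩
  obtain ⟨y, hy, hy1, -, -⟩ := H.exists_triple hγ'.1
  have hform' := (H.isWeakSolution_iff σ₀ ε hσ hγ'.1 hy hy1).1 hγ'
  have h : y.1 = x.1 := G.eq_of_form_eq hε hy hx fun z hz =>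
    (hform' z hz).trans (hform z hz).symm
  rw [← h]
  exact hy1.symm

end

end Transport

end

/-! ### The theorem -/

theorem theorem2p1 {n : ℕ} (hn : n = 2 ∨ n = 3)
    (Ω : Set (Transport.E n)) (hΩ : Transport.IsC6Domain Ω)
    (η k₁ : ℝ) (hη : 0 < η) (hηd : η < Metric.diam Ω) (hk₁ : 0 < k₁)
    (σ₀ : Transport.E n → ℝ) (hσ₀ : Transport.MemSobolev Ω ⊤ 2 σ₀)
    (hσ₀_pos : ∀ᵐ x ∂(volume.restrict (Ω \ closure (Transport.innerRegion Ω η))), k₁ ≤ σ₀ x)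
    (g : Transport.E n → ℝ) (hg : Transport.MemH72Boundary Ω g)
    (hg_mean : ∫ x, g x ∂(Transport.surface Ω) = 0)
    (U : Transport.E n → ℝ) (hU : Transport.MemSobolev Ω 2 5 U)
    (hU_mean : ∫ x in Ω, U x = 0)
    (hUg : ∀ᵐ x ∂(Transport.surface Ω),
      Transport.contRep Ω σ₀ x * Transport.normalVelocity Ω U x = g x)
    (hsep : Transport.WellSeparated Ω U) :
    -- every element of the graph space has a trace in `L²(|β · ν|; Γ)`, and only one
    (∀ v, Transport.MemGraph Ω U v →
      ∃ t, Transport.IsTrace Ω U v t ∧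
        ∀ t', Transport.IsTrace Ω U v t' → t' =ᵐ[Transport.weightedSurface Ω U] t) ∧
    -- existence and uniqueness for the regularized problem
    ∀ ε : ℝ, 0 < ε → ε < 1 →
      ∃ γ, Transport.IsWeakSolution Ω U σ₀ ε γ ∧
        ∀ γ', Transport.IsWeakSolution Ω U σ₀ ε γ' → γ' =ᵐ[volume.restrict Ω] γ := by
  have hn3 : n ≤ 3 := by omega
  obtain ⟨χ, hχs, hχ⟩ := hsep.exists_contDiff_sign
  have H : Transport.IsTransportSetting Ω U χ := ⟨hn3, hΩ, hU, hχs, hχ⟩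
  exact ⟨fun v hv => H.exists_unique_trace hv,
    fun ε hε _ => H.exists_unique_isWeakSolution σ₀ hε⟩
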